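/- Let $k$ be a field and $r\ge 1$ an integer. Let $Q_r$ be the cyclic quiver with vertex set $\mathbb Z/r$ and exactly one arrow $j\to j+1$ for every vertex $j$, and let $\Lambda_r=kQ_r/I$, where $I$ is the two-sided ideal generated by all cycles of length $r$ (paths are multiplied from left to right). Modules are right modules. For a vertex $j$ with lazy path $e_j$ let $S_j$ be the one-dimensional simple $\Lambda_r$-module supported at $j$, and let $P_j=e_j\Lambda_r$ be its projective cover. Let $D^b(\Lambda_r)$ be the bounded derived category of finite-dimensional modules, realized as the full subcategory of $D(\Lambda_r)$ (the derived category of all $\Lambda_r$-modules) of the complexes with bounded and finite-dimensional cohomology. An object $S$ of $D^b(\Lambda_r)$ is a $\mathbb P^{\infty,2}$-object if there is a graded $k$-algebra isomorphism $\bigoplus_n\mathrm{Hom}(S,S[n])\cong k[\theta]$ with $\deg\theta=2$, and $\mathrm{hocolim}(S\xrightarrow{\theta}S[2]\xrightarrow{\theta[2]}S[4]\to\cdots)=0$ in $D(\Lambda_r)$. A sequence of objects (or of triangulated subcategories) is semiorthogonal if there are no nonzero morphisms of any degree from a later member to an earlier one; $\langle\ldots\rangle$ is the smallest strictly full triangulated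 subcategory that contains the given objects. A triangulated subcategory of $D^b(\Lambda_r)$ is admissible if its inclusion has a left and a right adjoint; it is proper if $\bigoplus_n\mathrm{Hom}(X,Y[n])$ is finite-dimensional for all its objects $X,Y$; it is smooth if it is generated, as a thick subcategory, by one object whose dg endomorphism algebra $E=\mathrm{RHom}(G,G)$ (computed on a K-projective resolution of the generator $G$) is smooth, i.e. perfect as a dg $E$-bimodule. Then for every vertex $i\in\mathbb Z/r$: (i) $(S_{i+1},S_{i+2},\ldots,S_{i-1})$ (the $r-1$ simple modules other than $S_i$, in this cyclic order; the empty sequence if $r=1$) is a semiorthogonal sequence of $\mathbb P^{\infty,2}$-objects in $D^b(\Lambda_r)$; (ii) with $\mathsf S_i=\langle S_{i+1},\ldots,S_{i-1}\rangle$ there is a semiorthogonal decomposition $D^b(\Lambda_r)=\langle \mathsf S_i,\langle P_i\rangle\rangle$: the subcategories $\mathsf S_i$, $\langle P_i\rangle$ are semiorthogonal and together generate $D^b(\Lambda_r)$ as a triangulated category; (iii) $\mathsf S_i$ absorbs the singularities of $\Lambda_r$: it is admissible in $D^b(\Lambda_r)$, and both orthogonal complements $\mathsf S_i^{\perp}$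 and ${}^{\perp}\mathsf S_i$ are smooth and proper. -/

import Mathlib

open CategoryTheory Limits Pretriangulated Triangulated
open scoped DirectSum

universe u v w

noncomputable section

section PathAlgebra

open Quiver

/-- The path algebra `kQ` of a quiver `Q` with finitely many vertices, with its decomposition
`kQ = ⨁ a b, e_a kQ e_b`, where `e_a kQ e_b` has the paths from `a` to `b` as a basis.
The product `p * q` of two paths is "first `p`, then `q`" (and is zero if this makes no sense). -/
def PathAlgebra (k : Type u) (V : Type) [Quiver.{0} V] [CommRing k] : Type u :=
  ∀ a b : V, Path a b →₀ k

namespace PathAlgebra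

variable {k : Type u} {V : Type} [Quiver.{0} V] [CommRing k]

instance : AddCommGroup (PathAlgebra k V) :=
  inferInstanceAs (AddCommGroup (∀ a b : V, Path a b →₀ k))

instance : Module k (PathAlgebra k V) :=
  inferInstanceAs (Module k (∀ a b : V, Path a b →₀ k))

@[ext]
theorem ext {x y : PathAlgebra k V} (h : ∀ a b, x a b = y a b) : x = y :=
  funext fun a => funext fun b => h a b

theorem add_apply (x y : PathAlgebra k V) (a b : V) : (x + y) a b = x a b + y a b := rfl

theorem smul_apply (s : k) (x : PathAlgebra k V) (a b : V) : (s • x) a b = s • x a b := rfl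

theorem zero_apply (a b : V) : (0 : PathAlgebra k V) a b = 0 := rfl

/-- Bilinear extension of the concatenation of paths. -/
def concat {a b c : V} : (Path a b →₀ k) →ₗ[k] (Path b c →₀ k) →ₗ[k] (Path a c →₀ k) :=
  Finsupp.lsum k fun p => LinearMap.toSpanSingleton k _ (Finsupp.lmapDomain k k p.comp)

theorem concat_single {a b c : V} (p : Path a b) (q : Path b c) (s t : k) :
    concat (Finsupp.single p s) (Finsupp.single q t) = Finsupp.single (p.comp q) (s * t) := by
  simp [concat]

theorem concat_assoc {a b c d : V} (x : Path a b →₀ k) (y : Path b c →₀ k) (z : Path c d →₀ k) :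
    concat (concat x y) z = concat x (concat y z) := by
  induction x using Finsupp.induction_linear with
  | zero => simp
  | add x x' hx hx' => simp [hx, hx']
  | single p s =>
    induction y using Finsupp.induction_linear with
    | zero => simp
    | add y y' hy hy' => simp [hy, hy']
    | single q t =>
      induction z using Finsupp.induction_linear with
      | zero => simp
      | add z z' hz hz' => simp [hz, hz']
      | single r v => simp only [concat_single, Path.comp_assoc, mul_assoc]

theorem nil_concat {a b : V} (x : Path a b →₀ k) :
    concat (Finsupp.single Path.nil 1) x = x := by
  induction x using Finsupp.induction_linear with
  | zero => simp
  | add x x' hx hx' => simp [hx, hx']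
  | single p s => simp [concat_single]

theorem concat_nil {a b : V} (x : Path a b →₀ k) :
    concat x (Finsupp.single Path.nil 1) = x := by
  induction x using Finsupp.induction_linear with
  | zero => simp
  | add x x' hx hx' => simp [hx, hx']
  | single p s => simp [concat_single]

/-- The element of the path algebra given by a path. -/
def ofPath [DecidableEq V] {a b : V} (p : Path a b) : PathAlgebra k V :=
  Pi.single a (Pi.single b (Finsupp.single p 1))

section Mul

variable [Fintype V]

instance : Mul (PathAlgebra k V) where
  mul x y := fun a c => ∑ b : V, concat (x a b) (y b c)

theorem mul_apply (x y : PathAlgebra k V) (a c : V) :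
    (x * y) a c = ∑ b : V, concat (x a b) (y b c) := rfl

end Mul

section One

variable [DecidableEq V]

/-- The unit is the sum of the lazy paths. -/
instance : One (PathAlgebra k V) where
  one := fun a b => if h : a = b then Finsupp.single (h ▸ Path.nil) 1 else 0

theorem one_apply (a b : V) : (1 : PathAlgebra k V) a b =
    if h : a = b then Finsupp.single (h ▸ Path.nil) 1 else 0 := rfl

theorem one_apply_self (a : V) : (1 : PathAlgebra k V) a a = Finsupp.single Path.nil 1 := by
  rw [one_apply, dif_pos rfl]

theorem one_apply_ne {a b : V} (h : a ≠ b) : (1 : PathAlgebra k V) a b = 0 := by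
  rw [one_apply, dif_neg h]

end One

variable [Fintype V] [DecidableEq V]

instance : Ring (PathAlgebra k V) :=
  { (inferInstance : AddCommGroup (PathAlgebra k V)),
    (inferInstance : Mul (PathAlgebra k V)),
    (inferInstance : One (PathAlgebra k V)) with
    left_distrib := fun x y z => by
      ext1 a c
      simp only [mul_apply, add_apply, map_add, Finset.sum_add_distrib]
    right_distrib := fun x y z => by
      ext1 a c
      simp only [mul_apply, add_apply, map_add, LinearMap.add_apply, Finset.sum_add_distrib]
    zero_mul := fun x => by
      ext1 a c
      simp only [mul_apply, zero_apply, map_zero, LinearMap.zero_apply, Finset.sum_const_zero]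
    mul_zero := fun x => by
      ext1 a c
      simp only [mul_apply, zero_apply, map_zero, Finset.sum_const_zero]
    mul_assoc := fun x y z => by
      ext1 a d
      simp only [mul_apply, map_sum, LinearMap.sum_apply, concat_assoc]
      exact Finset.sum_comm
    one_mul := fun x => by
      ext1 a c
      rw [mul_apply, Finset.sum_eq_single a]
      · rw [one_apply_self, nil_concat]
      · intro b _ hb
        rw [one_apply_ne hb.symm, map_zero, LinearMap.zero_apply]
      · simp
    mul_one := fun x => by
      ext1 a c
      rw [mul_apply, Finset.sum_eq_single c]
      · rw [one_apply_self, concat_nil]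
      · intro b _ hb
        rw [one_apply_ne hb, map_zero]
      · simp }

instance : Algebra k (PathAlgebra k V) :=
  Algebra.ofModule
    (fun s x y => by
      ext1 a c
      simp only [mul_apply, smul_apply, map_smul, LinearMap.smul_apply, Finset.smul_sum])
    (fun s x y => by
      ext1 a c
      simp only [mul_apply, smul_apply, map_smul, Finset.smul_sum])

theorem ofPath_mul_ofPath {a b c : V} (p : Path a b) (q : Path b c) :
    (ofPath p * ofPath q : PathAlgebra k V) = ofPath (p.comp q) := by
  ext1 a' c'
  rw [mul_apply, Finset.sum_eq_single b]
  · by_cases ha : a' = a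
    · subst ha
      by_cases hc : c' = c
      · subst hc
        simp [ofPath, concat_single]
      · simp [ofPath, Pi.single_eq_of_ne hc]
    · simp [ofPath, Pi.single_eq_of_ne ha]
  · intro b' _ hb
    simp [ofPath, Pi.single_eq_of_ne hb]
  · simp

theorem span_ofPath : Submodule.span k
    {x : PathAlgebra k V | ∃ (a b : V) (p : Path a b), x = ofPath p} = ⊤ := by
  rw [eq_top_iff]
  intro x _
  let ev : ∀ a b : V, PathAlgebra k V →ₗ[k] (Path a b →₀ k) := fun a b =>
    { toFun := fun x => x a b, map_add' := fun _ _ => rfl, map_smul' := fun _ _ => rfl }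
  let inc : ∀ a b : V, (Path a b →₀ k) →ₗ[k] PathAlgebra k V := fun a b =>
    (LinearMap.single k (fun a : V => ∀ b : V, Path a b →₀ k) a).comp
      (LinearMap.single k (fun b : V => Path a b →₀ k) b)
  have hx : x = ∑ a : V, ∑ b : V, inc a b (x a b) := by
    ext1 a b
    suffices h : ev a b x = ev a b (∑ a : V, ∑ b : V, inc a b (x a b)) from h
    rw [map_sum, Finset.sum_eq_single a, map_sum, Finset.sum_eq_single b]
    · change x a b = (Pi.single a (Pi.single b (x a b)) : ∀ a b : V, Path a b →₀ k) a b
      simp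
    · intro b' _ hb
      change (Pi.single a (Pi.single b' (x a b')) : ∀ a b : V, Path a b →₀ k) a b = 0
      simp [Pi.single_eq_of_ne hb.symm]
    · simp
    · intro a' _ ha
      rw [map_sum, Finset.sum_eq_zero]
      intro b' _
      change (Pi.single a' (Pi.single b' (x a' b')) : ∀ a b : V, Path a b →₀ k) a b = 0
      simp [Pi.single_eq_of_ne ha.symm]
    · simp
  rw [hx]
  refine Submodule.sum_mem _ fun a _ => Submodule.sum_mem _ fun b _ => ?_
  induction x a b using Finsupp.induction_linear with
  | zero => simp
  | add f g hf hg => rw [map_add]; exact Submodule.add_mem _ hf hg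
  | single p s =>
    have h : Finsupp.single p s = s • Finsupp.single p (1 : k) := by simp
    rw [h, map_smul]
    exact Submodule.smul_mem _ _ (Submodule.subset_span ⟨a, b, p, rfl⟩)

/-- The coefficient of the lazy path `e_i`: a character of the path algebra. -/
def lazyCoeff (i : V) : PathAlgebra k V →ₐ[k] k :=
  AlgHom.ofLinearMap
    { toFun := fun x => x i i Path.nil
      map_add' := fun _ _ => rfl
      map_smul' := fun _ _ => rfl }
    (by
      change (1 : PathAlgebra k V) i i Path.nil = 1
      rw [one_apply_self, Finsupp.single_eq_same])
    (fun x y => by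
      have key : ∀ (b : V) (f : Path i b →₀ k) (g : Path b i →₀ k),
          concat f g Path.nil =
            if h : i = b then f (h ▸ Path.nil) * g (h ▸ Path.nil) else 0 := by
        intro b f g
        induction f using Finsupp.induction_linear with
        | zero => simp
        | add f f' hf hf' =>
          rw [map_add, LinearMap.add_apply, Finsupp.add_apply, hf, hf']
          split_ifs <;> simp [add_mul]
        | single p s =>
          induction g using Finsupp.induction_linear with
          | zero => simp
          | add g g' hg hg' =>
            rw [map_add, Finsupp.add_apply, hg, hg']
            split_ifs <;> simp [mul_add]
          | single q t =>
            rw [concat_single]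
            cases q with
            | nil =>
              cases p with
              | nil => simp
              | cons p e =>
                simp
            | cons q e =>
              have h1 : p.comp (q.cons e) ≠ Path.nil := by
                rw [Path.comp_cons]; exact Path.cons_ne_nil _ _
              rw [Finsupp.single_eq_of_ne h1.symm]
              split_ifs with h
              · subst h
                simp
              · rfl
      change (x * y) i i Path.nil = x i i Path.nil * y i i Path.nil
      rw [mul_apply, Finsupp.finsetSum_apply, Finset.sum_eq_single i]
      · rw [key]; simp
      · intro b _ hb
        rw [key, dif_neg hb.symm]
      · simp)

end PathAlgebra

/-- The cyclic quiver: its vertices are the residues modulo `r`, and there is exactly one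
arrow `i ⟶ i + 1` for every vertex `i`, and no other arrow. -/
def CyclicQuiver (r : ℕ) : Type := ZMod r

namespace CyclicQuiver

instance (r : ℕ) : CommRing (CyclicQuiver r) := inferInstanceAs (CommRing (ZMod r))

instance (r : ℕ) : DecidableEq (CyclicQuiver r) := inferInstanceAs (DecidableEq (ZMod r))

instance (r : ℕ) [NeZero r] : Fintype (CyclicQuiver r) := inferInstanceAs (Fintype (ZMod r))

instance (r : ℕ) : Quiver.{0} (CyclicQuiver r) where
  Hom i j := PLift (j = i + 1)

theorem natCast_self (r : ℕ) : (r : CyclicQuiver r) = 0 := ZMod.natCast_self r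

/-- The path of length `n` that starts at `a`. -/
def pathFrom {r : ℕ} (a : CyclicQuiver r) : ℕ → Σ b : CyclicQuiver r, Path a b
  | 0 => ⟨a, Path.nil⟩
  | n + 1 => ⟨(pathFrom a n).1 + 1, (pathFrom a n).2.cons ⟨rfl⟩⟩

theorem pathFrom_fst {r : ℕ} (a : CyclicQuiver r) (n : ℕ) : (pathFrom a n).1 = a + n := by
  induction n with
  | zero => simp [pathFrom]
  | succ n ih => simp [pathFrom, ih, add_assoc]

theorem length_pathFrom {r : ℕ} (a : CyclicQuiver r) (n : ℕ) : (pathFrom a n).2.length = n := by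
  induction n with
  | zero => simp [pathFrom]
  | succ n ih => simp [pathFrom, ih]

theorem eq_pathFrom {r : ℕ} {a b : CyclicQuiver r} (p : Path a b) :
    (⟨b, p⟩ : Σ b : CyclicQuiver r, Path a b) = pathFrom a p.length := by
  induction p with
  | nil => rfl
  | cons p e ih =>
    obtain ⟨rfl⟩ := e
    have h : ∀ q : Σ b : CyclicQuiver r, Path a b, (⟨_, p⟩ : Σ b : CyclicQuiver r, Path a b) = q →
        (⟨_, p.cons ⟨rfl⟩⟩ : Σ b : CyclicQuiver r, Path a b) = ⟨q.1 + 1, q.2.cons ⟨rfl⟩⟩ := by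
      rintro _ rfl
      rfl
    exact h _ ih

end CyclicQuiver

/-- The ideal of the path algebra of the cyclic quiver with `r` vertices that is generated by
the paths of length `r` (each of them is the shortest cycle of positive length at its vertex). -/
def cycleIdeal (k : Type u) [CommRing k] (r : ℕ) [NeZero r] :
    TwoSidedIdeal (PathAlgebra k (CyclicQuiver r)) :=
  TwoSidedIdeal.span {x | ∃ (i : CyclicQuiver r) (p : Path i i),
    p.length = r ∧ x = PathAlgebra.ofPath p}

/-- The algebra `Λ_r`: the path algebra of the cyclic quiver modulo all cycles of length `r`. -/
abbrev CyclicAlgebra (k : Type u) [CommRing k] (r : ℕ) [NeZero r] : Type u :=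
  (cycleIdeal k r).ringCon.Quotient

namespace CyclicAlgebra

variable (k : Type u) [CommRing k] (r : ℕ) [NeZero r]

/-- The quotient map from the path algebra. -/
def mk : PathAlgebra k (CyclicQuiver r) →ₐ[k] CyclicAlgebra k r :=
  { (cycleIdeal k r).ringCon.mk' with
    commutes' := fun _ => rfl }

theorem mk_surjective : Function.Surjective (mk k r) := Quotient.mk''_surjective

theorem mk_eq_zero_iff (x : PathAlgebra k (CyclicQuiver r)) :
    mk k r x = 0 ↔ x ∈ cycleIdeal k r :=
  RingCon.eq _

theorem mk_pathFrom_eq_zero (a : CyclicQuiver r) (n : ℕ) (hn : r ≤ n) :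
    mk k r (PathAlgebra.ofPath (CyclicQuiver.pathFrom a n).2) = 0 := by
  induction n, hn using Nat.le_induction with
  | base =>
    rw [mk_eq_zero_iff]
    have h1 : (CyclicQuiver.pathFrom a r).1 = a := by
      rw [CyclicQuiver.pathFrom_fst, CyclicQuiver.natCast_self, add_zero]
    have h2 := CyclicQuiver.length_pathFrom a r
    generalize CyclicQuiver.pathFrom a r = q at h1 h2
    obtain ⟨b, p⟩ := q
    dsimp only at h1 h2
    subst h1
    exact TwoSidedIdeal.subset_span ⟨_, p, h2, rfl⟩
  | succ n hn ih =>
    let e : (CyclicQuiver.pathFrom a n).1 ⟶ (CyclicQuiver.pathFrom a n).1 + 1 := ⟨rfl⟩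
    suffices h : mk k r (PathAlgebra.ofPath ((CyclicQuiver.pathFrom a n).2.comp e.toPath)) = 0
      from h
    rw [← PathAlgebra.ofPath_mul_ofPath, map_mul, ih, zero_mul]

instance : Module.Finite k (CyclicAlgebra k r) := by
  let f : CyclicQuiver r × Fin r → CyclicAlgebra k r := fun x =>
    mk k r (PathAlgebra.ofPath (CyclicQuiver.pathFrom x.1 x.2).2)
  refine ⟨(Submodule.fg_def).2 ⟨Set.range f, Set.finite_range f, ?_⟩⟩
  have hr : LinearMap.range (mk k r).toLinearMap = ⊤ :=
    LinearMap.range_eq_top.2 (mk_surjective k r)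
  rw [eq_top_iff, ← hr, LinearMap.range_eq_map, ← PathAlgebra.span_ofPath, Submodule.map_span,
    Submodule.span_le]
  rintro _ ⟨_, ⟨a, b, p, rfl⟩, rfl⟩
  have h : mk k r (PathAlgebra.ofPath p) =
      mk k r (PathAlgebra.ofPath (CyclicQuiver.pathFrom a p.length).2) :=
    congrArg (fun q : Σ b : CyclicQuiver r, Path a b => mk k r (PathAlgebra.ofPath q.2))
      (CyclicQuiver.eq_pathFrom p)
  change mk k r (PathAlgebra.ofPath p) ∈ Submodule.span k (Set.range f)
  rw [h]
  by_cases hp : p.length < r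
  · exact Submodule.subset_span ⟨(a, ⟨p.length, hp⟩), rfl⟩
  · rw [mk_pathFrom_eq_zero k r a _ (not_lt.1 hp)]
    exact Submodule.zero_mem _

/-- The class of the lazy path at the vertex `i`. -/
def idem (i : CyclicQuiver r) : CyclicAlgebra k r := mk k r (PathAlgebra.ofPath (Path.nil : Path i i))

theorem cycleIdeal_le_ker (i : CyclicQuiver r) :
    cycleIdeal k r ≤ TwoSidedIdeal.ker (PathAlgebra.lazyCoeff (k := k) i) := by
  rw [cycleIdeal, TwoSidedIdeal.span_le]
  rintro _ ⟨j, p, hp, rfl⟩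
  rw [SetLike.mem_coe, TwoSidedIdeal.mem_ker]
  change (PathAlgebra.ofPath p : PathAlgebra k (CyclicQuiver r)) i i Path.nil = 0
  by_cases h : i = j
  · subst h
    have hne : p ≠ Path.nil := by
      rintro rfl
      exact NeZero.ne r hp.symm
    simp [PathAlgebra.ofPath, hne]
  · simp [PathAlgebra.ofPath, Pi.single_eq_of_ne h]

/-- The character of `Λ_r` given by the coefficient of the lazy path at `i`. -/
def character (i : CyclicQuiver r) : CyclicAlgebra k r →ₐ[k] k :=
  (cycleIdeal k r).ringCon.liftₐ (PathAlgebra.lazyCoeff i)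
    fun _ _ h => TwoSidedIdeal.ringCon_le_iff.1 (cycleIdeal_le_ker k r i) h

/-- The simple right `Λ_r`-module `S_i`: it is `k`, concentrated at the vertex `i`. -/
def simple (k : Type u) [Field k] (r : ℕ) [NeZero r] (i : CyclicQuiver r) :
    ModuleCat.{u} (CyclicAlgebra k r)ᵐᵒᵖ :=
  (ModuleCat.restrictScalars
    ((character k r i).toRingHom.fromOpposite fun _ _ => mul_comm _ _)).obj (ModuleCat.of k k)

/-- The indecomposable projective right `Λ_r`-module `P_i = e_i Λ_r`, the projective cover
of `S_i`. -/
def proj (k : Type u) [Field k] (r : ℕ) [NeZero r] (i : CyclicQuiver r) :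
    ModuleCat.{u} (CyclicAlgebra k r)ᵐᵒᵖ :=
  ModuleCat.of _ (Submodule.span (CyclicAlgebra k r)ᵐᵒᵖ {idem k r i})

end CyclicAlgebra

end PathAlgebra

section BoundedDerived

variable (k : Type u) [Field k] (R : Type u) [Ring R] [Algebra k R]

/-- The `R`-modules that are finite dimensional over `k`. -/
def isFinDim : ObjectProperty (ModuleCat.{u} R) := fun M =>
  Module.Finite k ((ModuleCat.restrictScalars (algebraMap k R)).obj M)

instance : (isFinDim k R).IsSerreClass where
  exists_zero := ⟨ModuleCat.of R PUnit, ModuleCat.isZero_of_subsingleton _, by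
    change Module.Finite k ((ModuleCat.restrictScalars (algebraMap k R)).obj (ModuleCat.of R PUnit))
    have : Finite ((ModuleCat.restrictScalars (algebraMap k R)).obj (ModuleCat.of R PUnit)) :=
      inferInstanceAs (Finite PUnit)
    infer_instance⟩
  prop_of_mono {X Y} f hf hY := by
    have hY' : Module.Finite k ((ModuleCat.restrictScalars (algebraMap k R)).obj Y) := hY
    exact Module.Finite.of_injective ((ModuleCat.restrictScalars (algebraMap k R)).map f).hom
      ((ModuleCat.mono_iff_injective f).1 hf)
  prop_of_epi {X Y} f hf hX := by
    have hX' : Module.Finite k ((ModuleCat.restrictScalars (algebraMap k R)).obj X) := hX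
    exact Module.Finite.of_surjective ((ModuleCat.restrictScalars (algebraMap k R)).map f).hom
      ((ModuleCat.epi_iff_surjective f).1 hf)
  prop_X₂_of_shortExact {S} hS h1 h3 := by
    have h1' : Module.Finite k ((ModuleCat.restrictScalars (algebraMap k R)).obj S.X₁) := h1
    have h3' : Module.Finite k ((ModuleCat.restrictScalars (algebraMap k R)).obj S.X₃) := h3
    let f := ((ModuleCat.restrictScalars (algebraMap k R)).map S.f).hom
    let g := ((ModuleCat.restrictScalars (algebraMap k R)).map S.g).hom
    have hfg : Function.Exact f g :=
      (ShortComplex.ShortExact.moduleCat_exact_iff_function_exact S).1 hS.exact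
    exact Module.Finite.of_exact hfg hS.moduleCat_surjective_g

variable [HasDerivedCategory.{w} (ModuleCat.{u} R)]

/-- The objects of the derived category with finite dimensional cohomology in all degrees. -/
def hasFinDimHomology : ObjectProperty (DerivedCategory (ModuleCat.{u} R)) := fun X =>
  ∀ n : ℤ, isFinDim k R ((DerivedCategory.homologyFunctor _ n).obj X)

instance : (hasFinDimHomology k R).IsClosedUnderIsomorphisms where
  of_iso e h n := (isFinDim k R).prop_of_iso ((DerivedCategory.homologyFunctor _ n).mapIso e) (h n)

open ZeroObject in
instance : (hasFinDimHomology k R).IsTriangulated where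
  exists_zero := ⟨0, isZero_zero _, fun n => (isFinDim k R).prop_of_isZero
    ((DerivedCategory.homologyFunctor _ n).map_isZero (isZero_zero _))⟩
  isStableUnderShiftBy a := ⟨fun X h n => (isFinDim k R).prop_of_iso
    (((DerivedCategory.homologyFunctor (ModuleCat.{u} R) 0).shiftIso a n (a + n) rfl).app X).symm
      (h (a + n))⟩
  ext₂' T hT h1 h3 := ObjectProperty.le_isoClosure _ _ fun n =>
    (isFinDim k R).prop_X₂_of_exact
      ((DerivedCategory.homologyFunctor (ModuleCat.{u} R) n).map_distinguished_exact T hT)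
      (h1 n) (h3 n)

/-- The objects of the derived category with bounded cohomology that is finite dimensional
in all degrees. -/
def isBoundedFinDim : ObjectProperty (DerivedCategory (ModuleCat.{u} R)) :=
  DerivedCategory.TStructure.t.bounded ⊓ hasFinDimHomology k R

instance : (isBoundedFinDim k R).IsClosedUnderIsomorphisms := by
  dsimp only [isBoundedFinDim]
  infer_instance

instance : (isBoundedFinDim k R).IsTriangulated := by
  dsimp only [isBoundedFinDim]
  infer_instance

/-- The bounded derived category of finite dimensional modules over a `k`-algebra `R`, as the
full triangulated subcategory of the derived category of all modules. -/
abbrev BoundedDerived : Type _ := (isBoundedFinDim k R).FullSubcategory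

instance (n : ℤ) : (shiftFunctor (BoundedDerived k R) n).Linear k where
  map_smul f s := by
    apply (isBoundedFinDim k R).ι.map_injective
    rw [← cancel_mono (((isBoundedFinDim k R).ι.commShiftIso n).hom.app _)]
    have h {X Y : BoundedDerived k R} (g : X ⟶ Y) :=
      ((isBoundedFinDim k R).ι.commShiftIso n).hom.naturality g
    dsimp only [Functor.comp_map] at h
    rw [h, Functor.map_smul, Functor.map_smul, Functor.map_smul, Linear.comp_smul,
      Linear.smul_comp, h]

variable {R}

theorem isBoundedFinDim_single {M : ModuleCat.{u} R} (hM : isFinDim k R M) :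
    isBoundedFinDim k R ((DerivedCategory.singleFunctor _ 0).obj M) := by
  refine ⟨⟨⟨0, inferInstance⟩, ⟨0, inferInstance⟩⟩, fun n => ?_⟩
  by_cases hn : n = 0
  · subst hn
    exact (isFinDim k R).prop_of_iso
      ((DerivedCategory.singleFunctorCompHomologyFunctorIso (ModuleCat.{u} R) 0).app M).symm hM
  · refine (isFinDim k R).prop_of_isZero ?_
    rcases lt_or_gt_of_ne hn with h | h
    · exact DerivedCategory.isZero_of_isGE _ 0 n h
    · exact DerivedCategory.isZero_of_isLE _ 0 n h

/-- A finite dimensional module as an object of the bounded derived category. -/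
def BoundedDerived.of (M : ModuleCat.{u} R) (hM : isFinDim k R M) : BoundedDerived k R :=
  ⟨(DerivedCategory.singleFunctor _ 0).obj M, isBoundedFinDim_single k hM⟩

end BoundedDerived

section ExtAlgebra

section
variable {C : Type w} [Category.{v} C] [HasShift C ℤ]

theorem shiftedHom_comp_heq {X Y Z : C} {a b c c' : ℤ} (f : ShiftedHom X Y a)
    (g : ShiftedHom Y Z b) (h : b + a = c) (h' : b + a = c') :
    HEq (f.comp g h) (f.comp g h') := by
  subst h h'
  rfl

instance (X : C) : GradedMonoid.GMul (fun n : ℤ => ShiftedHom X X n) where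
  mul f g := ShiftedHom.comp g f rfl

instance (X : C) : GradedMonoid.GOne (fun n : ℤ => ShiftedHom X X n) where
  one := ShiftedHom.mk₀ 0 rfl (𝟙 X)

theorem shiftedHom_mul_def {X : C} {i j : ℤ} (f : ShiftedHom X X i) (g : ShiftedHom X X j) :
    (GradedMonoid.GMul.mul (A := fun n : ℤ => ShiftedHom X X n) f g : ShiftedHom X X (i + j)) =
      ShiftedHom.comp g f rfl := rfl

end

variable {C : Type w} [Category.{v} C] [Preadditive C] [HasShift C ℤ]
  [∀ n : ℤ, (shiftFunctor C n).Additive]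

instance (X : C) : DirectSum.GRing (fun n : ℤ => ShiftedHom X X n) where
  mul_zero f := ShiftedHom.zero_comp _ _ _ _
  zero_mul g := ShiftedHom.comp_zero _ _ _
  mul_add f g g' := ShiftedHom.add_comp _ _ _ _
  add_mul f f' g := ShiftedHom.comp_add _ _ _ _
  one_mul := by
    rintro ⟨i, f⟩
    refine Sigma.ext (zero_add i) ?_
    refine HEq.trans (shiftedHom_comp_heq _ _ _ (zero_add i)) (heq_of_eq ?_)
    exact ShiftedHom.comp_mk₀_id _ _ _
  mul_one := by
    rintro ⟨i, f⟩
    refine Sigma.ext (add_zero i) ?_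
    refine HEq.trans (shiftedHom_comp_heq _ _ _ (add_zero i)) (heq_of_eq ?_)
    exact ShiftedHom.mk₀_id_comp _ _ _
  mul_assoc := by
    rintro ⟨i, f⟩ ⟨j, g⟩ ⟨l, h⟩
    refine Sigma.ext (add_assoc i j l) ?_
    refine HEq.trans (shiftedHom_comp_heq _ _ _ (add_assoc i j l)) (heq_of_eq ?_)
    exact (ShiftedHom.comp_assoc h g f rfl rfl (add_assoc i j l)).symm
  natCast n := n • ShiftedHom.mk₀ 0 rfl (𝟙 X)
  natCast_zero := zero_nsmul _
  natCast_succ n := succ_nsmul _ n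
  intCast n := n • ShiftedHom.mk₀ 0 rfl (𝟙 X)
  intCast_ofNat n := natCast_zsmul _ n
  intCast_negSucc_ofNat n := negSucc_zsmul _ n

/-- The graded algebra `Ext^•(X, X) = ⨁ n, Hom(X, X[n])`, with the composition as product. -/
abbrev ExtAlgebra (X : C) : Type _ := ⨁ n : ℤ, ShiftedHom X X n

variable (k : Type u) [Field k] [Linear k C] [∀ n : ℤ, (shiftFunctor C n).Linear k]

instance (X : C) : Algebra k (ExtAlgebra X) :=
  Algebra.ofModule
    (fun s x y => by
      induction x using DirectSum.induction_on with
      | zero => simp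
      | add x x' hx hx' => simp only [smul_add, add_mul, hx, hx']
      | of i f =>
        induction y using DirectSum.induction_on with
        | zero => simp
        | add y y' hy hy' => simp only [smul_add, mul_add, hy, hy']
        | of j g =>
          rw [← DirectSum.of_smul, DirectSum.of_mul_of, DirectSum.of_mul_of, ← DirectSum.of_smul,
            shiftedHom_mul_def, shiftedHom_mul_def, ShiftedHom.comp_smul])
    (fun s x y => by
      induction x using DirectSum.induction_on with
      | zero => simp
      | add x x' hx hx' => simp only [smul_add, add_mul, hx, hx']
      | of i f =>
        induction y using DirectSum.induction_on with
        | zero => simp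
        | add y y' hy hy' => simp only [smul_add, mul_add, hy, hy']
        | of j g =>
          rw [← DirectSum.of_smul, DirectSum.of_mul_of, DirectSum.of_mul_of, ← DirectSum.of_smul,
            shiftedHom_mul_def, shiftedHom_mul_def, ShiftedHom.smul_comp])

end ExtAlgebra

section DG

/-- A dg algebra over `k`, as a `k`-algebra with an internal grading and a differential. -/
structure DGAlgebra (k : Type u) [Field k] where
  carrier : Type v
  [ring : Ring carrier]
  [algebra : Algebra k carrier]
  deg : ℤ → Submodule k carrier
  isInternal : DirectSum.IsInternal deg
  one_mem : 1 ∈ deg 0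
  mul_mem : ∀ {i j : ℤ} {x y : carrier}, x ∈ deg i → y ∈ deg j → x * y ∈ deg (i + j)
  d : carrier →ₗ[k] carrier
  d_mem : ∀ {i : ℤ} {x : carrier}, x ∈ deg i → d x ∈ deg (i + 1)
  d_d : ∀ x, d (d x) = 0
  d_mul : ∀ {i : ℤ} {x : carrier} (y : carrier), x ∈ deg i →
    d (x * y) = d x * y + i.negOnePow • (x * d y)

attribute [instance] DGAlgebra.ring DGAlgebra.algebra

/-- A dg bimodule over a dg algebra (with `k` acting centrally). -/
structure DGBimodule {k : Type u} [Field k] (E : DGAlgebra.{u, v} k) where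
  carrier : Type v
  [addCommGroup : AddCommGroup carrier]
  [module : Module k carrier]
  [leftModule : Module E.carrier carrier]
  [rightModule : Module E.carrierᵐᵒᵖ carrier]
  [leftTower : IsScalarTower k E.carrier carrier]
  [rightTower : IsScalarTower k E.carrierᵐᵒᵖ carrier]
  [smulComm : SMulCommClass E.carrier E.carrierᵐᵒᵖ carrier]
  deg : ℤ → Submodule k carrier
  isInternal : DirectSum.IsInternal deg
  smul_mem : ∀ {i j : ℤ} {a : E.carrier} {m : carrier}, a ∈ E.deg i → m ∈ deg j →
    a • m ∈ deg (i + j)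
  op_smul_mem : ∀ {i j : ℤ} {a : E.carrier} {m : carrier}, a ∈ E.deg i → m ∈ deg j →
    MulOpposite.op a • m ∈ deg (j + i)
  d : carrier →ₗ[k] carrier
  d_mem : ∀ {i : ℤ} {m : carrier}, m ∈ deg i → d m ∈ deg (i + 1)
  d_d : ∀ m, d (d m) = 0
  d_smul : ∀ {i : ℤ} {a : E.carrier} (m : carrier), a ∈ E.deg i →
    d (a • m) = E.d a • m + i.negOnePow • (a • d m)
  d_op_smul : ∀ {i : ℤ} (a : E.carrier) {m : carrier}, m ∈ deg i →
    d (MulOpposite.op a • m) =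
      MulOpposite.op a • d m + i.negOnePow • (MulOpposite.op (E.d a) • m)

attribute [instance] DGBimodule.addCommGroup DGBimodule.module DGBimodule.leftModule
  DGBimodule.rightModule DGBimodule.leftTower DGBimodule.rightTower DGBimodule.smulComm

namespace DGBimodule

variable {k : Type u} [Field k] {E : DGAlgebra.{u, v} k}

/-- Morphisms of dg bimodules: closed, of degree zero. -/
structure Hom (M N : DGBimodule E) where
  toLin : M.carrier →ₗ[k] N.carrier
  map_smul : ∀ (a : E.carrier) (m : M.carrier), toLin (a • m) = a • toLin m
  map_op_smul : ∀ (a : E.carrier) (m : M.carrier),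
    toLin (MulOpposite.op a • m) = MulOpposite.op a • toLin m
  map_mem : ∀ {i : ℤ} {m : M.carrier}, m ∈ M.deg i → toLin m ∈ N.deg i
  map_d : ∀ m : M.carrier, toLin (M.d m) = N.d (toLin m)

/-- A quasi-isomorphism: the induced map on `ker d / im d` is injective and surjective. -/
def Hom.IsQuasiIso {M N : DGBimodule E} (f : Hom M N) : Prop :=
  (∀ m : M.carrier, M.d m = 0 → (∃ n : N.carrier, f.toLin m = N.d n) → ∃ m' , m = M.d m') ∧
  (∀ n : N.carrier, N.d n = 0 → ∃ m : M.carrier, M.d m = 0 ∧ ∃ n', f.toLin m - n = N.d n')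

/-- A dg bimodule is free of rank one if it has a closed homogeneous element `x` such that
`E ⊗ E ⟶ F`, `a ⊗ b ↦ a x b` is bijective. Up to isomorphism these are the shifts of `E ⊗ E`. -/
def IsFreeOfRankOne (F : DGBimodule E) : Prop :=
  ∃ (n : ℤ) (x : F.carrier), x ∈ F.deg n ∧ F.d x = 0 ∧
    Function.Bijective (TensorProduct.lift (LinearMap.mk₂ k
      (fun a b : E.carrier => a • (MulOpposite.op b • x))
      (fun a a' b => by rw [add_smul]) (fun s a b => by rw [smul_assoc])
      (fun a b b' => by rw [MulOpposite.op_add, add_smul, smul_add])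
      (fun s a b => by rw [MulOpposite.op_smul, smul_assoc, smul_comm])))

/-- Short exact sequences of dg bimodules. -/
structure IsShortExact {L M N : DGBimodule E} (f : Hom L M) (g : Hom M N) : Prop where
  injective : Function.Injective f.toLin
  exact : Function.Exact f.toLin g.toLin
  surjective : Function.Surjective g.toLin

/-- Perfect dg bimodules: the smallest class of dg bimodules that contains the free ones of rank
one and is closed under quasi-isomorphisms, under the two-out-of-three rule in short exact
sequences, and under direct summands. This is the thick subcategory of the derived category of
dg bimodules that is generated by `E ⊗ E`. -/
inductive IsPerfect : DGBimodule E → Prop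
  | free {F : DGBimodule E} : F.IsFreeOfRankOne → IsPerfect F
  | of_quasiIso {M N : DGBimodule E} (f : Hom M N) : f.IsQuasiIso → IsPerfect M → IsPerfect N
  | of_quasiIso' {M N : DGBimodule E} (f : Hom M N) : f.IsQuasiIso → IsPerfect N → IsPerfect M
  | ext₁ {L M N : DGBimodule E} (f : Hom L M) (g : Hom M N) : IsShortExact f g →
      IsPerfect M → IsPerfect N → IsPerfect L
  | ext₂ {L M N : DGBimodule E} (f : Hom L M) (g : Hom M N) : IsShortExact f g →
      IsPerfect L → IsPerfect N → IsPerfect M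
  | ext₃ {L M N : DGBimodule E} (f : Hom L M) (g : Hom M N) : IsShortExact f g →
      IsPerfect L → IsPerfect M → IsPerfect N
  | retract {M N : DGBimodule E} (i : Hom N M) (p : Hom M N) :
      (∀ n : N.carrier, p.toLin (i.toLin n) = n) → IsPerfect M → IsPerfect N

/-- The diagonal bimodule: the dg algebra as a bimodule over itself. -/
def diagonal (E : DGAlgebra.{u, v} k) : DGBimodule E where
  carrier := E.carrier
  deg := E.deg
  isInternal := E.isInternal
  smul_mem ha hm := E.mul_mem ha hm
  op_smul_mem ha hm := E.mul_mem hm ha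
  d := E.d
  d_mem := E.d_mem
  d_d := E.d_d
  d_smul m ha := E.d_mul m ha
  d_op_smul a _ hm := E.d_mul a hm

end DGBimodule

/-- A dg algebra is smooth if it is perfect as a dg bimodule over itself. -/
def DGAlgebra.IsSmooth {k : Type u} [Field k] (E : DGAlgebra.{u, v} k) : Prop :=
  (DGBimodule.diagonal E).IsPerfect

end DG

section DGEnd

open CochainComplex.HomComplex

variable {C : Type w} [Category.{v} C] [Preadditive C]

theorem cochain_comp_heq {F G K : CochainComplex C ℤ} {a b c c' : ℤ} (f : Cochain F G a)
    (g : Cochain G K b) (h : a + b = c) (h' : a + b = c') :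
    HEq (f.comp g h) (f.comp g h') := by
  subst h h'
  rfl

instance (K : CochainComplex C ℤ) : GradedMonoid.GMul (fun n : ℤ => Cochain K K n) where
  mul {i j} f g := Cochain.comp g f (add_comm j i)

instance (K : CochainComplex C ℤ) : GradedMonoid.GOne (fun n : ℤ => Cochain K K n) where
  one := Cochain.ofHom (𝟙 K)

theorem cochain_mul_def {K : CochainComplex C ℤ} {i j : ℤ} (f : Cochain K K i)
    (g : Cochain K K j) :
    (GradedMonoid.GMul.mul (A := fun n : ℤ => Cochain K K n) f g : Cochain K K (i + j)) =
      Cochain.comp g f (add_comm j i) := rfl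

instance (K : CochainComplex C ℤ) : DirectSum.GRing (fun n : ℤ => Cochain K K n) where
  mul_zero f := Cochain.zero_comp _ _
  zero_mul g := Cochain.comp_zero _ _
  mul_add f g g' := Cochain.add_comp _ _ _ _
  add_mul f f' g := Cochain.comp_add _ _ _ _
  one_mul := by
    rintro ⟨i, f⟩
    refine Sigma.ext (zero_add i) ?_
    exact HEq.trans (cochain_comp_heq f (Cochain.ofHom (𝟙 K)) (add_comm i 0) (add_zero i))
      (heq_of_eq (Cochain.comp_id f))
  mul_one := by
    rintro ⟨i, f⟩
    refine Sigma.ext (add_zero i) ?_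
    exact HEq.trans (cochain_comp_heq (Cochain.ofHom (𝟙 K)) f (add_comm 0 i) (zero_add i))
      (heq_of_eq (Cochain.id_comp f))
  mul_assoc := by
    rintro ⟨i, f⟩ ⟨j, g⟩ ⟨l, h⟩
    refine Sigma.ext (add_assoc i j l) ?_
    have e : l + j + i = i + (j + l) := by omega
    exact HEq.trans
      (cochain_comp_heq h (g.comp f (add_comm j i)) (add_comm l (i + j))
        (show l + (i + j) = i + (j + l) by omega))
      (heq_of_eq (Cochain.comp_assoc h g f (add_comm l j) (add_comm j i) e).symm)
  natCast n := n • Cochain.ofHom (𝟙 K)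
  natCast_zero := zero_nsmul _
  natCast_succ n := succ_nsmul _ n
  intCast n := n • Cochain.ofHom (𝟙 K)
  intCast_ofNat n := natCast_zsmul _ n
  intCast_negSucc_ofNat n := negSucc_zsmul _ n

variable (k : Type u) [Field k] [Linear k C]

instance (K : CochainComplex C ℤ) : Algebra k (⨁ n : ℤ, Cochain K K n) :=
  Algebra.ofModule
    (fun s x y => by
      induction x using DirectSum.induction_on with
      | zero => simp
      | add x x' hx hx' => simp only [smul_add, add_mul, hx, hx']
      | of i f =>
        induction y using DirectSum.induction_on with
        | zero => simp
        | add y y' hy hy' => simp only [smul_add, mul_add, hy, hy']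
        | of j g =>
          rw [← DirectSum.of_smul, DirectSum.of_mul_of, DirectSum.of_mul_of, ← DirectSum.of_smul,
            cochain_mul_def, cochain_mul_def, Cochain.comp_smul])
    (fun s x y => by
      induction x using DirectSum.induction_on with
      | zero => simp
      | add x x' hx hx' => simp only [smul_add, add_mul, hx, hx']
      | of i f =>
        induction y using DirectSum.induction_on with
        | zero => simp
        | add y y' hy hy' => simp only [smul_add, mul_add, hy, hy']
        | of j g =>
          rw [← DirectSum.of_smul, DirectSum.of_mul_of, DirectSum.of_mul_of, ← DirectSum.of_smul,
            cochain_mul_def, cochain_mul_def, Cochain.smul_comp])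

theorem isInternal_range_lof {M : ℤ → Type w} [∀ n, AddCommGroup (M n)] [∀ n, Module k (M n)] :
    DirectSum.IsInternal fun n : ℤ => LinearMap.range (DirectSum.lof k ℤ M n) := by
  let N : ℤ → Submodule k (⨁ n, M n) := fun n => LinearMap.range (DirectSum.lof k ℤ M n)
  let φ : (⨁ n, M n) →ₗ[k] ⨁ n, N n := DirectSum.toModule k ℤ _ fun n =>
    (DirectSum.lof k ℤ (fun n => N n) n).comp (DirectSum.lof k ℤ M n).rangeRestrict
  have h1 : (DirectSum.coeLinearMap N).comp φ = LinearMap.id := by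
    refine DirectSum.linearMap_ext k fun n => LinearMap.ext fun m => ?_
    simp [φ, DirectSum.toModule_lof, DirectSum.coeLinearMap_lof]
  have h2 : φ.comp (DirectSum.coeLinearMap N) = LinearMap.id := by
    refine DirectSum.linearMap_ext k fun n => LinearMap.ext ?_
    rintro ⟨_, m, rfl⟩
    simp only [LinearMap.comp_apply, DirectSum.coeLinearMap_lof, LinearMap.id_apply]
    rw [DirectSum.toModule_lof]
    rfl
  exact Function.bijective_iff_has_inverse.2
    ⟨φ, fun x => LinearMap.congr_fun h2 x, fun x => LinearMap.congr_fun h1 x⟩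

/-- The dg endomorphism algebra of a complex `K`: in degree `n` it consists of the families of
morphisms `K^p ⟶ K^(p+n)`, the product is the composition, the differential is the
differential of the complex of homomorphisms. -/
def dgEnd (K : CochainComplex C ℤ) : DGAlgebra.{u, v} k where
  carrier := ⨁ n : ℤ, Cochain K K n
  deg n := LinearMap.range (DirectSum.lof k ℤ (fun n : ℤ => Cochain K K n) n)
  isInternal := isInternal_range_lof k
  one_mem := ⟨Cochain.ofHom (𝟙 K), rfl⟩
  mul_mem := by
    rintro i j _ _ ⟨f, rfl⟩ ⟨g, rfl⟩
    exact ⟨_, (DirectSum.of_mul_of f g).symm⟩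
  d := DirectSum.toModule k ℤ _ fun n =>
    (DirectSum.lof k ℤ (fun n : ℤ => Cochain K K n) (n + 1)).comp (δ_hom k K K n (n + 1))
  d_mem := by
    rintro i _ ⟨f, rfl⟩
    rw [DirectSum.toModule_lof]
    exact ⟨_, rfl⟩
  d_d := fun x => by
    induction x using DirectSum.induction_on with
    | zero => simp only [map_zero]
    | add x y hx hy => simp only [map_add, hx, hy, add_zero]
    | of n f =>
      rw [← DirectSum.lof_eq_of k, DirectSum.toModule_lof, LinearMap.comp_apply,
        DirectSum.toModule_lof, LinearMap.comp_apply]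
      change DirectSum.lof k ℤ _ _ (δ (n + 1) (n + 1 + 1) (δ n (n + 1) f)) = 0
      rw [δ_δ, map_zero]
  d_mul := by
    rintro i _ y ⟨f, rfl⟩
    induction y using DirectSum.induction_on with
    | zero => simp only [mul_zero, map_zero, smul_zero, add_zero]
    | add y y' hy hy' =>
      simp only [mul_add, map_add, hy, hy', smul_add]
      abel
    | of j g =>
      have key : ∀ (a b c c' : ℤ) (z : Cochain K K a) (z' : Cochain K K b) (h : a + b = c)
          (h' : a + b = c'), DirectSum.of (fun n : ℤ => Cochain K K n) c (z.comp z' h) =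
            DirectSum.of (fun n : ℤ => Cochain K K n) c' (z.comp z' h') := by
        rintro a b c c' z z' rfl rfl
        rfl
      rw [← DirectSum.lof_eq_of k, DirectSum.toModule_lof, DirectSum.toModule_lof,
        DirectSum.lof_eq_of, DirectSum.lof_eq_of, DirectSum.of_mul_of, cochain_mul_def,
        ← DirectSum.lof_eq_of k, DirectSum.toModule_lof]
      simp only [LinearMap.comp_apply, DirectSum.lof_eq_of, DirectSum.of_mul_of, cochain_mul_def]
      change DirectSum.of (fun n : ℤ => Cochain K K n) _ (δ (i + j) (i + j + 1) _) =
        DirectSum.of (fun n : ℤ => Cochain K K n) _ (g.comp (δ i (i + 1) f) _) +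
          i.negOnePow • DirectSum.of (fun n : ℤ => Cochain K K n) _ ((δ j (j + 1) g).comp f _)
      rw [δ_comp g f (add_comm j i) (j + 1) (i + 1) (i + j + 1) rfl rfl rfl, map_add,
        Units.smul_def, Units.smul_def, map_zsmul]
      congr 1
      · exact key _ _ _ _ _ _ _ _
      · congr 1
        exact key _ _ _ _ _ _ _ _

end DGEnd

section Triangulated

variable {T : Type w} [Category.{v} T] [HasZeroObject T] [HasShift T ℤ] [Preadditive T]
  [∀ n : ℤ, (shiftFunctor T n).Additive] [Pretriangulated T]

/-- The triangulated subcategory generated by a class of objects: the smallest strictly full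
triangulated subcategory that contains it. -/
def generatedBy (P : ObjectProperty T) : ObjectProperty T := fun X =>
  ∀ Q : ObjectProperty T, Q.IsTriangulated → Q.IsClosedUnderIsomorphisms → P ≤ Q → Q X

/-- A finite sequence of objects is semiorthogonal if there are no morphisms
of any degree from a later object to an earlier one. -/
def IsSemiorthogonal {m : ℕ} (E : Fin m → T) : Prop :=
  ∀ a b : Fin m, a < b → ∀ (n : ℤ) (f : E b ⟶ (E a)⟦n⟧), f = 0

/-- Semiorthogonal decompositions: triangulated subcategories `𝒜 0, …, 𝒜 (m - 1)` without
nonzero morphisms from a later to an earlier one, which together generate. -/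
structure IsSemiorthogonalDecomposition {m : ℕ} (𝒜 : Fin m → ObjectProperty T) : Prop where
  isTriangulated : ∀ a, (𝒜 a).IsTriangulated
  isClosedUnderIsomorphisms : ∀ a, (𝒜 a).IsClosedUnderIsomorphisms
  semiorthogonal : ∀ a b : Fin m, a < b → 𝒜 a ≤ (𝒜 b).rightOrthogonal
  generate : generatedBy (⨆ a, 𝒜 a) = ⊤

/-- A triangulated subcategory is admissible if its inclusion functor has both a right and a
left adjoint. -/
structure IsAdmissible (P : ObjectProperty T) : Prop where
  isTriangulated : P.IsTriangulated
  rightAdmissible : P.ι.IsLeftAdjoint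
  leftAdmissible : P.ι.IsRightAdjoint

/-- `Y` is a homotopy colimit of the sequence `X 0 ⟶ X 1 ⟶ ⋯`: the third vertex of a
distinguished triangle on `1 - shift : ⨁ X n ⟶ ⨁ X n`. -/
def IsHocolim (X : ℕ → T) (f : ∀ n, X n ⟶ X (n + 1)) (Y : T) : Prop :=
  ∃ (c : Cofan X) (hc : IsColimit c) (g : c.pt ⟶ Y) (h : Y ⟶ c.pt⟦(1 : ℤ)⟧),
    Triangle.mk (𝟙 c.pt - Cofan.IsColimit.desc hc fun n => f n ≫ c.inj (n + 1)) g h ∈ distTriang T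

/-- The maps of the sequence `S ⟶ S[q] ⟶ S[2q] ⟶ ⋯` defined by `θ : S ⟶ S[q]`. -/
def shiftSequenceMap {S : T} {q : ℤ} (θ : ShiftedHom S S q) (n : ℕ) :
    S⟦q * (n : ℤ)⟧ ⟶ S⟦q * ((n + 1 : ℕ) : ℤ)⟧ :=
  θ⟦q * (n : ℤ)⟧' ≫ (shiftFunctorAdd' T q (q * n) (q * ((n + 1 : ℕ) : ℤ))
    (by push_cast; ring)).inv.app S

/-- `ℙ^{∞,q}`-objects of a `k`-linear triangulated category `T'` that is embedded by `F` into
a triangulated category `T` in which the homotopy colimit is taken: the graded algebra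
`Ext^•(S, S)` is a polynomial algebra on a generator `θ` of degree `q`, and
`hocolim (S ⟶ S[q] ⟶ S[2q] ⟶ ⋯) = 0`. -/
def IsPInftyObject (k : Type u) [Field k] {T' : Type*} [Category* T'] [Preadditive T']
    [HasShift T' ℤ] [∀ n : ℤ, (shiftFunctor T' n).Additive] [Linear k T']
    [∀ n : ℤ, (shiftFunctor T' n).Linear k] (F : T' ⥤ T) [F.CommShift ℤ] (q : ℤ) (S : T') : Prop :=
  ∃ (φ : Polynomial k ≃ₐ[k] ExtAlgebra S) (θ : ShiftedHom S S q),
    φ Polynomial.X = DirectSum.of (fun n : ℤ => ShiftedHom S S n) q θ ∧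
    ∃ Y : T, IsHocolim (fun n : ℕ => (F.obj S)⟦q * (n : ℤ)⟧)
      (fun n => shiftSequenceMap (θ.map F) n) Y ∧ IsZero Y

/-- A `k`-linear triangulated (sub)category is proper if the total Hom spaces
`⨁ n, Hom(X, Y[n])` are finite dimensional. -/
def IsProperSubcategory (k : Type u) [Field k] [Linear k T] (P : ObjectProperty T) : Prop :=
  ∀ X Y : T, P X → P Y → Module.Finite k (⨁ n : ℤ, ShiftedHom X Y n)

end Triangulated

section Absorption

variable (k : Type u) [Field k] {R : Type u} [Ring R] [Algebra k R]
  [HasDerivedCategory.{w} (ModuleCat.{u} R)]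

/-- Smoothness of a triangulated subcategory `P` of the bounded derived category, for the
dg enhancement by K-projective complexes: `P` has a classical generator `G` (the smallest thick
subcategory that contains `G` is `P`) such that the dg endomorphism algebra of a K-projective
resolution `K` of `G` is a smooth dg algebra. So `P` is the category of perfect dg modules over a
smooth dg algebra. -/
def IsSmoothSubcategory (P : ObjectProperty (BoundedDerived k R)) : Prop :=
  ∃ (K : CochainComplex (ModuleCat.{u} R) ℤ) (G : BoundedDerived k R),
    K.IsKProjective ∧ Nonempty (G.obj ≅ DerivedCategory.Q.obj K) ∧
    P = (ObjectProperty.singleton G).triangEnvelope ∧ (dgEnd k K).IsSmooth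

/-- A triangulated subcategory absorbs singularities if it is admissible and both of its
orthogonal complements are smooth and proper. -/
structure AbsorbsSingularities (P : ObjectProperty (BoundedDerived k R)) : Prop where
  isAdmissible : IsAdmissible P
  smooth_right : IsSmoothSubcategory k P.rightOrthogonal
  proper_right : IsProperSubcategory k P.rightOrthogonal
  smooth_left : IsSmoothSubcategory k P.leftOrthogonal
  proper_left : IsProperSubcategory k P.leftOrthogonal

end Absorption

namespace CyclicAlgebra

variable (k : Type u) [Field k] (r : ℕ) [NeZero r]

theorem isFinDim_simple (i : CyclicQuiver r) :
    isFinDim k (CyclicAlgebra k r)ᵐᵒᵖ (simple k r i) := by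
  let M := (ModuleCat.restrictScalars (algebraMap k (CyclicAlgebra k r)ᵐᵒᵖ)).obj (simple k r i)
  let f : k →ₗ[k] M :=
    { toFun := fun x => x
      map_add' := fun _ _ => rfl
      map_smul' := fun s x => by
        change s * x = character k r i (algebraMap k (CyclicAlgebra k r) s) * x
        rw [AlgHom.commutes]
        rfl }
  exact Module.Finite.of_surjective f fun x => ⟨x, rfl⟩

theorem isFinDim_proj (i : CyclicQuiver r) :
    isFinDim k (CyclicAlgebra k r)ᵐᵒᵖ (proj k r i) := by
  let M := (ModuleCat.restrictScalars (algebraMap k (CyclicAlgebra k r)ᵐᵒᵖ)).obj (proj k r i)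
  let f : CyclicAlgebra k r →ₗ[k] M :=
    { toFun := fun x => (⟨MulOpposite.op x • idem k r i,
        Submodule.smul_mem _ _ (Submodule.mem_span_singleton_self _)⟩ :
          Submodule.span (CyclicAlgebra k r)ᵐᵒᵖ {idem k r i})
      map_add' := fun x y => Subtype.ext (mul_add _ x y)
      map_smul' := fun s x => Subtype.ext <| by
        change idem k r i * (s • x) = (idem k r i * x) * algebraMap k (CyclicAlgebra k r) s
        rw [mul_smul_comm, ← Algebra.commutes, Algebra.smul_def] }
  refine Module.Finite.of_surjective f ?_
  rintro ⟨x, hx⟩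
  obtain ⟨y, rfl⟩ := Submodule.mem_span_singleton.1 hx
  exact ⟨y.unop, rfl⟩

variable [HasDerivedCategory.{w} (ModuleCat.{u} (CyclicAlgebra k r)ᵐᵒᵖ)]

/-- The simple module `S_i` as an object of the bounded derived category. -/
def simpleObj (i : CyclicQuiver r) : BoundedDerived k (CyclicAlgebra k r)ᵐᵒᵖ :=
  BoundedDerived.of k (simple k r i) (isFinDim_simple k r i)

/-- The projective module `P_i` as an object of the bounded derived category. -/
def projObj (i : CyclicQuiver r) : BoundedDerived k (CyclicAlgebra k r)ᵐᵒᵖ :=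
  BoundedDerived.of k (proj k r i) (isFinDim_proj k r i)

/-- The sequence `(S_{i+1}, …, S_{i-1})` of length `r - 1`. -/
def simpleSeq (i : CyclicQuiver r) (a : Fin (r - 1)) : BoundedDerived k (CyclicAlgebra k r)ᵐᵒᵖ :=
  simpleObj k r (i + 1 + ((a : ℕ) : CyclicQuiver r))

/-- The triangulated subcategory generated by `S_{i+1}, …, S_{i-1}`. -/
def absorbing (i : CyclicQuiver r) : ObjectProperty (BoundedDerived k (CyclicAlgebra k r)ᵐᵒᵖ) :=
  generatedBy (ObjectProperty.ofObj (simpleSeq k r i))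

end CyclicAlgebra

end

/-! Everything rests on two short exact sequences. Among the paths that start at j+1 the longest
nonzero one has length r-1 and ends at j. Hence left multiplication by the arrow at j maps P_{j+1}
onto rad P_j with kernel S_j (`socleSequence_shortExact`). Spliced with rad P_j → P_j → S_j
(`topSequence_shortExact`) this gives a resolution of S_j that repeats with period two and uses only
P_j and P_{j+1}.

Simples. If l is neither j nor j+1, no shift of S_l receives a map from P_j or P_{j+1}, so
`ShiftedHom.eq_zero_of_periodic` kills all maps from S_j to shifts of S_l. Leaving out S_i cuts the
cycle open, and the remaining simples are semiorthogonal. For r ≥ 2 nothing maps from P_{j+1} to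
shifts of S_j, so the product θ of the two connecting morphisms is a periodicity operator on
Ext(S_j, S_j) in degrees ≥ 0. Since degree 0 is k and degree 1 vanishes, the algebra is k[θ]
(`ExtAlgebra.bijective_aeval`). The homotopy colimit vanishes because the objects S_j[2n] have
cohomology in pairwise different degrees: the shift map on their coproduct is zero on cohomology, so
1 - shift is invertible.

Decompositions. For j ≠ i there are no maps from P_i to shifts of S_j, and none from S_j to shifts
of P_{i+1}. For the latter, Hom(P_j, P_{i+1}) and Hom(P_{j+1}, P_{i+1}) are lines spanned by one
path each, and P_{j+1} → P_j carries one path to the other. The radical of P_i has no composition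
factor S_i, so the two sequences recover S_i from the other simples together with either P_i or
P_{i+1}. Thus 𝖲_i has the complement ⟨P_i⟩ on one side and ⟨P_{i+1}⟩ on the other
(`extensionProduct_projObj_absorbing`, `extensionProduct_absorbing_projObj`). This yields both
adjoints and identifies both orthogonals.

Smooth and proper. Each P_j is projective with endomorphism algebra k, so the complements are
generated by an object whose dg endomorphism algebra is k. -/

noncomputable section

/-! ### Generated subcategories and extension products. -/

section Generation

variable {T : Type w} [Category.{v} T] [HasZeroObject T] [HasShift T ℤ] [Preadditive T]
  [∀ n : ℤ, (shiftFunctor T n).Additive] [Pretriangulated T]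

instance generatedBy_isClosedUnderIsomorphisms (P : ObjectProperty T) :
    (generatedBy P).IsClosedUnderIsomorphisms where
  of_iso e h Q hQ hQ' hP := Q.prop_of_iso e (h Q hQ hQ' hP)

instance generatedBy_isTriangulated (P : ObjectProperty T) : (generatedBy P).IsTriangulated where
  exists_zero := ⟨_, isZero_zero T, fun Q _ _ _ => Q.prop_of_isZero (isZero_zero T)⟩
  isStableUnderShiftBy a := ⟨fun _ h Q hQ hQ' hP => Q.le_shift a _ (h Q hQ hQ' hP)⟩
  ext₂' T hT h₁ h₃ := ObjectProperty.le_isoClosure _ _ fun Q hQ hQ' hP =>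
    Q.ext_of_isTriangulatedClosed₂ T hT (h₁ Q hQ hQ' hP) (h₃ Q hQ hQ' hP)

theorem le_generatedBy (P : ObjectProperty T) : P ≤ generatedBy P :=
  fun _ hX _ _ _ hP => hP _ hX

theorem generatedBy_le {P Q : ObjectProperty T} [hQ : Q.IsTriangulated]
    [hQ' : Q.IsClosedUnderIsomorphisms] (h : P ≤ Q) : generatedBy P ≤ Q :=
  fun _ hX => hX Q hQ hQ' h

instance leftOrthogonal_isStableUnderRetracts (P : ObjectProperty T) :
    P.leftOrthogonal.IsStableUnderRetracts where
  of_retract {X Y} r hY Z f hZ := by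
    have := hY (r.r ≫ f) hZ
    rw [← Category.id_comp f, ← r.retract, Category.assoc, this, comp_zero]

/-- Orthogonality may be tested on generators of both subcategories. -/
theorem generatedBy_le_rightOrthogonal_generatedBy {P Q : ObjectProperty T}
    (h : ∀ X Y, P X → Q Y → ∀ (n : ℤ) (f : X ⟶ Y⟦n⟧), f = 0) :
    generatedBy Q ≤ (generatedBy P).rightOrthogonal := by
  -- Closing P under shifts makes its right orthogonal triangulated, so it contains everything that
  -- Q generates. The left orthogonal of the latter is triangulated in turn and contains P.
  have hP : generatedBy P ≤ (generatedBy Q).leftOrthogonal := by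
    have hQ : generatedBy Q ≤ (P.shiftClosure ℤ).rightOrthogonal := by
      refine generatedBy_le ?_
      rintro Y hY X f ⟨X', n, e, hX'⟩
      have : e.inv ≫ f = 0 := by
        obtain ⟨g, hg⟩ := ((shiftEquiv T n).toAdjunction.homEquiv _ _).symm.surjective (e.inv ≫ f)
        have hg₀ : g = 0 := h X' Y hX' hY _ g
        refine hg.symm.trans ((Adjunction.homEquiv_counit _ _ _ _).trans ?_)
        rw [hg₀]
        exact (congrArg (· ≫ _) ((shiftFunctor T n).map_zero _ _)).trans zero_comp
      rw [← cancel_epi e.inv, this, comp_zero]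
    exact generatedBy_le fun X hX Y f hY => hQ Y hY f (P.le_shiftClosure X hX)
  exact fun Y hY X f hX => hP X hX f hY

/-- If there are no morphisms from `P` to `Q`, and `P`, `Q` generate, then every object is an
extension of an object of `Q` by an object of `P`. -/
theorem extensionProduct_eq_top [IsTriangulated T] {P Q : ObjectProperty T} [P.IsTriangulated]
    [P.IsClosedUnderIsomorphisms] [Q.IsTriangulated] [Q.IsClosedUnderIsomorphisms]
    (hPQ : Q ≤ P.rightOrthogonal) (h : generatedBy (P ⊔ Q) = ⊤) :
    ObjectProperty.extensionProduct P Q = ⊤ := by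
  -- An extension in the wrong order splits: its connecting morphism goes from an object of P to a
  -- shifted object of Q.
  have hQP : ObjectProperty.extensionProduct Q P ≤ ObjectProperty.extensionProduct P Q := by
    rintro X ⟨B, A, f, g, δ, hT, hB, hA⟩
    have hδ : δ = 0 := hPQ _ (Q.le_shift (1 : ℤ) _ hB) δ hA
    obtain ⟨e, -, -⟩ := exists_iso_binaryBiproduct_of_distTriang _ hT hδ
    refine ObjectProperty.prop_of_iso _
      (biprod.braiding A B ≪≫ e.symm)
      ⟨A, B, _, _, _, binaryBiproductTriangle_distinguished A B, hA, hB⟩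
  have hE : (ObjectProperty.extensionProduct P Q).IsTriangulated :=
    { exists_zero := ⟨_, isZero_zero T, ObjectProperty.le_extensionProduct_left (Q := Q) _
        (P.prop_of_isZero (isZero_zero T))⟩
      ext₂' := by
        intro S hS h₁ h₃
        apply ObjectProperty.le_isoClosure
        have h2 : ObjectProperty.extensionProduct (ObjectProperty.extensionProduct P Q)
            (ObjectProperty.extensionProduct P Q) S.obj₂ := ⟨_, _, _, _, _, hS, h₁, h₃⟩
        have hPP : ObjectProperty.extensionProduct P P ≤ P :=
          ObjectProperty.extensionProduct_le_of_isTriangulatedClosed₂ le_rfl le_rfl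
        have hQQ : ObjectProperty.extensionProduct Q Q ≤ Q :=
          ObjectProperty.extensionProduct_le_of_isTriangulatedClosed₂ le_rfl le_rfl
        -- (P*Q)*(P*Q) = P*(Q*P)*Q ⊆ P*(P*Q)*Q = (P*P)*(Q*Q) ⊆ P*Q. Associativity of * is where the
        -- octahedral axiom enters.
        rw [ObjectProperty.extensionProduct_assoc, ← ObjectProperty.extensionProduct_assoc Q P Q]
          at h2
        have h3 := ObjectProperty.monotone_extensionProduct_right P
          (ObjectProperty.monotone_extensionProduct_left Q hQP) _ h2
        rw [ObjectProperty.extensionProduct_assoc P Q Q, ← ObjectProperty.extensionProduct_assoc]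
          at h3
        exact ObjectProperty.monotone_extensionProduct_left _ hPP _
          (ObjectProperty.monotone_extensionProduct_right _ hQQ _ h3) }
  rw [eq_top_iff, ← h]
  exact generatedBy_le (sup_le (ObjectProperty.le_extensionProduct_left (Q := Q))
    (ObjectProperty.le_extensionProduct_right (P := P)))

section Exact

variable {X Y Z : T} {f : X ⟶ Y} {g : Y ⟶ Z} {h : Z ⟶ X⟦(1 : ℤ)⟧}

theorem exists_eq_mor₂_comp (hT : Triangle.mk f g h ∈ distTriang T) {W : T}
    (φ : Y ⟶ W) (hφ : f ≫ φ = 0) : ∃ ψ, φ = g ≫ ψ :=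
  Triangle.yoneda_exact₂ _ hT φ hφ

theorem exists_eq_mor₃_comp (hT : Triangle.mk f g h ∈ distTriang T) {W : T}
    (φ : Z ⟶ W) (hφ : g ≫ φ = 0) : ∃ ψ, φ = h ≫ ψ :=
  Triangle.yoneda_exact₃ _ hT φ hφ

theorem exists_eq_comp_mor₁ (hT : Triangle.mk f g h ∈ distTriang T) {W : T}
    (φ : W ⟶ Y) (hφ : φ ≫ g = 0) : ∃ ψ, φ = ψ ≫ f :=
  Triangle.coyoneda_exact₂ _ hT φ hφ

theorem exists_eq_comp_mor₃ (hT : Triangle.mk f g h ∈ distTriang T) {W : T}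
    (φ : W ⟶ X⟦(1 : ℤ)⟧) (hφ : φ ≫ f⟦(1 : ℤ)⟧' = 0) :
    ∃ ψ, φ = ψ ≫ h :=
  Triangle.coyoneda_exact₁ _ hT φ hφ

theorem mor₁_comp_mor₂ (hT : Triangle.mk f g h ∈ distTriang T) : f ≫ g = 0 :=
  comp_distTriang_mor_zero₁₂ _ hT

theorem mor₃_comp_mor₁ (hT : Triangle.mk f g h ∈ distTriang T) :
    h ≫ f⟦(1 : ℤ)⟧' = 0 := comp_distTriang_mor_zero₃₁ _ hT

theorem exists_eq_shift_mor₁_comp (hT : Triangle.mk f g h ∈ distTriang T) {W : T}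
    (φ : X⟦(1 : ℤ)⟧ ⟶ W) (hφ : h ≫ φ = 0) :
    ∃ ψ, φ = f⟦(1 : ℤ)⟧' ≫ ψ := by
  obtain ⟨ψ, hψ⟩ := Triangle.yoneda_exact₃ _ (rot_of_distTriang _ hT) φ hφ
  -- Rotation turns f into -f[1], hence the sign.
  refine ⟨-ψ, ?_⟩
  rw [hψ]
  exact (Preadditive.neg_comp _ _).trans (Preadditive.comp_neg _ _).symm

end Exact

/-! ### Orthogonals and adjoints from a two-term decomposition. -/

section Decomposition

variable {P Q : ObjectProperty T}

/-- Decompose X as A → X → B. If X → B is zero, the identity of B factors through A[1], and maps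
from A[1] to B vanish. So B = 0 and X lies in P. -/
theorem leftOrthogonal_eq_of_extensionProduct [P.IsTriangulated] [P.IsClosedUnderIsomorphisms]
    (hPQ : Q ≤ P.rightOrthogonal) (h : ObjectProperty.extensionProduct P Q = ⊤) :
    Q.leftOrthogonal = P := by
  apply le_antisymm
  · intro X hX
    obtain ⟨A, B, f, g, δ, hT, hA, hB⟩ : ObjectProperty.extensionProduct P Q X := h ▸ trivial
    have hg : g = 0 := hX g hB
    have h0 : IsZero B := by
      rw [IsZero.iff_id_eq_zero]
      obtain ⟨φ, hφ⟩ := exists_eq_mor₃_comp hT (𝟙 B) (by rw [hg, zero_comp])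
      rw [hφ, hPQ _ hB (X := A⟦(1 : ℤ)⟧) φ (P.le_shift _ _ hA)]
      exact comp_zero
    exact P.ext_of_isTriangulatedClosed₂ _ hT hA (P.prop_of_isZero h0)
  · intro X hX Y f hY
    exact hPQ _ hY f hX

/-- Dual argument: if A → X is zero, the identity of A[1] factors through B. -/
theorem rightOrthogonal_eq_of_extensionProduct [P.IsTriangulated] [Q.IsTriangulated]
    [Q.IsClosedUnderIsomorphisms]
    (hPQ : Q ≤ P.rightOrthogonal) (h : ObjectProperty.extensionProduct P Q = ⊤) :
    P.rightOrthogonal = Q := by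
  apply le_antisymm
  · intro X hX
    obtain ⟨A, B, f, g, δ, hT, hA, hB⟩ : ObjectProperty.extensionProduct P Q X := h ▸ trivial
    have hg : f = 0 := hX f hA
    have h0 : IsZero (A⟦(1 : ℤ)⟧) := by
      rw [IsZero.iff_id_eq_zero]
      obtain ⟨φ, hφ⟩ := exists_eq_comp_mor₃ hT (𝟙 _) (by rw [hg, Functor.map_zero, comp_zero])
      rw [hφ, hPQ _ hB φ (P.le_shift _ _ hA)]
      exact zero_comp
    exact Q.ext_of_isTriangulatedClosed₁ _ (rot_of_distTriang _ hT) hB (Q.prop_of_isZero h0)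
  · exact hPQ

/-- The map X → B of the decomposition triangle is universal among maps to Q: existence of
factorizations needs no maps from A, uniqueness none from A[1]. -/
theorem isRightAdjoint_ι_of_extensionProduct [P.IsTriangulated]
    (hPQ : Q ≤ P.rightOrthogonal) (h : ObjectProperty.extensionProduct P Q = ⊤) :
    Q.ι.IsRightAdjoint := by
  have hX : ∀ X : T, ∃ (B : Q.FullSubcategory) (g : X ⟶ B.obj), ∀ Y : Q.FullSubcategory,
      Function.Bijective (fun f : B ⟶ Y => g ≫ Q.ι.map f) := by
    intro X
    obtain ⟨A, B, f, g, δ, hT, hA, hB⟩ : ObjectProperty.extensionProduct P Q X := h ▸ trivial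
    refine ⟨⟨B, hB⟩, g, fun Y => ⟨fun φ ψ hφψ => ?_, fun φ => ?_⟩⟩
    · apply Q.ι.map_injective
      rw [← sub_eq_zero]
      obtain ⟨χ, hχ⟩ := exists_eq_mor₃_comp hT (Q.ι.map φ - Q.ι.map ψ)
        ((Preadditive.comp_sub _ _ _).trans (sub_eq_zero.2 hφψ))
      rw [hχ, hPQ _ Y.property (X := A⟦(1 : ℤ)⟧) χ (P.le_shift _ _ hA)]
      exact comp_zero
    · obtain ⟨χ, hχ⟩ := exists_eq_mor₂_comp hT φ (hPQ _ Y.property _ hA)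
      exact ⟨Q.fullyFaithfulι.preimage χ, hχ.symm⟩
  choose B g hg using hX
  exact ⟨_, ⟨Adjunction.adjunctionOfEquivLeft (G := Q.ι)
    (fun X Y => Equiv.ofBijective _ (hg X Y)) (by intros; simp)⟩⟩

/-- The map A → X is universal among maps from P, since P has no maps to B or B[-1]. -/
theorem isLeftAdjoint_ι_of_extensionProduct [Q.IsTriangulated]
    (hPQ : Q ≤ P.rightOrthogonal) (h : ObjectProperty.extensionProduct P Q = ⊤) :
    P.ι.IsLeftAdjoint := by
  have hX : ∀ X : T, ∃ (A : P.FullSubcategory) (f : A.obj ⟶ X), ∀ Y : P.FullSubcategory,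
      Function.Bijective (fun φ : Y ⟶ A => P.ι.map φ ≫ f) := by
    intro X
    obtain ⟨A, B, f, g, δ, hT, hA, hB⟩ : ObjectProperty.extensionProduct P Q X := h ▸ trivial
    refine ⟨⟨A, hA⟩, f, fun Y => ⟨fun φ ψ hφψ => ?_, fun φ => ?_⟩⟩
    · apply P.ι.map_injective
      rw [← sub_eq_zero]
      obtain ⟨χ, hχ⟩ := exists_eq_comp_mor₁ (inv_rot_of_distTriang _ hT)
        (P.ι.map φ - P.ι.map ψ) ((Preadditive.sub_comp _ _ _).trans (sub_eq_zero.2 hφψ))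
      rw [hχ, hPQ _ (Q.le_shift (-1 : ℤ) _ hB) χ Y.property]
      exact zero_comp
    · obtain ⟨χ, hχ⟩ := exists_eq_comp_mor₁ hT φ (hPQ _ hB _ Y.property)
      exact ⟨P.fullyFaithfulι.preimage χ, hχ.symm⟩
  choose A f hf using hX
  exact ⟨_, ⟨Adjunction.adjunctionOfEquivRight (F := P.ι)
    (fun Y X => (Equiv.ofBijective _ (hf X Y)).symm) (by
      intro X' X Y f g
      rw [Equiv.symm_apply_eq]
      simp only [Equiv.ofBijective_apply, Functor.map_comp, Category.assoc]
      congr 1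
      exact ((Equiv.ofBijective _ (hf Y X)).apply_symm_apply g).symm)⟩⟩

end Decomposition

end Generation

/-! ### Long exact sequences of graded morphisms and two-periodic resolutions. -/

section ShiftedHomExact

variable {T : Type w} [Category.{v} T] [HasZeroObject T] [HasShift T ℤ] [Preadditive T]
  [∀ n : ℤ, (shiftFunctor T n).Additive] [Pretriangulated T]

section

variable {X Y Z : T} {f : X ⟶ Y} {g : Y ⟶ Z} {h : ShiftedHom Z X (1 : ℤ)}

/-- Exactness of Hom(-, W[n]), with the map out of X[1] desuspended. The connecting map becomes the
graded product with h, a form that can be iterated. -/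
theorem ShiftedHom.exists_eq_mor₃_comp (hT : Triangle.mk f g h ∈ distTriang T) {W : T}
    {m n : ℤ} (hmn : m + 1 = n)
    (φ : ShiftedHom Z W n) (hφ : g ≫ φ = 0) : ∃ ψ : ShiftedHom X W m, φ = h.comp ψ hmn := by
  obtain ⟨ψ, hψ⟩ := _root_.exists_eq_mor₃_comp hT φ hφ
  obtain ⟨χ, hχ⟩ := (shiftFunctor T (1 : ℤ)).map_surjective
    (ψ ≫ (shiftFunctorAdd' T m 1 n hmn).hom.app W)
  refine ⟨χ, ?_⟩
  rw [ShiftedHom.comp, hχ, Category.assoc, Iso.hom_inv_id_app, Category.comp_id, hψ]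

theorem ShiftedHom.exists_eq_mor₁_comp (hT : Triangle.mk f g h ∈ distTriang T) {W : T}
    {m n : ℤ} (hmn : m + 1 = n)
    (φ : ShiftedHom X W m) (hφ : h.comp φ hmn = 0) :
    ∃ ψ : ShiftedHom Y W m, φ = f ≫ ψ := by
  have hφ' : h ≫ φ⟦(1 : ℤ)⟧' = 0 := by
    rw [ShiftedHom.comp, ← Category.assoc] at hφ
    rw [← cancel_mono ((shiftFunctorAdd' T m 1 n hmn).inv.app W), hφ, zero_comp]
  obtain ⟨ψ, hψ⟩ := exists_eq_shift_mor₁_comp hT _ hφ'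
  obtain ⟨χ, rfl⟩ := (shiftFunctor T (1 : ℤ)).map_surjective ψ
  refine ⟨χ, (shiftFunctor T (1 : ℤ)).map_injective ?_⟩
  rw [hψ, Functor.map_comp]

theorem ShiftedHom.mor₃_comp_mor₁_comp (hT : Triangle.mk f g h ∈ distTriang T) {W : T}
    {m n : ℤ} (hmn : m + 1 = n)
    (ψ : ShiftedHom Y W m) : h.comp (show ShiftedHom X W m from f ≫ ψ) hmn = 0 := by
  rw [ShiftedHom.comp, Functor.map_comp, Category.assoc, ← Category.assoc, mor₃_comp_mor₁ hT,
    zero_comp]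

end

section Periodic

variable {S M P P' : T} {i : M ⟶ P} {p : P ⟶ S} {α : ShiftedHom S M (1 : ℤ)}
  {j : S ⟶ P'} {q : P' ⟶ M} {β : ShiftedHom M S (1 : ℤ)}

/-- If `S` has a two-periodic resolution by `P` and `P'`, and `P' ⟶ P` induces isomorphisms
on morphisms to all shifts of `N`, then `S` has no morphisms to the shifts of `N`, if this
holds for the negative shifts. -/
theorem ShiftedHom.eq_zero_of_periodic {N : T}
    (h₁ : Triangle.mk i p α ∈ distTriang T) (h₂ : Triangle.mk j q β ∈ distTriang T)
    (hN : ∀ n : ℤ, Function.Bijective fun φ : P ⟶ N⟦n⟧ => (q ≫ i) ≫ φ)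
    (hneg : ∀ n : ℤ, n < 0 → ∀ φ : S ⟶ N⟦n⟧, φ = 0) (n : ℤ) (φ : S ⟶ N⟦n⟧) : φ = 0 := by
  -- One turn through the resolution lowers the degree by two, so induction on an upper bound for
  -- the degree reaches `hneg`.
  suffices H : ∀ (m : ℕ) (n : ℤ), n < m → ∀ φ : S ⟶ N⟦n⟧, φ = 0 from
    H (n.toNat + 1) n (by push_cast; omega) φ
  clear φ n
  intro m
  induction m with
  | zero => exact fun n hn => hneg n (by simpa using hn)
  | succ m ih =>
    intro n hn φ
    -- Injectivity on maps from P: p ≫ φ dies after composition with q ≫ i because i ≫ p = 0.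
    have hpφ : p ≫ φ = 0 := (hN n).1 (by
      have := mor₁_comp_mor₂ h₁
      simp only [Category.assoc, comp_zero, reassoc_of% this, zero_comp])
    obtain ⟨g, rfl⟩ := ShiftedHom.exists_eq_mor₃_comp h₁ (sub_add_cancel n 1) φ hpφ
    -- Surjectivity gives a map on P whose restriction to M agrees with g after composition with q.
    -- Such a restriction is annihilated by α, so it may be subtracted from g.
    obtain ⟨χ, hχ⟩ := (hN (n - 1)).2 (q ≫ g)
    have hq : q ≫ (g - i ≫ χ) = 0 := by
      rw [Preadditive.comp_sub, ← Category.assoc, sub_eq_zero]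
      exact hχ.symm
    obtain ⟨ψ, hψ⟩ := ShiftedHom.exists_eq_mor₃_comp h₂ (sub_add_cancel (n - 1) 1) _ hq
    rw [ih (n - 1 - 1) (by push_cast at hn; omega) ψ, ShiftedHom.comp_zero, sub_eq_zero] at hψ
    rw [hψ]
    exact ShiftedHom.mor₃_comp_mor₁_comp h₁ _ χ

/-- Dimension shifting twice. The obstructions are maps from P' in degrees m and m+1, which always
vanish, and maps from P in degrees m+1 and m+2, which vanish because m ≥ 0 excludes degree zero. -/
theorem ShiftedHom.bijective_comp_of_periodic
    (h₁ : Triangle.mk i p α ∈ distTriang T) (h₂ : Triangle.mk j q β ∈ distTriang T)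
    (hP' : ∀ (n : ℤ) (φ : P' ⟶ S⟦n⟧), φ = 0)
    (hP : ∀ n : ℤ, n ≠ 0 → ∀ φ : P ⟶ S⟦n⟧, φ = 0)
    {m n : ℤ} (hmn : m + (1 + 1) = n) (hm : 0 ≤ m) :
    Function.Bijective fun φ : ShiftedHom S S m => (α.comp β rfl).comp φ hmn := by
  have key : ∀ φ : ShiftedHom S S m, (α.comp β rfl).comp φ hmn =
      α.comp (β.comp φ rfl) (by omega) := fun φ => ShiftedHom.comp_assoc _ _ _ _ _ (by omega)
  constructor
  · suffices H : ∀ φ : ShiftedHom S S m, (α.comp β rfl).comp φ hmn = 0 → φ = 0 by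
      intro φ ψ hφψ
      rw [← sub_eq_zero]
      apply H
      rw [sub_eq_add_neg, ShiftedHom.comp_add, ShiftedHom.comp_neg, ← sub_eq_add_neg, sub_eq_zero]
      exact hφψ
    intro φ hφ
    rw [key] at hφ
    obtain ⟨ψ, hψ⟩ := ShiftedHom.exists_eq_mor₁_comp h₁ _ _ hφ
    rw [hP _ (by omega) ψ, comp_zero] at hψ
    obtain ⟨χ, hχ⟩ := ShiftedHom.exists_eq_mor₁_comp h₂ _ _ hψ
    rw [hχ, hP' _ χ, comp_zero]
  · intro φ
    obtain ⟨ψ, rfl⟩ := ShiftedHom.exists_eq_mor₃_comp h₁ (m := m + 1) (by omega) φ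
      (hP _ (by omega) _)
    obtain ⟨χ, rfl⟩ := ShiftedHom.exists_eq_mor₃_comp h₂ (m := m) (by omega) ψ (hP' _ _)
    exact ⟨χ, key χ⟩

/-- The same shifting, started in degree 1, ends with a map of degree -1. -/
theorem ShiftedHom.eq_zero_of_periodic_one
    (h₁ : Triangle.mk i p α ∈ distTriang T) (h₂ : Triangle.mk j q β ∈ distTriang T)
    (hP' : ∀ (n : ℤ) (φ : P' ⟶ S⟦n⟧), φ = 0)
    (hP : ∀ n : ℤ, n ≠ 0 → ∀ φ : P ⟶ S⟦n⟧, φ = 0)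
    (hneg : ∀ φ : S ⟶ S⟦(-1 : ℤ)⟧, φ = 0)
    (φ : S ⟶ S⟦(1 : ℤ)⟧) : φ = 0 := by
  obtain ⟨ψ, rfl⟩ := ShiftedHom.exists_eq_mor₃_comp h₁ (zero_add 1) φ (hP _ one_ne_zero _)
  obtain ⟨χ, rfl⟩ := ShiftedHom.exists_eq_mor₃_comp h₂ (neg_add_cancel 1) ψ (hP' _ _)
  rw [hneg χ, ShiftedHom.comp_zero, ShiftedHom.comp_zero]

end Periodic

end ShiftedHomExact

/-! ### Recognizing a polynomial Ext algebra. -/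

section PolynomialExt

variable {C : Type w} [Category.{v} C] [Preadditive C] [HasShift C ℤ]
  [∀ n : ℤ, (shiftFunctor C n).Additive] (k : Type u) [Field k] [Linear k C]
  [∀ n : ℤ, (shiftFunctor C n).Linear k]

/-- In the Ext algebra x * y means "first y, then x", so right multiplication by θ is precomposition
with θ. -/
theorem ExtAlgebra.mul_of_apply {S : C} {q : ℤ} (θ : ShiftedHom S S q) (x : ExtAlgebra S)
    (m n : ℤ) (hmn : m + q = n) :
    (x * DirectSum.of (fun n : ℤ => ShiftedHom S S n) q θ) n = θ.comp (x m) hmn := by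
  subst hmn
  induction x using DirectSum.induction_on with
  | zero => simp
  | add x y hx hy => simp [add_mul, hx, hy]
  | of l f =>
    rw [DirectSum.of_mul_of, shiftedHom_mul_def]
    by_cases hl : l = m
    · subst hl
      rw [DirectSum.of_eq_same, DirectSum.of_eq_same]
    · rw [DirectSum.of_eq_of_ne _ _ _ (by omega), DirectSum.of_eq_of_ne _ _ _ (Ne.symm hl),
        ShiftedHom.comp_zero]

/-- If `Ext^•(S, S)` is concentrated in nonnegative even degrees and scalar in degree zero, and
the product with `θ` in degree two is bijective, it is the polynomial algebra on `θ`. -/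
theorem ExtAlgebra.bijective_aeval {S : C} (θ : ShiftedHom S S (2 : ℤ))
    (hneg : ∀ n : ℤ, n < 0 → ∀ φ : ShiftedHom S S n, φ = 0)
    (hone : ∀ φ : ShiftedHom S S (1 : ℤ), φ = 0)
    (hzero : ∀ φ : S ⟶ S, ∃ c : k, φ = c • 𝟙 S) (hS : 𝟙 S ≠ 0)
    (hθ : ∀ m n : ℤ, ∀ hmn : m + 2 = n, 0 ≤ m →
      Function.Bijective fun φ : ShiftedHom S S m => θ.comp φ hmn) :
    Function.Bijective (Polynomial.aeval (R := k)
      (DirectSum.of (fun n : ℤ => ShiftedHom S S n) 2 θ : ExtAlgebra S)) := by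
  set t : ExtAlgebra S := DirectSum.of (fun n : ℤ => ShiftedHom S S n) 2 θ with ht
  have hone' : (1 : ExtAlgebra S) = DirectSum.of (fun n : ℤ => ShiftedHom S S n) 0
    (ShiftedHom.mk₀ 0 rfl (𝟙 S)) := rfl
  constructor
  · rw [injective_iff_map_eq_zero]
    intro p hp
    induction hd : p.natDegree using Nat.strong_induction_on generalizing p with
    | _ d ih =>
    -- Split p as `divX` times X plus its constant term. The degree-zero component will kill the
    -- constant, and then θ can be cancelled.
    have hp' : Polynomial.aeval t p.divX * t + p.coeff 0 • 1 = 0 := by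
      rw [← Polynomial.divX_mul_X_add p, map_add, map_mul, Polynomial.aeval_X,
        Polynomial.aeval_C, Algebra.algebraMap_eq_smul_one] at hp
      exact hp
    have h0 : p.coeff 0 = 0 := by
      have := congrArg (fun x : ExtAlgebra S => x 0) hp'
      dsimp only at this
      -- The degree-zero part of a multiple of θ comes from degree -2.
      have e : (Polynomial.aeval t p.divX * t) 0 = 0 := by
        rw [ht, mul_of_apply θ _ (-2) 0 (by norm_num), ← ht,
          hneg (-2) (by norm_num) (Polynomial.aeval t p.divX (-2)), ShiftedHom.comp_zero]
      rw [DirectSum.add_apply, e, zero_add, DirectSum.smul_apply, hone',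
        DirectSum.of_eq_same, DirectSum.zero_apply, smul_eq_zero] at this
      refine this.resolve_right fun h => hS ?_
      exact (ShiftedHom.homEquiv (0 : ℤ) rfl).injective (by simpa using h)
    rw [h0, zero_smul, add_zero] at hp'
    have hdiv : Polynomial.aeval t p.divX = 0 := by
      refine DFinsupp.ext fun n => ?_
      by_cases hn : n < 0
      · exact hneg n hn _
      · apply (hθ n (n + 2) rfl (not_lt.1 hn)).1
        have := congrArg (fun x : ExtAlgebra S => x (n + 2)) hp'
        dsimp only at this
        rw [ht, mul_of_apply θ _ n (n + 2) rfl] at this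
        dsimp only
        refine this.trans ?_
        exact (ShiftedHom.comp_zero _ _ _).symm
    -- Constants are separated because `divX` lowers only a positive degree.
    by_cases hd0 : d = 0
    · rw [Polynomial.eq_C_of_natDegree_eq_zero (hd.trans hd0), h0, map_zero]
    · have := ih _ (by rw [Polynomial.natDegree_divX_eq_natDegree_tsub_one]; omega) p.divX hdiv rfl
      rw [← Polynomial.divX_mul_X_add p, this, h0]
      simp
  · suffices H : ∀ (m : ℕ) (n : ℤ), n < m → ∀ φ : ShiftedHom S S n,
        DirectSum.of (fun n : ℤ => ShiftedHom S S n) n φ ∈ (Polynomial.aeval (R := k) t).range by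
      intro x
      change x ∈ (Polynomial.aeval (R := k) t).range
      induction x using DirectSum.induction_on with
      | zero => exact zero_mem _
      | add x y hx hy => exact add_mem hx hy
      | of n φ => exact H (n.toNat + 1) n (by push_cast; omega) φ
    intro m
    induction m with
    | zero =>
      intro n hn φ
      rw [hneg n (by simpa using hn) φ, map_zero]
      exact zero_mem _
    | succ m ih =>
      intro n hn φ
      obtain hn' | rfl | rfl | hn' : n < 0 ∨ n = 0 ∨ n = 1 ∨ 2 ≤ n := by omega
      · rw [hneg n hn' φ, map_zero]
        exact zero_mem _
      · obtain ⟨f, rfl⟩ := (ShiftedHom.homEquiv (0 : ℤ) rfl).surjective φ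
        obtain ⟨c, rfl⟩ := hzero f
        rw [ShiftedHom.homEquiv_apply, ShiftedHom.mk₀_smul, DirectSum.of_smul]
        exact Subalgebra.smul_mem _ (one_mem _) c
      · rw [hone φ, map_zero]
        exact zero_mem _
      · obtain ⟨ψ, rfl⟩ := (hθ (n - 2) n (by omega) (by omega)).2 φ
        have : DirectSum.of (fun n : ℤ => ShiftedHom S S n) n
            (θ.comp ψ (by omega)) =
            DirectSum.of (fun n : ℤ => ShiftedHom S S n) (n - 2) ψ * t := by
          refine DFinsupp.ext fun l => ?_
          refine Eq.trans ?_ (mul_of_apply θ _ (l - 2) l (by omega)).symm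
          by_cases hl : n = l
          · subst hl
            rw [DirectSum.of_eq_same, DirectSum.of_eq_same]
          · rw [DirectSum.of_eq_of_ne _ _ _ (Ne.symm hl), DirectSum.of_eq_of_ne _ _ _ (by omega),
              ShiftedHom.comp_zero]
        dsimp only
        rw [this]
        exact mul_mem (ih (n - 2) (by push_cast at hn; omega) ψ) ⟨Polynomial.X, Polynomial.aeval_X _⟩

end PolynomialExt

/-! ### Finite-dimensional total morphism spaces. -/

section Proper

theorem Module.Finite.of_exact_of_finite {k V₁ V₂ V₃ : Type*} [Field k] [AddCommGroup V₁]
    [AddCommGroup V₂] [AddCommGroup V₃] [Module k V₁] [Module k V₂] [Module k V₃]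
    [Module.Finite k V₁] [Module.Finite k V₃] {f : V₁ →ₗ[k] V₂} {g : V₂ →ₗ[k] V₃}
    (h : Function.Exact f g) : Module.Finite k V₂ := by
  refine Module.Finite.of_exact (f := f) (g := g.rangeRestrict) (fun x => ?_)
    g.surjective_rangeRestrict
  rw [← h x, Subtype.ext_iff]
  rfl

variable {T : Type w} [Category.{v} T] [HasShift T ℤ] [Preadditive T] (k : Type u) [Field k]
  [Linear k T]

/-- The total space of morphisms from `X` to the shifts of `Y` is finite dimensional. -/
def HasFiniteTotalHom (X Y : T) : Prop :=
  (∀ n : ℤ, Module.Finite k (X ⟶ Y⟦n⟧)) ∧ ∃ N : ℕ, ∀ n : ℤ, N < n.natAbs → ∀ f : X ⟶ Y⟦n⟧, f = 0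

variable {k}

theorem HasFiniteTotalHom.finite {X Y : T} (h : HasFiniteTotalHom k X Y) :
    Module.Finite k (⨁ n : ℤ, ShiftedHom X Y n) := by
  obtain ⟨h, N, hN⟩ := h
  have : ∀ n : ℤ, Module.Finite k (ShiftedHom X Y n) := h
  let s : Finset ℤ := Finset.Icc (-N) N
  let φ : (∀ n : s, ShiftedHom X Y n.1) →ₗ[k] ⨁ n : ℤ, ShiftedHom X Y n :=
    ∑ n : s, (DirectSum.lof k ℤ (fun n => ShiftedHom X Y n) n.1).comp (LinearMap.proj n)
  refine Module.Finite.of_surjective φ fun x => ?_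
  change x ∈ LinearMap.range φ
  induction x using DirectSum.induction_on with
  | zero => exact zero_mem _
  | add x y hx hy => exact add_mem hx hy
  | of n f =>
    by_cases hn : N < n.natAbs
    · rw [hN n hn f, map_zero]
      exact zero_mem _
    · have hs : n ∈ s := by
        rw [Finset.mem_Icc]
        omega
      refine ⟨Pi.single ⟨n, hs⟩ f, ?_⟩
      rw [LinearMap.sum_apply, Finset.sum_eq_single ⟨n, hs⟩]
      · simp [DirectSum.lof_eq_of]
      · intro b _ hb
        simp [Pi.single_eq_of_ne hb]
      · simp

theorem HasFiniteTotalHom.of_surjective {X Y X' Y' : T} (a : ℤ)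
    (h : HasFiniteTotalHom k X Y)
    (H : ∀ n : ℤ, ∃ φ : (X ⟶ Y⟦n + a⟧) →ₗ[k] (X' ⟶ Y'⟦n⟧), Function.Surjective φ) :
    HasFiniteTotalHom k X' Y' := by
  obtain ⟨h, N, hN⟩ := h
  refine ⟨fun n => ?_, N + a.natAbs, fun n hn f => ?_⟩
  · obtain ⟨φ, hφ⟩ := H n
    have := h (n + a)
    exact Module.Finite.of_surjective φ hφ
  · obtain ⟨φ, hφ⟩ := H n
    obtain ⟨g, rfl⟩ := hφ f
    rw [hN (n + a) (by omega) g, map_zero]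

theorem HasFiniteTotalHom.of_exact {X₁ Y₁ X₂ Y₂ X₃ Y₃ : T}
    (h₁ : HasFiniteTotalHom k X₁ Y₁) (h₃ : HasFiniteTotalHom k X₃ Y₃)
    (H : ∀ n : ℤ, ∃ (f : (X₁ ⟶ Y₁⟦n⟧) →ₗ[k] (X₂ ⟶ Y₂⟦n⟧))
      (g : (X₂ ⟶ Y₂⟦n⟧) →ₗ[k] (X₃ ⟶ Y₃⟦n⟧)), Function.Exact f g) :
    HasFiniteTotalHom k X₂ Y₂ := by
  obtain ⟨h₁, N, hN⟩ := h₁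
  obtain ⟨h₃, N', hN'⟩ := h₃
  refine ⟨fun n => ?_, max N N', fun n hn φ => ?_⟩
  · obtain ⟨f, g, hfg⟩ := H n
    have := h₁ n
    have := h₃ n
    exact Module.Finite.of_exact_of_finite hfg
  · obtain ⟨f, g, hfg⟩ := H n
    obtain ⟨ψ, rfl⟩ := (hfg φ).1 (hN' n (by omega) _)
    rw [hN n (by omega) ψ, map_zero]

variable [HasZeroObject T] [∀ n : ℤ, (shiftFunctor T n).Additive] [Pretriangulated T]

open scoped ZeroObject

/-- The objects X with this property form a strictly full triangulated subcategory: shifts translate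
the window of nonzero degrees, and cones are controlled by the long exact sequence. -/
theorem hasFiniteTotalHom_of_generatedBy_left [∀ n : ℤ, (shiftFunctor T n).Linear k]
    {P : ObjectProperty T} {Y : T}
    (h : ∀ X, P X → HasFiniteTotalHom k X Y) (X : T) (hX : generatedBy P X) :
    HasFiniteTotalHom k X Y := by
  let Q : ObjectProperty T := fun X => HasFiniteTotalHom k X Y
  have hiso : Q.IsClosedUnderIsomorphisms := ⟨fun {X X'} e hX => by
    obtain ⟨h, N, hN⟩ := hX
    refine ⟨fun n => ?_, N, fun n hn f => ?_⟩
    · have := h n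
      exact Module.Finite.of_surjective (Linear.leftComp k (Y⟦n⟧) e.inv)
        fun f => ⟨e.hom ≫ f, by simp⟩
    · rw [← cancel_epi e.hom, hN n hn (e.hom ≫ f), comp_zero]⟩
  have htri : Q.IsTriangulated :=
    { exists_zero := ⟨0, isZero_zero T, fun n => by
        have : Subsingleton ((0 : T) ⟶ Y⟦n⟧) := ⟨fun f g => (isZero_zero T).eq_of_src f g⟩
        infer_instance, 0, fun n _ f => (isZero_zero T).eq_of_src _ _⟩
      isStableUnderShiftBy := fun a => ⟨fun X hX => HasFiniteTotalHom.of_surjective (-a) hX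
        fun n => ⟨(Linear.rightComp k (X⟦a⟧)
          ((shiftFunctorAdd' T (n + -a) a n (by omega)).inv.app Y)).comp
            ((shiftFunctor T a).mapLinearMap k), fun f => by
          obtain ⟨g, hg⟩ := (shiftFunctor T a).map_surjective
            (f ≫ (shiftFunctorAdd' T (n + -a) a n (by omega)).hom.app Y)
          refine ⟨g, ?_⟩
          change (shiftFunctor T a).map g ≫ _ = f
          rw [hg, Category.assoc, Iso.hom_inv_id_app, Category.comp_id]⟩⟩
      ext₂' := fun S hS h₁ h₃ => ObjectProperty.le_isoClosure _ _
        (HasFiniteTotalHom.of_exact h₃ h₁ fun n => ⟨Linear.leftComp k (Y⟦n⟧) S.mor₂,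
          Linear.leftComp k (Y⟦n⟧) S.mor₁, fun φ => ⟨fun hφ => by
            obtain ⟨ψ, hψ⟩ := exists_eq_mor₂_comp (f := S.mor₁) (g := S.mor₂) (h := S.mor₃) hS φ hφ
            exact ⟨ψ, hψ.symm⟩, by
            rintro ⟨ψ, rfl⟩
            change S.mor₁ ≫ S.mor₂ ≫ ψ = 0
            rw [comp_distTriang_mor_zero₁₂_assoc _ hS, zero_comp]⟩⟩) }
  exact hX Q htri hiso h

theorem hasFiniteTotalHom_of_generatedBy_right {P : ObjectProperty T} {X : T}
    (h : ∀ Y, P Y → HasFiniteTotalHom k X Y) (Y : T) (hY : generatedBy P Y) :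
    HasFiniteTotalHom k X Y := by
  let Q : ObjectProperty T := fun Y => HasFiniteTotalHom k X Y
  have hiso : Q.IsClosedUnderIsomorphisms := ⟨fun {Y Y'} e hY =>
    HasFiniteTotalHom.of_surjective 0 hY fun n => ⟨Linear.rightComp k X
      ((shiftFunctorAdd' T 0 n (n + 0) (by omega)).hom.app Y ≫
        ((shiftFunctorZero T ℤ).hom.app Y ≫ e.hom)⟦n⟧'), fun f =>
      ⟨f ≫ (e.inv ≫ (shiftFunctorZero T ℤ).inv.app Y)⟦n⟧' ≫
        (shiftFunctorAdd' T 0 n (n + 0) (by omega)).inv.app Y, by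
        simp [← Functor.map_comp]⟩⟩⟩
  have htri : Q.IsTriangulated :=
    { exists_zero := ⟨0, isZero_zero T, fun n => by
        have : Subsingleton (X ⟶ (0 : T)⟦n⟧) :=
          ⟨fun f g => ((shiftFunctor T n).map_isZero (isZero_zero T)).eq_of_tgt f g⟩
        infer_instance, 0, fun n _ f =>
          ((shiftFunctor T n).map_isZero (isZero_zero T)).eq_of_tgt _ _⟩
      isStableUnderShiftBy := fun a => ⟨fun Y hY => HasFiniteTotalHom.of_surjective a hY
        fun n => ⟨Linear.rightComp k X
          ((shiftFunctorAdd' T a n (n + a) (by omega)).hom.app Y), fun f =>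
            ⟨f ≫ (shiftFunctorAdd' T a n (n + a) (by omega)).inv.app Y, by simp⟩⟩⟩
      ext₂' := fun S hS h₁ h₃ => ObjectProperty.le_isoClosure _ _
        (HasFiniteTotalHom.of_exact h₁ h₃ fun n => ⟨Linear.rightComp k X (S.mor₁⟦n⟧'),
          Linear.rightComp k X (S.mor₂⟦n⟧'), fun φ => ⟨fun hφ => by
            -- The n-th shift of a triangle multiplies its maps by (-1)^n. This changes no kernel,
            -- and the preimage found absorbs the sign.
            obtain ⟨ψ, hψ⟩ := exists_eq_comp_mor₁
              (f := n.negOnePow • S.mor₁⟦n⟧') (g := n.negOnePow • S.mor₂⟦n⟧')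
              (Triangle.shift_distinguished S hS n) φ (by
                rw [Linear.comp_units_smul, show φ ≫ S.mor₂⟦n⟧' = 0 from hφ, smul_zero])
            refine ⟨n.negOnePow • ψ, ?_⟩
            rw [hψ, Linear.comp_units_smul]
            exact Linear.units_smul_comp _ _ _, by
            rintro ⟨ψ, rfl⟩
            change (ψ ≫ S.mor₁⟦n⟧') ≫ S.mor₂⟦n⟧' = 0
            rw [Category.assoc, ← Functor.map_comp, comp_distTriang_mor_zero₁₂ _ hS,
              Functor.map_zero, comp_zero]⟩⟩) }
  exact hY Q htri hiso h

/-- The triangulated subcategory generated by one object is proper if its generator has a finite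
dimensional total endomorphism space. -/
theorem isProperSubcategory_generatedBy_singleton [∀ n : ℤ, (shiftFunctor T n).Linear k] {G : T}
    (h : HasFiniteTotalHom k G G) :
    IsProperSubcategory k (generatedBy (ObjectProperty.singleton G)) := by
  intro X Y hX hY
  refine HasFiniteTotalHom.finite (hasFiniteTotalHom_of_generatedBy_right ?_ Y hY)
  intro Y' hY'
  refine hasFiniteTotalHom_of_generatedBy_left ?_ X hX
  intro X' hX'
  rw [ObjectProperty.singleton_iff] at hX' hY'
  rwa [← hX', ← hY']

end Proper

/-! ### The path algebra graded by length, as matrices of polynomials. -/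

namespace PathAlgebra

open Quiver

variable {k : Type u} [CommRing k] {V : Type} [Quiver.{0} V]

/-- A linear combination of paths is sent to the polynomial that records their lengths. -/
def lengthPolynomial {a b : V} : (Path a b →₀ k) →ₗ[k] Polynomial k :=
  Finsupp.linearCombination k fun p => Polynomial.X ^ p.length

theorem lengthPolynomial_single {a b : V} (p : Path a b) (s : k) :
    lengthPolynomial (Finsupp.single p s) = s • Polynomial.X ^ p.length := by
  simp [lengthPolynomial]

theorem lengthPolynomial_concat {a b c : V} (x : Path a b →₀ k) (y : Path b c →₀ k) :
    lengthPolynomial (concat x y) = lengthPolynomial x * lengthPolynomial y := by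
  induction x using Finsupp.induction_linear with
  | zero => simp
  | add x x' hx hx' => simp [hx, hx', add_mul]
  | single p s =>
    induction y using Finsupp.induction_linear with
    | zero => simp
    | add y y' hy hy' => simp [hy, hy', mul_add]
    | single q t =>
      simp only [concat_single, lengthPolynomial_single, Path.length_comp, pow_add,
        smul_mul_smul_comm]

variable [Fintype V] [DecidableEq V]

/-- The length polynomials of the components are the entries of a matrix that depends
multiplicatively on the element of the path algebra. -/
def lengthMatrix : PathAlgebra k V →+* Matrix V V (Polynomial k) where
  toFun x := Matrix.of fun a b => lengthPolynomial (x a b)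
  map_one' := by
    ext1 a b
    by_cases h : a = b
    · subst h
      simp [one_apply_self, lengthPolynomial_single]
    · simp [one_apply_ne h, Matrix.one_apply_ne h]
  map_mul' x y := by
    ext1 a c
    simp [mul_apply, Matrix.mul_apply, map_sum, lengthPolynomial_concat]
  map_zero' := by
    ext1 a b
    simp [zero_apply]
  map_add' x y := by
    ext1 a b
    simp [add_apply]

theorem lengthMatrix_apply (x : PathAlgebra k V) (a b : V) :
    lengthMatrix x a b = lengthPolynomial (x a b) := rfl

theorem lengthMatrix_smul (s : k) (x : PathAlgebra k V) (a b : V) :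
    lengthMatrix (s • x) a b = s • lengthMatrix x a b := by
  simp [lengthMatrix_apply, smul_apply]

theorem lengthMatrix_ofPath {a b : V} (p : Path a b) (a' b' : V) :
    lengthMatrix (ofPath p : PathAlgebra k V) a' b' =
      if a' = a ∧ b' = b then Polynomial.X ^ p.length else 0 := by
  rw [lengthMatrix_apply]
  by_cases ha : a' = a
  · subst ha
    by_cases hb : b' = b
    · subst hb
      simp [ofPath, lengthPolynomial_single]
    · simp [ofPath, hb]
  · simp [ofPath, ha]

theorem ofPath_mul_ofPath_of_ne {a b c d : V} (p : Path a b) (q : Path c d) (h : b ≠ c) :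
    (ofPath p * ofPath q : PathAlgebra k V) = 0 := by
  ext1 a' d'
  rw [mul_apply, zero_apply]
  refine Finset.sum_eq_zero fun b' _ => ?_
  by_cases hb : b' = b
  · subst hb
    simp [ofPath, Pi.single_eq_of_ne h]
  · by_cases ha : a' = a
    · subst ha
      simp [ofPath, Pi.single_eq_of_ne hb]
    · simp [ofPath, Pi.single_eq_of_ne ha]

end PathAlgebra

theorem CyclicQuiver.natCast_injective_of_lt {r n m : ℕ} (hn : n < r) (hm : m < r)
    (h : (n : CyclicQuiver r) = m) : n = m := by
  have h' : ((n : ℕ) : ZMod r) = (m : ℕ) := h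
  rw [ZMod.natCast_eq_natCast_iff'] at h'
  rwa [Nat.mod_eq_of_lt hn, Nat.mod_eq_of_lt hm] at h'

/-! ### The path basis of Λ_r and its multiplication. -/

namespace CyclicAlgebra

open PathAlgebra CyclicQuiver Quiver

section Basis

variable (k : Type u) [CommRing k] (r : ℕ) [NeZero r]

/-- Each generator of the ideal is a path of length r, so its length matrix has entries 0 or X^r.
The ideal therefore lies in the kernel of the map to matrices over k[X]/(X^r), which still sees all
lengths below r. -/
theorem coeff_lengthMatrix_eq_zero {x : PathAlgebra k (CyclicQuiver r)} (hx : x ∈ cycleIdeal k r)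
    (a b : CyclicQuiver r) {n : ℕ} (hn : n < r) : (lengthMatrix x a b).coeff n = 0 := by
  let I : Ideal (Polynomial k) := Ideal.span {Polynomial.X ^ r}
  have h : cycleIdeal k r ≤ TwoSidedIdeal.ker ((Ideal.Quotient.mk I).mapMatrix.comp lengthMatrix) := by
    rw [cycleIdeal, TwoSidedIdeal.span_le]
    rintro _ ⟨j, p, hp, rfl⟩
    rw [SetLike.mem_coe, TwoSidedIdeal.mem_ker]
    ext1 a b
    rw [RingHom.comp_apply, RingHom.mapMatrix_apply, Matrix.map_apply, lengthMatrix_ofPath, hp,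
      Matrix.zero_apply, Ideal.Quotient.eq_zero_iff_mem]
    split_ifs
    · exact Ideal.subset_span rfl
    · exact I.zero_mem
  have h1 := (TwoSidedIdeal.mem_ker _).1 (h hx)
  have h2 : Ideal.Quotient.mk I (lengthMatrix x a b) = 0 := congrFun (congrFun h1 a) b
  rw [Ideal.Quotient.eq_zero_iff_mem, Ideal.mem_span_singleton, Polynomial.X_pow_dvd_iff] at h2
  exact h2 n hn

/-- The class of the path of length `n` that starts at `a`. -/
def path (a : CyclicQuiver r) (n : ℕ) : CyclicAlgebra k r := mk k r (ofPath (pathFrom a n).2)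

theorem mk_ofPath {a b : CyclicQuiver r} (p : Path a b) :
    mk k r (ofPath p) = path k r a p.length :=
  congrArg (fun q : Σ b : CyclicQuiver r, Path a b => mk k r (ofPath q.2)) (eq_pathFrom p)

theorem idem_eq_path (a : CyclicQuiver r) : idem k r a = path k r a 0 := rfl

variable {k r} in
theorem path_eq_zero (a : CyclicQuiver r) {n : ℕ} (hn : r ≤ n) : path k r a n = 0 :=
  mk_pathFrom_eq_zero k r a n hn

theorem path_mul_path (a : CyclicQuiver r) (n m : ℕ) :
    path k r a n * path k r (a + n) m = path k r a (n + m) := by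
  -- The end of `pathFrom a n` is a + n only propositionally, so the path is generalized together
  -- with its end point.
  have h : ∀ (p : Σ b : CyclicQuiver r, Path a b) (b : CyclicQuiver r), p.1 = b →
      mk k r (ofPath p.2) * path k r b m = path k r a (p.2.length + m) := by
    rintro ⟨b, p⟩ _ rfl
    rw [path, ← map_mul, ofPath_mul_ofPath, mk_ofPath, Path.length_comp, length_pathFrom]
  rw [path, h _ _ (pathFrom_fst a n), length_pathFrom]

theorem path_mul_path_of_ne {a b : CyclicQuiver r} {n : ℕ} (m : ℕ) (h : a + n ≠ b) :
    path k r a n * path k r b m = 0 := by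
  rw [path, path, ← map_mul, ofPath_mul_ofPath_of_ne _ _ (by rwa [pathFrom_fst]), map_zero]

theorem idem_mul_path (a : CyclicQuiver r) (n : ℕ) :
    idem k r a * path k r a n = path k r a n := by
  have := path_mul_path k r a 0 n
  rwa [Nat.cast_zero, add_zero, zero_add] at this

theorem idem_mul_path_of_ne {a b : CyclicQuiver r} (n : ℕ) (h : a ≠ b) :
    idem k r a * path k r b n = 0 :=
  path_mul_path_of_ne k r (n := 0) n (by simpa using h)

theorem path_mul_idem {a b : CyclicQuiver r} {n : ℕ} (h : a + n = b) :
    path k r a n * idem k r b = path k r a n := by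
  subst h
  exact path_mul_path k r a n 0

theorem path_mul_idem_of_ne {a b : CyclicQuiver r} {n : ℕ} (h : a + n ≠ b) :
    path k r a n * idem k r b = 0 :=
  path_mul_path_of_ne k r 0 h

theorem idem_mul_idem (a : CyclicQuiver r) : idem k r a * idem k r a = idem k r a :=
  idem_mul_path k r a 0

theorem sum_idem : ∑ a, idem k r a = 1 := by
  have h : ∑ a : CyclicQuiver r, (ofPath (Path.nil : Path a a) : PathAlgebra k (CyclicQuiver r)) = 1 := by
    ext1 a b
    have : (∑ a : CyclicQuiver r, (ofPath (Path.nil : Path a a) : PathAlgebra k (CyclicQuiver r))) a b =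
        ∑ c : CyclicQuiver r, (ofPath (Path.nil : Path c c) : PathAlgebra k (CyclicQuiver r)) a b := by
      erw [Finset.sum_apply, Finset.sum_apply]
    rw [this, Finset.sum_eq_single a]
    · by_cases hab : b = a
      · subst hab
        rw [one_apply_self]
        simp [ofPath]
      · rw [one_apply_ne (Ne.symm hab)]
        simp [ofPath, Pi.single_eq_of_ne hab]
    · intro c _ hc
      simp [ofPath, Pi.single_eq_of_ne hc.symm]
    · simp
  rw [← map_one (mk k r), ← h, map_sum]
  rfl

/-- A path is determined by its start and its length. The coefficient of X^n in the entry (a, a+n)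
of the length matrix isolates the coefficient of a single path in a relation. -/
theorem linearIndependent_path : LinearIndependent k
    fun x : CyclicQuiver r × Fin r => path k r x.1 x.2 := by
  rw [Fintype.linearIndependent_iff]
  rintro g hg ⟨a, n⟩
  have h : mk k r (∑ x : CyclicQuiver r × Fin r, g x • ofPath (pathFrom x.1 x.2).2) = 0 := by
    rw [map_sum, ← hg]
    simp only [map_smul]
    rfl
  rw [mk_eq_zero_iff] at h
  have h1 := coeff_lengthMatrix_eq_zero k r h a (a + (n : ℕ)) n.2
  rw [map_sum, Matrix.sum_apply, Polynomial.finsetSum_coeff, Finset.sum_eq_single (a, n)] at h1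
  · rw [lengthMatrix_smul, lengthMatrix_ofPath, if_pos ⟨rfl, (pathFrom_fst _ _).symm⟩,
      length_pathFrom, Polynomial.coeff_smul, Polynomial.coeff_X_pow_self] at h1
    simpa using h1
  · rintro ⟨b, m⟩ _ hbm
    rw [lengthMatrix_smul, lengthMatrix_ofPath, length_pathFrom]
    split_ifs with hc
    · rw [Polynomial.coeff_smul, Polynomial.coeff_X_pow, if_neg, smul_zero]
      intro hnm
      exact hbm (Prod.ext hc.1.symm (Fin.ext hnm.symm))
    · simp
  · simp

theorem span_path : Submodule.span k
    (Set.range fun x : CyclicQuiver r × Fin r => path k r x.1 x.2) = ⊤ := by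
  have hr : LinearMap.range (mk k r).toLinearMap = ⊤ :=
    LinearMap.range_eq_top.2 (mk_surjective k r)
  rw [eq_top_iff, ← hr, LinearMap.range_eq_map, ← PathAlgebra.span_ofPath, Submodule.map_span,
    Submodule.span_le]
  rintro _ ⟨_, ⟨a, b, p, rfl⟩, rfl⟩
  change mk k r (ofPath p) ∈ Submodule.span k _
  rw [mk_ofPath]
  by_cases hp : p.length < r
  · exact Submodule.subset_span ⟨(a, ⟨p.length, hp⟩), rfl⟩
  · rw [path_eq_zero a (not_lt.1 hp)]
    exact Submodule.zero_mem _

/-- The paths of length less than `r` are a basis. -/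
def pathBasis : Module.Basis (CyclicQuiver r × Fin r) k (CyclicAlgebra k r) :=
  Module.Basis.mk (linearIndependent_path k r) (span_path k r).ge

theorem pathBasis_apply (x : CyclicQuiver r × Fin r) :
    pathBasis k r x = path k r x.1 x.2 :=
  Module.Basis.mk_apply _ _ _

/-- The coefficient of the path of length `n` that starts at `a`. -/
def coeff (a : CyclicQuiver r) (n : Fin r) : CyclicAlgebra k r →ₗ[k] k :=
  (pathBasis k r).coord (a, n)

theorem coeff_path (a b : CyclicQuiver r) (n : Fin r) (m : ℕ) :
    coeff k r a n (path k r b m) = if b = a ∧ m = n then 1 else 0 := by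
  by_cases hm : m < r
  · have := pathBasis_apply k r (b, ⟨m, hm⟩)
    dsimp only at this
    rw [← this, coeff, Module.Basis.coord_apply, Module.Basis.repr_self, Finsupp.single_apply]
    simp [Prod.ext_iff, Fin.ext_iff]
  · rw [path_eq_zero b (not_lt.1 hm), map_zero, if_neg]
    rintro ⟨-, h⟩
    omega

variable {k r}

theorem linearMap_ext {V : Type*} [AddCommGroup V] [Module k V]
    {f g : CyclicAlgebra k r →ₗ[k] V} (h : ∀ a n, f (path k r a n) = g (path k r a n)) : f = g :=
  (pathBasis k r).ext fun x => by
    rw [pathBasis_apply]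
    exact h _ _

theorem character_path (i a : CyclicQuiver r) (n : ℕ) :
    character k r i (path k r a n) = if a = i ∧ n = 0 then 1 else 0 := by
  change (ofPath (pathFrom a n).2 : PathAlgebra k (CyclicQuiver r)) i i Path.nil = _
  cases n with
  | zero =>
    by_cases h : a = i
    · subst h
      simp [ofPath, pathFrom]
    · simp [ofPath, h]
  | succ n =>
    rw [if_neg (by simp)]
    by_cases h : i = a
    · subst h
      have : ∀ (p : Σ b : CyclicQuiver r, Path i b), p.2.length ≠ 0 →
          (ofPath p.2 : PathAlgebra k (CyclicQuiver r)) i i Path.nil = 0 := by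
        rintro ⟨b, p⟩ hp
        by_cases hb : i = b
        · subst hb
          have hne : p ≠ Path.nil := by
            rintro rfl
            exact hp rfl
          simp [ofPath, hne]
        · simp [ofPath, Pi.single_eq_of_ne hb]
      exact this _ (by simp [length_pathFrom])
    · simp [ofPath, Pi.single_eq_of_ne h]

theorem character_idem (i : CyclicQuiver r) : character k r i (idem k r i) = 1 := by
  rw [idem_eq_path, character_path, if_pos ⟨rfl, rfl⟩]

theorem character_idem_of_ne {i j : CyclicQuiver r} (h : j ≠ i) :
    character k r i (idem k r j) = 0 := by
  rw [idem_eq_path, character_path, if_neg fun heq => h heq.1]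

/-- The elements that start at `i` are the sum of a lazy path and of an element that starts
with the arrow at `i`. -/
theorem exists_idem_mul_eq (i : CyclicQuiver r) (x : CyclicAlgebra k r) :
    ∃ y, idem k r i * x = character k r i x • idem k r i + path k r i 1 * y := by
  have hx : x ∈ Submodule.span k (Set.range fun x : CyclicQuiver r × Fin r => path k r x.1 x.2) := by
    rw [span_path]
    trivial
  induction hx using Submodule.span_induction with
  | mem x hx =>
    obtain ⟨⟨a, n⟩, rfl⟩ := hx
    dsimp only
    by_cases h : i = a
    · subst h
      rw [idem_mul_path, character_path]
      obtain hn | ⟨m, hm⟩ : (n : ℕ) = 0 ∨ ∃ m, (n : ℕ) = m + 1 :=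
        (Nat.eq_zero_or_eq_succ_pred n).imp id fun h => ⟨_, h⟩
      · exact ⟨0, by simp [hn, idem_eq_path]⟩
      · refine ⟨path k r (i + 1) m, ?_⟩
        rw [hm, if_neg (by simp), zero_smul, zero_add, add_comm m 1, ← path_mul_path,
          Nat.cast_one]
    · refine ⟨0, ?_⟩
      rw [idem_mul_path_of_ne k r _ h, character_path, if_neg fun h' => h h'.1.symm]
      simp
  | zero => exact ⟨0, by simp⟩
  | add x x' _ _ h h' =>
    obtain ⟨y, hy⟩ := h
    obtain ⟨y', hy'⟩ := h'
    exact ⟨y + y', by rw [mul_add, hy, hy', map_add, add_smul, mul_add]; abel⟩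
  | smul s x _ h =>
    obtain ⟨y, hy⟩ := h
    exact ⟨s • y, by rw [mul_smul_comm, hy, map_smul, smul_add, mul_smul_comm, smul_assoc]⟩

/-- This path ends at i, and extending it by any positive length gives zero. So it spans a copy of
S_i, the socle of P_{i+1}. -/
theorem path_top_mul (i : CyclicQuiver r) (x : CyclicAlgebra k r) :
    path k r (i + 1) (r - 1) * x = character k r i x • path k r (i + 1) (r - 1) := by
  suffices h : LinearMap.mulLeft k (path k r (i + 1) (r - 1)) =
      (character k r i).toLinearMap.smulRight (path k r (i + 1) (r - 1)) from
    LinearMap.congr_fun h x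
  refine linearMap_ext fun a n => ?_
  rw [LinearMap.mulLeft_apply, LinearMap.smulRight_apply, AlgHom.toLinearMap_apply, character_path]
  have hi : i + 1 + ((r - 1 : ℕ) : CyclicQuiver r) = i := by
    rw [Nat.cast_sub NeZero.one_le, natCast_self]
    ring
  by_cases ha : i = a
  · subst ha
    nth_rw 2 [← hi]
    rw [path_mul_path]
    by_cases hn : n = 0
    · subst hn
      simp
    · rw [path_eq_zero _ (by omega), if_neg fun h => hn h.2, zero_smul]
  · rw [path_mul_path_of_ne k r _ (by rwa [hi]), if_neg fun h => ha h.1.symm, zero_smul]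

/-- Multiplication by the arrow raises the length of paths from i+1 by one and keeps distinct paths
distinct. Only the path of length r-1 is lost. This is the kernel of P_{i+1} → rad P_i. -/
theorem idem_mul_eq_of_path_mul_eq_zero {i : CyclicQuiver r} {x : CyclicAlgebra k r}
    (hx : path k r i 1 * x = 0) : ∃ c : k, idem k r (i + 1) * x = c • path k r (i + 1) (r - 1) := by
  have h1 : ∀ (n : ℕ) (hn : n + 1 < r), coeff k r (i + 1) ⟨n, by omega⟩ x = 0 := by
    intro n hn
    suffices h : coeff k r (i + 1) ⟨n, by omega⟩ =
        (coeff k r i ⟨n + 1, hn⟩).comp (LinearMap.mulLeft k (path k r i 1)) by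
      rw [h, LinearMap.comp_apply, LinearMap.mulLeft_apply, hx, map_zero]
    refine linearMap_ext fun a m => ?_
    rw [LinearMap.comp_apply, LinearMap.mulLeft_apply, coeff_path]
    by_cases ha : i + 1 = a
    · subst ha
      have := path_mul_path k r i 1 m
      rw [Nat.cast_one] at this
      rw [this, coeff_path]
      simp [add_comm 1 m]
    · rw [path_mul_path_of_ne k r _ (by rwa [Nat.cast_one]), map_zero,
        if_neg fun h => ha h.1.symm]
  have hr : r - 1 < r := Nat.sub_lt (NeZero.pos r) one_pos
  refine ⟨coeff k r (i + 1) ⟨r - 1, hr⟩ x, ?_⟩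
  have h2 : idem k r (i + 1) * x = ∑ n : Fin r, coeff k r (i + 1) n x • path k r (i + 1) n := by
    suffices h : LinearMap.mulLeft k (idem k r (i + 1)) =
        ∑ n : Fin r, (coeff k r (i + 1) n).smulRight (path k r (i + 1) n) by
      have := LinearMap.congr_fun h x
      simpa using this
    refine linearMap_ext fun a m => ?_
    simp only [LinearMap.mulLeft_apply, LinearMap.sum_apply, LinearMap.smulRight_apply, coeff_path]
    by_cases ha : a = i + 1
    · subst ha
      rw [idem_mul_path]
      by_cases hm : m < r
      · rw [Finset.sum_eq_single ⟨m, hm⟩]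
        · simp
        · intro n _ hn
          rw [if_neg, zero_smul]
          rintro ⟨-, h⟩
          exact hn (Fin.ext h.symm)
        · simp
      · rw [path_eq_zero _ (not_lt.1 hm), Finset.sum_eq_zero]
        intro n _
        rw [if_neg, zero_smul]
        rintro ⟨-, h⟩
        omega
    · rw [idem_mul_path_of_ne k r _ (Ne.symm ha)]
      simp [ha]
  rw [h2, Finset.sum_eq_single ⟨r - 1, hr⟩]
  · intro n _ hn
    have hn' : (n : ℕ) + 1 < r := by
      have : (n : ℕ) ≠ r - 1 := fun h => hn (Fin.ext h)
      omega
    rw [h1 n hn', zero_smul]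
  · simp

theorem path_ne_zero [Nontrivial k] (a : CyclicQuiver r) {n : ℕ} (hn : n < r) :
    path k r a n ≠ 0 := by
  intro h
  have := coeff_path k r a a ⟨n, hn⟩ n
  rw [h, map_zero, if_pos ⟨rfl, rfl⟩] at this
  exact zero_ne_one this

/-- The lengths below r have distinct residues, so exactly one basis path runs from a to a+n. Hence
every Hom(P_b, P_a) = e_a Λ e_b is a line. -/
theorem idem_mul_mul_idem (a : CyclicQuiver r) {n : ℕ} (hn : n < r) (x : CyclicAlgebra k r) :
    idem k r a * x * idem k r (a + n) = coeff k r a ⟨n, hn⟩ x • path k r a n := by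
  suffices h : (LinearMap.mulRight k (idem k r (a + n))).comp (LinearMap.mulLeft k (idem k r a)) =
      (coeff k r a ⟨n, hn⟩).smulRight (path k r a n) from LinearMap.congr_fun h x
  refine linearMap_ext fun b m => ?_
  rw [LinearMap.comp_apply, LinearMap.mulLeft_apply, LinearMap.mulRight_apply,
    LinearMap.smulRight_apply, coeff_path]
  by_cases hb : b = a
  · subst hb
    rw [idem_mul_path]
    by_cases hm : m < r
    · by_cases hnm : m = n
      · subst hnm
        rw [path_mul_idem k r rfl]
        simp
      · rw [path_mul_idem_of_ne, if_neg fun h => hnm h.2, zero_smul]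
        intro h
        exact hnm (natCast_injective_of_lt hm hn (add_left_cancel h))
    · rw [path_eq_zero _ (not_lt.1 hm), zero_mul, if_neg, zero_smul]
      rintro ⟨-, h⟩
      dsimp only at h
      omega
  · rw [idem_mul_path_of_ne k r _ (Ne.symm hb), zero_mul, if_neg fun h => hb h.1, zero_smul]

end Basis

end CyclicAlgebra

namespace CyclicAlgebra

open MulOpposite

variable {k : Type u} [Field k] {r : ℕ} [NeZero r]

/-! ### Morphisms out of P_i and S_i. -/

section Projective

/-- The generator `e_i` of `P_i`. -/
def projGen (i : CyclicQuiver r) : proj k r i :=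
  (⟨idem k r i, Submodule.mem_span_singleton_self _⟩ :
    Submodule.span (CyclicAlgebra k r)ᵐᵒᵖ {idem k r i})

theorem mem_proj_iff {i : CyclicQuiver r} {x : CyclicAlgebra k r} :
    x ∈ Submodule.span (CyclicAlgebra k r)ᵐᵒᵖ {idem k r i} ↔ idem k r i * x = x := by
  rw [Submodule.mem_span_singleton]
  constructor
  · rintro ⟨a, rfl⟩
    change idem k r i * (idem k r i * a.unop) = idem k r i * a.unop
    rw [← mul_assoc, idem_mul_idem]
  · exact fun h => ⟨op x, h⟩

/-- The elements of `P_i` as elements of the algebra. -/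
def projVal {i : CyclicQuiver r} (x : proj k r i) : CyclicAlgebra k r :=
  (show Submodule.span (CyclicAlgebra k r)ᵐᵒᵖ {idem k r i} from x).1

/-- The element of `P_i` given by an element of the algebra. -/
def projMk (i : CyclicQuiver r) (x : CyclicAlgebra k r) (hx : idem k r i * x = x) : proj k r i :=
  (⟨x, mem_proj_iff.2 hx⟩ : Submodule.span (CyclicAlgebra k r)ᵐᵒᵖ {idem k r i})

theorem projVal_projMk (i : CyclicQuiver r) (x : CyclicAlgebra k r) (hx : idem k r i * x = x) :
    projVal (projMk i x hx) = x := rfl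

theorem projVal_projGen (i : CyclicQuiver r) : projVal (projGen (k := k) i) = idem k r i := rfl

theorem projVal_injective (i : CyclicQuiver r) : Function.Injective (projVal (k := k) (i := i)) :=
  Subtype.val_injective

theorem projVal_smul {i : CyclicQuiver r} (a : CyclicAlgebra k r) (x : proj k r i) :
    projVal (op a • x) = projVal x * a := rfl

theorem idem_mul_projVal {i : CyclicQuiver r} (x : proj k r i) :
    idem k r i * projVal x = projVal x :=
  mem_proj_iff.1 (show Submodule.span (CyclicAlgebra k r)ᵐᵒᵖ {idem k r i} from x).2

/-- The underlying vector space of `S_i` is the ground field. -/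
def simpleEquiv (i : CyclicQuiver r) : simple k r i ≃+ k := AddEquiv.refl k

theorem simpleEquiv_smul {i : CyclicQuiver r} (a : CyclicAlgebra k r) (x : simple k r i) :
    simpleEquiv i (op a • x) = character k r i a * simpleEquiv i x := rfl

/-- The morphism from `S_i` to a module that is given by an element on which the algebra acts
by the character at `i`. -/
def simpleDesc (i : CyclicQuiver r) {N : ModuleCat.{u} (CyclicAlgebra k r)ᵐᵒᵖ} (z : N)
    (hz : ∀ x : CyclicAlgebra k r,
      op x • z = op (algebraMap k (CyclicAlgebra k r) (character k r i x)) • z) :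
    simple k r i ⟶ N :=
  ModuleCat.ofHom (X := simple k r i)
    { toFun := fun c => op (algebraMap k (CyclicAlgebra k r) (simpleEquiv i c)) • z
      map_add' := fun c c' => by
        rw [map_add, map_add, MulOpposite.op_add, add_smul]
      map_smul' := fun x c => by
        have hs : simpleEquiv i (x • c) = character k r i x.unop * simpleEquiv i c := rfl
        have hx : x • z = op (algebraMap k (CyclicAlgebra k r) (character k r i x.unop)) • z :=
          hz x.unop
        have hc : op (algebraMap k (CyclicAlgebra k r) (simpleEquiv i c)) * x =
            x * op (algebraMap k (CyclicAlgebra k r) (simpleEquiv i c)) :=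
          unop_injective (Algebra.commutes (simpleEquiv i c) x.unop).symm
        refine (congrArg (fun t => op (algebraMap k (CyclicAlgebra k r) t) • z) hs).trans ?_
        rw [RingHom.id_apply, ← mul_smul x, ← hc, mul_smul, hx, ← mul_smul, ← op_mul,
          ← map_mul] }

theorem simpleDesc_apply (i : CyclicQuiver r) {N : ModuleCat.{u} (CyclicAlgebra k r)ᵐᵒᵖ} (z : N)
    (hz : ∀ x : CyclicAlgebra k r,
      op x • z = op (algebraMap k (CyclicAlgebra k r) (character k r i x)) • z)
    (c : simple k r i) :
    (simpleDesc i z hz).hom c = op (algebraMap k (CyclicAlgebra k r) (simpleEquiv i c)) • z := rfl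

theorem mono_simpleDesc (i : CyclicQuiver r) {N : ModuleCat.{u} (CyclicAlgebra k r)ᵐᵒᵖ} {z : N}
    (hz : ∀ x : CyclicAlgebra k r,
      op x • z = op (algebraMap k (CyclicAlgebra k r) (character k r i x)) • z) (h0 : z ≠ 0) :
    Mono (simpleDesc i z hz) := by
  refine (ModuleCat.mono_iff_injective _).2
    ((injective_iff_map_eq_zero (simpleDesc i z hz).hom).2 ?_)
  intro c hc
  rw [simpleDesc_apply] at hc
  by_contra hc0
  have hcc : simpleEquiv i c * (simpleEquiv i c)⁻¹ = 1 :=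
    mul_inv_cancel₀ ((map_ne_zero_iff _ (simpleEquiv i).injective).2 hc0)
  apply h0
  rw [← one_smul (CyclicAlgebra k r)ᵐᵒᵖ z, ← op_one, ← map_one (algebraMap k (CyclicAlgebra k r)),
    ← hcc, map_mul, op_mul, mul_smul, hc, smul_zero]

/-- The morphism from `P_i` to a module that is given by an element of the module. -/
def projDesc (i : CyclicQuiver r) {N : ModuleCat.{u} (CyclicAlgebra k r)ᵐᵒᵖ} (y : N) :
    proj k r i ⟶ N :=
  ModuleCat.ofHom (X := Submodule.span (CyclicAlgebra k r)ᵐᵒᵖ {idem k r i})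
    { toFun := fun x => op x.1 • y
      map_add' := fun x x' => by
        rw [← add_smul]
        rfl
      map_smul' := fun a x => by
        rw [RingHom.id_apply, ← mul_smul]
        rfl }

theorem projDesc_apply (i : CyclicQuiver r) {N : ModuleCat.{u} (CyclicAlgebra k r)ᵐᵒᵖ} (y : N)
    (x : proj k r i) : (projDesc i y).hom x = op (projVal x) • y := rfl

theorem proj_hom_apply {i : CyclicQuiver r} {N : ModuleCat.{u} (CyclicAlgebra k r)ᵐᵒᵖ}
    (f : proj k r i ⟶ N) (x : proj k r i) :
    f.hom x = op (projVal x) • f.hom (projGen i) := by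
  rw [← map_smul]
  congr 1
  exact projVal_injective i (idem_mul_projVal x).symm

theorem proj_hom_ext {i : CyclicQuiver r} {N : ModuleCat.{u} (CyclicAlgebra k r)ᵐᵒᵖ}
    {f g : proj k r i ⟶ N} (h : f.hom (projGen i) = g.hom (projGen i)) : f = g := by
  ext x
  rw [proj_hom_apply f, proj_hom_apply g, h]

theorem idem_smul_proj_hom {i : CyclicQuiver r} {N : ModuleCat.{u} (CyclicAlgebra k r)ᵐᵒᵖ}
    (f : proj k r i ⟶ N) : op (idem k r i) • f.hom (projGen i) = f.hom (projGen i) :=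
  (proj_hom_apply f (projGen i)).symm

instance (i : CyclicQuiver r) : Projective (proj k r i) where
  factors {E X} f e he := by
    obtain ⟨z, hz⟩ := (ModuleCat.epi_iff_surjective e).1 he (f.hom (projGen i))
    refine ⟨projDesc i z, proj_hom_ext ?_⟩
    change e.hom (op (idem k r i) • z) = _
    rw [map_smul]
    exact (congrArg _ hz).trans (idem_smul_proj_hom f)

theorem smul_hom_apply {M N : ModuleCat.{u} (CyclicAlgebra k r)ᵐᵒᵖ} (c : k) (f : M ⟶ N) (x : M) :
    (c • f).hom x = op (algebraMap k (CyclicAlgebra k r) c) • f.hom x := rfl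

/-- End(P_i) = e_i Λ e_i, and the lazy path is the only nonzero path from i to itself. -/
theorem exists_proj_hom_eq_smul {i : CyclicQuiver r} (f : proj k r i ⟶ proj k r i) :
    ∃ c : k, f = c • 𝟙 (proj k r i) := by
  have hy := congrArg projVal (idem_smul_proj_hom f)
  rw [projVal_smul] at hy
  refine ⟨coeff k r i ⟨0, NeZero.pos r⟩ (projVal (f.hom (projGen i))),
    proj_hom_ext (projVal_injective i ?_)⟩
  have := idem_mul_mul_idem (k := k) i (NeZero.pos r) (projVal (f.hom (projGen i)))
  rw [Nat.cast_zero, add_zero, idem_mul_projVal, hy, ← idem_eq_path] at this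
  refine this.trans ?_
  rw [smul_hom_apply, projVal_smul, ← Algebra.commutes, ← Algebra.smul_def]
  rfl

/-- A map is determined by the image of e_i, on which e_i acts as the identity, while e_i acts on
S_j by zero. -/
theorem proj_hom_simple_eq_zero {i j : CyclicQuiver r} (h : i ≠ j)
    (f : proj k r i ⟶ simple k r j) : f = 0 := by
  apply proj_hom_ext
  apply (simpleEquiv j).injective
  rw [← idem_smul_proj_hom f, simpleEquiv_smul, character_idem_of_ne h, zero_mul]
  rfl

theorem exists_simple_hom_eq_smul {i : CyclicQuiver r} (f : simple k r i ⟶ simple k r i) :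
    ∃ c : k, f = c • 𝟙 (simple k r i) := by
  let one : simple k r i := (simpleEquiv i).symm 1
  refine ⟨simpleEquiv i (f.hom one), ?_⟩
  ext x
  apply (simpleEquiv i).injective
  have hx : x = op (algebraMap k (CyclicAlgebra k r) (simpleEquiv i x)) • one := by
    apply (simpleEquiv i).injective
    rw [simpleEquiv_smul, AlgHom.commutes, AddEquiv.apply_symm_apply, mul_one]
    rfl
  rw [smul_hom_apply, simpleEquiv_smul, AlgHom.commutes]
  conv_lhs => rw [hx]
  rw [map_smul, simpleEquiv_smul, AlgHom.commutes]
  exact mul_comm _ _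

theorem simple_id_ne_zero (i : CyclicQuiver r) : 𝟙 (simple k r i) ≠ 0 := by
  intro h
  have := congrArg (fun f : simple k r i ⟶ simple k r i =>
    simpleEquiv i (f.hom ((simpleEquiv i).symm 1))) h
  exact one_ne_zero (α := k) this

theorem proj_id_ne_zero (i : CyclicQuiver r) : 𝟙 (proj k r i) ≠ 0 := by
  intro h
  have := congrArg (fun f : proj k r i ⟶ proj k r i => f.hom (projGen i)) h
  exact path_ne_zero (k := k) i (NeZero.pos r) (congrArg Subtype.val this)

end Projective

/-! ### The two exact sequences that make up the periodic resolution. -/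

section Radical

variable (k r) in
/-- The radical of `P_i`: the right ideal generated by the arrow at `i`. -/
def radical (i : CyclicQuiver r) : ModuleCat.{u} (CyclicAlgebra k r)ᵐᵒᵖ :=
  ModuleCat.of _ (Submodule.span (CyclicAlgebra k r)ᵐᵒᵖ {path k r i 1})

theorem mem_radical_iff {i : CyclicQuiver r} {x : CyclicAlgebra k r} :
    x ∈ Submodule.span (CyclicAlgebra k r)ᵐᵒᵖ {path k r i 1} ↔ ∃ y, path k r i 1 * y = x := by
  rw [Submodule.mem_span_singleton]
  exact ⟨fun ⟨a, h⟩ => ⟨a.unop, h⟩, fun ⟨y, h⟩ => ⟨op y, h⟩⟩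

theorem radical_le_proj (i : CyclicQuiver r) :
    Submodule.span (CyclicAlgebra k r)ᵐᵒᵖ {path k r i 1} ≤
      Submodule.span (CyclicAlgebra k r)ᵐᵒᵖ {idem k r i} := by
  rw [Submodule.span_singleton_le_iff_mem, mem_proj_iff, idem_mul_path]

/-- The inclusion of the radical of `P_i`. -/
def radicalι (i : CyclicQuiver r) : radical k r i ⟶ proj k r i :=
  ModuleCat.ofHom (Submodule.inclusion (radical_le_proj i))

/-- The projection of `P_i` to its top `S_i`. -/
def projToSimple (i : CyclicQuiver r) : proj k r i ⟶ simple k r i :=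
  projDesc i (N := simple k r i) (1 : k)

theorem projToSimple_apply (i : CyclicQuiver r) (x : proj k r i) :
    simpleEquiv i ((projToSimple i).hom x) = character k r i (projVal x) :=
  mul_one (character k r i (projVal x))

theorem projToSimple_surjective (i : CyclicQuiver r) :
    Function.Surjective (projToSimple (k := k) i).hom := by
  intro c
  refine ⟨op (algebraMap k (CyclicAlgebra k r) (simpleEquiv i c)) • projGen i,
    (simpleEquiv i).injective ?_⟩
  rw [projToSimple_apply, projVal_smul, projVal_projGen, map_mul, character_idem, one_mul,
    AlgHom.commutes]
  rfl

theorem character_path_one (i : CyclicQuiver r) : character k r i (path k r i 1) = 0 := by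
  rw [character_path, if_neg (by simp)]

/-- The extension of the top `S_i` of `P_i` by the radical. -/
def topSequence (i : CyclicQuiver r) : ShortComplex (ModuleCat.{u} (CyclicAlgebra k r)ᵐᵒᵖ) where
  X₁ := radical k r i
  X₂ := proj k r i
  X₃ := simple k r i
  f := radicalι i
  g := projToSimple i
  zero := by
    ext x
    obtain ⟨y, hy⟩ := mem_radical_iff.1 x.2
    apply (simpleEquiv i).injective
    refine (projToSimple_apply i _).trans ?_
    change character k r i x.1 = 0
    rw [← hy, map_mul, character_path_one, zero_mul]

/-- By `exists_idem_mul_eq`, an element of e_i Λ without a lazy component is a right multiple of the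
arrow. -/
theorem topSequence_shortExact (i : CyclicQuiver r) : (topSequence (k := k) i).ShortExact := by
  refine ShortComplex.ShortExact.mk' ?_ ?_ ?_
  · rw [ShortComplex.ShortExact.moduleCat_exact_iff_function_exact]
    intro x
    constructor
    · intro hx
      have hx' : character k r i (projVal x) = 0 := (projToSimple_apply i x).symm.trans hx
      obtain ⟨y, hy⟩ := exists_idem_mul_eq i (projVal x)
      rw [hx', zero_smul, zero_add] at hy
      exact ⟨⟨_, mem_radical_iff.2 ⟨y, hy.symm.trans (idem_mul_projVal (i := i) x)⟩⟩, rfl⟩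
    · rintro ⟨y, rfl⟩
      exact LinearMap.congr_fun (ModuleCat.hom_ext_iff.1 (topSequence (k := k) i).zero) y
  · exact (ModuleCat.mono_iff_injective _).2 (Submodule.inclusion_injective (radical_le_proj i))
  · exact (ModuleCat.epi_iff_surjective _).2 (projToSimple_surjective i)

/-- The projective cover of the radical of `P_i`. -/
def projToRadical (i : CyclicQuiver r) : proj k r (i + 1) ⟶ radical k r i :=
  ModuleCat.ofHom (X := Submodule.span (CyclicAlgebra k r)ᵐᵒᵖ {idem k r (i + 1)})
    (Y := Submodule.span (CyclicAlgebra k r)ᵐᵒᵖ {path k r i 1})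
    { toFun := fun x => ⟨path k r i 1 * x.1, mem_radical_iff.2 ⟨x.1, rfl⟩⟩
      map_add' := fun _ _ => Subtype.ext (mul_add _ _ _)
      map_smul' := fun a x => Subtype.ext (mul_assoc _ x.1 a.unop).symm }

theorem projToRadical_surjective (i : CyclicQuiver r) :
    Function.Surjective (projToRadical (k := k) i).hom := by
  rintro ⟨x, hx⟩
  obtain ⟨y, rfl⟩ := mem_radical_iff.1 hx
  refine ⟨(⟨idem k r (i + 1) * y, mem_proj_iff.2 ?_⟩ :
    Submodule.span (CyclicAlgebra k r)ᵐᵒᵖ {idem k r (i + 1)}), Subtype.ext ?_⟩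
  · rw [← mul_assoc, idem_mul_idem]
  · change path k r i 1 * (idem k r (i + 1) * y) = path k r i 1 * y
    rw [← mul_assoc, path_mul_idem k r (by rw [Nat.cast_one])]

theorem projToRadical_apply (i : CyclicQuiver r) (x : proj k r (i + 1)) :
    (show Submodule.span (CyclicAlgebra k r)ᵐᵒᵖ {path k r i 1} from
      (projToRadical i).hom x).1 = path k r i 1 * projVal x := rfl

/-- The generator of the socle `S_i` of `P_{i+1}`. -/
def socleGen (i : CyclicQuiver r) : proj k r (i + 1) :=
  projMk (i + 1) (path k r (i + 1) (r - 1)) (idem_mul_path k r _ _)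

theorem projVal_smul_socleGen (i : CyclicQuiver r) (c : k) :
    projVal (op (algebraMap k (CyclicAlgebra k r) c) • socleGen i) =
      c • path k r (i + 1) (r - 1) := by
  rw [projVal_smul, ← Algebra.commutes, ← Algebra.smul_def]
  rfl

theorem smul_socleGen (i : CyclicQuiver r) (x : CyclicAlgebra k r) :
    op x • socleGen (k := k) i =
      op (algebraMap k (CyclicAlgebra k r) (character k r i x)) • socleGen i := by
  apply projVal_injective
  rw [projVal_smul_socleGen, ← path_top_mul]
  rfl

/-- The inclusion of the socle `S_i` of `P_{i+1}`. -/
def socleι (i : CyclicQuiver r) : simple k r i ⟶ proj k r (i + 1) :=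
  simpleDesc i (socleGen i) (smul_socleGen i)

theorem projVal_socleι (i : CyclicQuiver r) (c : simple k r i) :
    projVal ((socleι i).hom c) = simpleEquiv i c • path k r (i + 1) (r - 1) :=
  projVal_smul_socleGen i _

/-- The presentation of the radical of `P_i`. -/
def socleSequence (i : CyclicQuiver r) : ShortComplex (ModuleCat.{u} (CyclicAlgebra k r)ᵐᵒᵖ) where
  X₁ := simple k r i
  X₂ := proj k r (i + 1)
  X₃ := radical k r i
  f := socleι i
  g := projToRadical i
  zero := by
    ext c
    refine Subtype.ext ((projToRadical_apply i _).trans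
      ((congrArg (path k r i 1 * ·) (projVal_socleι i c)).trans ?_))
    have := path_mul_path k r i 1 (r - 1)
    rw [Nat.cast_one] at this
    change path k r i 1 * (simpleEquiv i c • path k r (i + 1) (r - 1)) = 0
    rw [mul_smul_comm, this, path_eq_zero _ (by omega), smul_zero]

/-- The kernel of left multiplication by the arrow at i on P_{i+1} is the line of the longest path,
which is S_i again. This is what closes the period. -/
theorem socleSequence_shortExact (i : CyclicQuiver r) :
    (socleSequence (k := k) i).ShortExact := by
  refine ShortComplex.ShortExact.mk' ?_ ?_ ?_
  · rw [ShortComplex.ShortExact.moduleCat_exact_iff_function_exact]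
    intro x
    constructor
    · intro hx
      have hx' : path k r i 1 * projVal x = 0 := congrArg Subtype.val hx
      obtain ⟨c, hc⟩ := idem_mul_eq_of_path_mul_eq_zero hx'
      exact ⟨(simpleEquiv i).symm c, projVal_injective _ ((projVal_socleι i _).trans
        (hc.symm.trans (idem_mul_projVal (i := i + 1) x)))⟩
    · rintro ⟨y, rfl⟩
      exact LinearMap.congr_fun (ModuleCat.hom_ext_iff.1 (socleSequence (k := k) i).zero) y
  · refine mono_simpleDesc i (smul_socleGen i) fun h => ?_
    exact path_ne_zero (k := k) (i + 1) (Nat.sub_lt (NeZero.pos r) one_pos) (congrArg projVal h)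
  · exact (ModuleCat.epi_iff_surjective _).2 (projToRadical_surjective i)

theorem projToRadical_comp_radicalι (i : CyclicQuiver r)
    {N : ModuleCat.{u} (CyclicAlgebra k r)ᵐᵒᵖ} (f : proj k r i ⟶ N) :
    ((projToRadical i ≫ radicalι i) ≫ f).hom (projGen (i + 1)) =
      op (path k r i 1) • f.hom (projGen i) := by
  refine (proj_hom_apply f ((projToRadical i ≫ radicalι i).hom (projGen (i + 1)))).trans ?_
  congr 2
  exact path_mul_idem k r (by rw [Nat.cast_one])

theorem exists_eq_add_natCast {i j : CyclicQuiver r} (h : j ≠ i) :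
    ∃ l : ℕ, l + 1 < r ∧ j = i + 1 + (l : CyclicQuiver r) := by
  have exists_natCast_eq (m : CyclicQuiver r) : ∃ l : ℕ, l < r ∧ (l : CyclicQuiver r) = m :=
    ⟨ZMod.val (n := r) m, ZMod.val_lt (n := r) m, ZMod.natCast_zmod_val (n := r) m⟩
  obtain ⟨l, hl, hj⟩ := exists_natCast_eq (j - (i + 1))
  refine ⟨l, ?_, by rw [hj]; ring⟩
  by_contra hlt
  have h2 : l + 1 = r := by omega
  have h3 : ((l + 1 : ℕ) : CyclicQuiver r) = 0 := by rw [h2, CyclicQuiver.natCast_self]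
  rw [Nat.cast_add, Nat.cast_one, hj] at h3
  apply h
  linear_combination h3

/-- For `j ≠ i` the map `P_{j+1} ⟶ P_j` induces a bijection on the morphisms to `P_{i+1}`. -/
theorem bijective_projToRadical_comp {i j : CyclicQuiver r} (h : j ≠ i) :
    Function.Bijective fun f : proj k r j ⟶ proj k r (i + 1) =>
      (projToRadical j ≫ radicalι j) ≫ f := by
  -- Write j = i+1+l. The two Hom spaces are spanned by the paths from i+1 of lengths l and l+1, and
  -- the map appends the arrow at j. Since j ≠ i, the longer path has length below r and is nonzero.
  obtain ⟨l, hl, rfl⟩ := exists_eq_add_natCast h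
  have hpath : path k r (i + 1) l * path k r (i + 1 + l) 1 = path k r (i + 1) (l + 1) :=
    path_mul_path k r (i + 1) l 1
  constructor
  · suffices H : ∀ f : proj k r (i + 1 + l) ⟶ proj k r (i + 1),
        (projToRadical (i + 1 + (l : CyclicQuiver r)) ≫ radicalι _) ≫ f = 0 → f = 0 by
      intro f g hfg
      rw [← sub_eq_zero]
      apply H
      rw [Preadditive.comp_sub, sub_eq_zero]
      exact hfg
    intro f hf
    have h1 := congrArg projVal (projToRadical_comp_radicalι (i + 1 + (l : CyclicQuiver r)) f)
    rw [hf, projVal_smul] at h1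
    have h3 := congrArg projVal (idem_smul_proj_hom f)
    rw [projVal_smul] at h3
    have h4 := idem_mul_mul_idem (i + 1) (show l < r by omega) (projVal (f.hom (projGen _)))
    rw [idem_mul_projVal, h3] at h4
    rw [h4, smul_mul_assoc, hpath, eq_comm] at h1
    have h5 := congrArg (coeff k r (i + 1) ⟨l + 1, hl⟩) h1
    rw [map_smul, coeff_path, if_pos ⟨rfl, rfl⟩, smul_eq_mul, mul_one] at h5
    rw [h5.trans (map_zero _), zero_smul] at h4
    exact proj_hom_ext (projVal_injective _ h4)
  · intro g
    have h3 := congrArg projVal (idem_smul_proj_hom g)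
    rw [projVal_smul] at h3
    have h4 := idem_mul_mul_idem (i + 1) hl (projVal (g.hom (projGen _)))
    rw [Nat.cast_add, Nat.cast_one, ← add_assoc, idem_mul_projVal, h3] at h4
    obtain ⟨c, h4⟩ : ∃ c : k, projVal (g.hom (projGen _)) = c • path k r (i + 1) (l + 1) := ⟨_, h4⟩
    have hy : idem k r (i + 1) * (c • path k r (i + 1) l) = c • path k r (i + 1) l := by
      rw [mul_smul_comm, idem_mul_path]
    refine ⟨projDesc (N := proj k r (i + 1)) (i + 1 + (l : CyclicQuiver r))
      (projMk (i + 1) (c • path k r (i + 1) l) hy), proj_hom_ext (projVal_injective _ ?_)⟩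
    refine Eq.trans ?_ h4.symm
    dsimp only
    rw [projToRadical_comp_radicalι, projVal_smul, projDesc_apply, projVal_smul, projVal_projMk,
      projVal_projGen, smul_mul_assoc, smul_mul_assoc, path_mul_idem k r rfl, hpath]

end Radical

/-! ### Simple submodules. -/

section Socle

variable {N : ModuleCat.{u} (CyclicAlgebra k r)ᵐᵒᵖ}

theorem exists_idem_smul_ne_zero {y : N} (hy : y ≠ 0) : ∃ a, op (idem k r a) • y ≠ 0 := by
  by_contra! h
  apply hy
  rw [← one_smul (CyclicAlgebra k r)ᵐᵒᵖ y, ← op_one, ← sum_idem, Finset.op_sum, Finset.sum_smul]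
  exact Finset.sum_eq_zero fun a _ => h a

/-- Every nonzero module has a simple submodule. -/
theorem exists_simple_mono {y : N} (hy : y ≠ 0) :
    ∃ (j : CyclicQuiver r) (f : simple k r j ⟶ N), Mono f ∧ ∃ z : N, op (idem k r j) • z ≠ 0 := by
  obtain ⟨a, ha⟩ := exists_idem_smul_ne_zero hy
  -- Follow the arrows from a as long as the result is nonzero, which stops before length r. The
  -- last nonzero element is killed by every arrow and so spans a copy of S_{a+n}.
  obtain ⟨n, hn, hn'⟩ : ∃ n, op (path k r a n) • y ≠ 0 ∧ op (path k r a (n + 1)) • y = 0 := by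
    by_contra! h
    have : ∀ n, op (path k r a n) • y ≠ 0 := fun n => by
      induction n with
      | zero => exact ha
      | succ n ih => exact h n ih
    exact this r (by rw [path_eq_zero a le_rfl, MulOpposite.op_zero, zero_smul])
  let z := op (path k r a n) • y
  have hz (x : CyclicAlgebra k r) :
      op x • z = op (algebraMap k (CyclicAlgebra k r) (character k r (a + n) x)) • z := by
    have hx : x ∈ Submodule.span k
        (Set.range fun x : CyclicQuiver r × Fin r => path k r x.1 x.2) := by
      rw [span_path]
      trivial
    induction hx using Submodule.span_induction with
    | mem x hx =>
      obtain ⟨⟨b, m⟩, rfl⟩ := hx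
      dsimp only
      rw [character_path]
      simp only [z]
      rw [← mul_smul, ← op_mul]
      by_cases hb : a + n = b
      · subst hb
        rw [path_mul_path]
        obtain hm | ⟨m', hm⟩ : (m : ℕ) = 0 ∨ ∃ m', (m : ℕ) = m' + 1 :=
          (Nat.eq_zero_or_eq_succ_pred m).imp id fun h => ⟨_, h⟩
        · rw [hm, if_pos ⟨rfl, rfl⟩, map_one, op_one, one_smul, add_zero]
        · rw [hm, if_neg (by simp), map_zero, MulOpposite.op_zero, zero_smul,
            show n + (m' + 1) = n + 1 + m' by omega, ← path_mul_path, op_mul, mul_smul, hn',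
            smul_zero]
      · rw [path_mul_path_of_ne k r _ hb, if_neg fun h => hb h.1.symm]
        simp
    | zero => simp
    | add x x' _ _ h h' => rw [MulOpposite.op_add, add_smul, h, h', map_add, map_add,
        MulOpposite.op_add, add_smul]
    | smul s x _ h =>
      rw [Algebra.smul_def, map_mul, AlgHom.commutes, Algebra.algebraMap_self_apply, map_mul, op_mul,
        op_mul, mul_smul, mul_smul, ← mul_smul (op x), ← op_mul, Algebra.commutes, op_mul,
        mul_smul, h, ← mul_smul, ← op_mul, Algebra.commutes, op_mul, mul_smul]
  refine ⟨a + (n : CyclicQuiver r), simpleDesc (a + (n : CyclicQuiver r)) z hz,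
    mono_simpleDesc _ hz hn, z, ?_⟩
  rw [hz, character_idem, map_one, op_one, one_smul]
  exact hn

end Socle

end CyclicAlgebra

/-! ### Modules inside the bounded derived category. -/

namespace BoundedDerived

variable {k : Type u} [Field k] {R : Type u} [Ring R] [Algebra k R]
  [HasDerivedCategory.{w} (ModuleCat.{u} R)]

theorem eq_zero_of_forall_eq_zero {X Y : BoundedDerived k R} {n : ℤ}
    (h : ∀ f : X.obj ⟶ Y.obj⟦n⟧, f = 0) (f : X ⟶ Y⟦n⟧) : f = 0 := by
  apply (isBoundedFinDim k R).ι.map_injective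
  rw [← cancel_mono (((isBoundedFinDim k R).ι.commShiftIso n).hom.app Y), Functor.map_zero,
    zero_comp]
  exact h _

variable {M N : ModuleCat.{u} R} {hM : isFinDim k R M} {hN : isFinDim k R N}

/-- The morphism of the bounded derived category that is given by a morphism of modules. -/
def mapOf (hM : isFinDim k R M) (hN : isFinDim k R N) (f : M ⟶ N) : of k M hM ⟶ of k N hN :=
  ObjectProperty.homMk ((DerivedCategory.singleFunctor _ 0).map f)

theorem exists_eq_mapOf (f : of k M hM ⟶ of k N hN) : ∃ g, f = mapOf hM hN g := by
  obtain ⟨g, hg⟩ := (DerivedCategory.singleFunctor (ModuleCat.{u} R) 0).map_surjective f.hom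
  exact ⟨g, ObjectProperty.hom_ext _ hg.symm⟩

theorem mapOf_injective : Function.Injective (mapOf hM hN) := fun _ _ h =>
  (DerivedCategory.singleFunctor (ModuleCat.{u} R) 0).map_injective
    (congrArg (fun g => g.hom) h)

theorem mapOf_zero : mapOf hM hN 0 = 0 :=
  ObjectProperty.hom_ext _ ((DerivedCategory.singleFunctor (ModuleCat.{u} R) 0).map_zero M N)

theorem mapOf_id : mapOf hM hM (𝟙 M) = 𝟙 (of k M hM) :=
  ObjectProperty.hom_ext _ ((DerivedCategory.singleFunctor (ModuleCat.{u} R) 0).map_id M)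

theorem mapOf_comp {L : ModuleCat.{u} R} {hL : isFinDim k R L} (f : L ⟶ M) (g : M ⟶ N) :
    mapOf hL hN (f ≫ g) = mapOf hL hM f ≫ mapOf hM hN g :=
  ObjectProperty.hom_ext _ ((DerivedCategory.singleFunctor (ModuleCat.{u} R) 0).map_comp f g)

theorem mapOf_smul (c : k) (f : M ⟶ N) : mapOf hM hN (c • f) = c • mapOf hM hN f :=
  ObjectProperty.hom_ext _
    ((DerivedCategory.singleFunctor (ModuleCat.{u} R) 0).map_smul c f)

/-- The connecting morphism lives in the ambient derived category. It is brought back along the full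
inclusion, corrected by the isomorphism with which the inclusion commutes with shifts. -/
theorem exists_distinguished {S : ShortComplex (ModuleCat.{u} R)} (hS : S.ShortExact)
    (h₁ : isFinDim k R S.X₁) (h₂ : isFinDim k R S.X₂) (h₃ : isFinDim k R S.X₃) :
    ∃ δ : of k S.X₃ h₃ ⟶ (of k S.X₁ h₁)⟦(1 : ℤ)⟧,
      Triangle.mk (mapOf h₁ h₂ S.f) (mapOf h₂ h₃ S.g) δ ∈ distTriang (BoundedDerived k R) := by
  refine ⟨(isBoundedFinDim k R).fullyFaithfulι.preimage (hS.singleδ ≫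
    ((isBoundedFinDim k R).ι.commShiftIso (1 : ℤ)).inv.app (of k S.X₁ h₁)), ?_⟩
  refine isomorphic_distinguished _ hS.singleTriangle_distinguished _
    (Triangle.isoMk _ _ (Iso.refl _) (Iso.refl _) (Iso.refl _) ?_ ?_ ?_)
  · exact (Category.comp_id _).trans (Category.id_comp _).symm
  · exact (Category.comp_id _).trans (Category.id_comp _).symm
  · refine (congrArg (_ ≫ ·) ((shiftFunctor _ (1 : ℤ)).map_id _)).trans
      ((Category.comp_id _).trans (Eq.trans ?_ (Category.id_comp _).symm))
    refine (Category.assoc _ _ _).trans ((congrArg (hS.singleδ ≫ ·) (Iso.inv_hom_id_app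
      ((isBoundedFinDim k R).ι.commShiftIso (1 : ℤ)) (of k S.X₁ h₁))).trans (Category.comp_id _))

theorem hom_eq_zero_of_neg {n : ℤ} (hn : n < 0) (f : of k M hM ⟶ (of k N hN)⟦n⟧) : f = 0 := by
  refine eq_zero_of_forall_eq_zero (fun f => ?_) f
  have h₁ : DerivedCategory.TStructure.t.IsLE (of k M hM).obj 0 :=
    inferInstanceAs (((DerivedCategory.singleFunctor (ModuleCat.{u} R) 0).obj M).IsLE 0)
  have h₂ : DerivedCategory.TStructure.t.IsGE (of k N hN).obj 0 :=
    inferInstanceAs (((DerivedCategory.singleFunctor (ModuleCat.{u} R) 0).obj N).IsGE 0)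
  have := DerivedCategory.TStructure.t.isGE_shift (of k N hN).obj 0 n (-n)
  exact DerivedCategory.TStructure.t.zero f 0 (-n)

/-- Negative degrees vanish by the t-structure. In positive degrees the morphisms are Ext groups. -/
theorem hom_eq_zero_of_projective [Projective M] {n : ℤ} (hn : n ≠ 0)
    (f : of k M hM ⟶ (of k N hN)⟦n⟧) : f = 0 := by
  obtain hn | hn := lt_or_gt_of_ne hn
  · exact hom_eq_zero_of_neg hn f
  · refine eq_zero_of_forall_eq_zero (fun f => ?_) f
    obtain ⟨m, rfl⟩ : ∃ m : ℕ, n = ((m + 1 : ℕ) : ℤ) := ⟨(n - 1).toNat, by omega⟩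
    have := HasExt.standard (ModuleCat.{u} R)
    obtain ⟨e, rfl⟩ := (Abelian.Ext.homEquiv (C := ModuleCat.{u} R) (X := M) (Y := N)).surjective f
    rw [Abelian.Ext.eq_zero_of_projective e]
    exact Abelian.Ext.zero_hom _ _ _

theorem exists_eq_mk₀_mapOf (f : of k M hM ⟶ (of k N hN)⟦(0 : ℤ)⟧) :
    ∃ g, f = ShiftedHom.mk₀ (0 : ℤ) rfl (mapOf hM hN g) := by
  obtain ⟨f, rfl⟩ := (ShiftedHom.homEquiv (0 : ℤ) rfl).surjective f
  obtain ⟨g, rfl⟩ := exists_eq_mapOf f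
  exact ⟨g, rfl⟩

theorem mapOf_comp_mk₀ {L : ModuleCat.{u} R} {hL : isFinDim k R L} (f : L ⟶ M) (g : M ⟶ N) :
    mapOf hL hM f ≫ ShiftedHom.mk₀ (0 : ℤ) rfl (mapOf hM hN g) =
      ShiftedHom.mk₀ (0 : ℤ) rfl (mapOf hL hN (f ≫ g)) := by
  rw [mapOf_comp (hM := hM)]
  exact (Category.assoc _ _ _).symm

theorem hom_eq_zero_of_projective_of_forall [Projective M] (h : ∀ f : M ⟶ N, f = 0) (n : ℤ)
    (f : of k M hM ⟶ (of k N hN)⟦n⟧) : f = 0 := by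
  by_cases hn : n = 0
  · subst hn
    obtain ⟨g, rfl⟩ := exists_eq_mk₀_mapOf f
    rw [h g, mapOf_zero, ShiftedHom.mk₀_zero]
  · exact hom_eq_zero_of_projective hn f

/-- A morphism of projective modules that induces a bijection on the morphisms to `N` induces
bijections on the morphisms to the shifts of `N`. -/
theorem bijective_mapOf_comp {P P' : ModuleCat.{u} R} [Projective P] [Projective P']
    {hP : isFinDim k R P} {hP' : isFinDim k R P'} {d : P' ⟶ P}
    (h : Function.Bijective fun f : P ⟶ N => d ≫ f) (n : ℤ) :
    Function.Bijective fun f : of k P hP ⟶ (of k N hN)⟦n⟧ => mapOf hP' hP d ≫ f := by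
  by_cases hn : n = 0
  · subst hn
    constructor
    · intro f f' hf
      obtain ⟨g, rfl⟩ := exists_eq_mk₀_mapOf f
      obtain ⟨g', rfl⟩ := exists_eq_mk₀_mapOf f'
      dsimp only at hf
      rw [mapOf_comp_mk₀, mapOf_comp_mk₀] at hf
      rw [h.1 (mapOf_injective ((ShiftedHom.homEquiv (0 : ℤ) rfl).injective hf))]
    · intro f
      obtain ⟨g, rfl⟩ := exists_eq_mk₀_mapOf f
      obtain ⟨g', rfl⟩ := h.2 g
      exact ⟨ShiftedHom.mk₀ (0 : ℤ) rfl (mapOf hP hN g'), mapOf_comp_mk₀ _ _⟩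
  · exact ⟨fun f f' _ => (hom_eq_zero_of_projective hn f).trans
      (hom_eq_zero_of_projective hn f').symm, fun f =>
        ⟨0, comp_zero.trans (hom_eq_zero_of_projective hn f).symm⟩⟩

end BoundedDerived

theorem CyclicQuiver.add_natCast_ne {r : ℕ} (i : CyclicQuiver r) (a : Fin (r - 1)) :
    i + 1 + ((a : ℕ) : CyclicQuiver r) ≠ i := by
  intro h
  have ha := a.2
  have h2 : (((a : ℕ) + 1 : ℕ) : CyclicQuiver r) = ((0 : ℕ) : CyclicQuiver r) := by
    rw [Nat.cast_add, Nat.cast_one, Nat.cast_zero]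
    linear_combination h
  have := CyclicQuiver.natCast_injective_of_lt (by omega) (by omega) h2
  omega

/-! ### Morphisms between simples and projectives in all degrees. -/

namespace CyclicAlgebra

variable {k : Type u} [Field k] {r : ℕ} [NeZero r]

theorem isFinDim_radical (i : CyclicQuiver r) :
    isFinDim k (CyclicAlgebra k r)ᵐᵒᵖ (radical k r i) :=
  (isFinDim k (CyclicAlgebra k r)ᵐᵒᵖ).prop_X₁_of_shortExact (topSequence_shortExact i)
    (isFinDim_proj k r i)

variable [HasDerivedCategory.{w} (ModuleCat.{u} (CyclicAlgebra k r)ᵐᵒᵖ)]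

variable (k r) in
/-- The radical of `P_i` as an object of the bounded derived category. -/
def radicalObj (i : CyclicQuiver r) : BoundedDerived k (CyclicAlgebra k r)ᵐᵒᵖ :=
  BoundedDerived.of k (radical k r i) (isFinDim_radical i)

open BoundedDerived

/-- The triangle of the extension of `S_i` by the radical of `P_i`. -/
theorem exists_topTriangle (i : CyclicQuiver r) :
    ∃ α : ShiftedHom (simpleObj k r i) (radicalObj k r i) (1 : ℤ),
      Triangle.mk (show radicalObj k r i ⟶ projObj k r i from
          mapOf (isFinDim_radical i) (isFinDim_proj k r i) (radicalι i))
        (show projObj k r i ⟶ simpleObj k r i from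
          mapOf (isFinDim_proj k r i) (isFinDim_simple k r i) (projToSimple i)) α ∈ distTriang _ :=
  exists_distinguished (topSequence_shortExact i) _ _ _

/-- The triangle of the presentation of the radical of `P_i`. -/
theorem exists_socleTriangle (i : CyclicQuiver r) :
    ∃ β : ShiftedHom (radicalObj k r i) (simpleObj k r i) (1 : ℤ),
      Triangle.mk (show simpleObj k r i ⟶ projObj k r (i + 1) from
          mapOf (isFinDim_simple k r i) (isFinDim_proj k r (i + 1)) (socleι i))
        (show projObj k r (i + 1) ⟶ radicalObj k r i from
          mapOf (isFinDim_proj k r (i + 1)) (isFinDim_radical i) (projToRadical i)) β ∈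
      distTriang _ :=
  exists_distinguished (socleSequence_shortExact i) _ _ _

theorem simpleObj_hom_eq_zero_of_neg (i j : CyclicQuiver r) {n : ℤ} (hn : n < 0)
    (f : simpleObj k r i ⟶ (simpleObj k r j)⟦n⟧) : f = 0 :=
  hom_eq_zero_of_neg hn f

theorem projObj_hom_simpleObj_eq_zero {i j : CyclicQuiver r} (h : i ≠ j) (n : ℤ)
    (f : projObj k r i ⟶ (simpleObj k r j)⟦n⟧) : f = 0 :=
  hom_eq_zero_of_projective_of_forall (fun f => proj_hom_simple_eq_zero h f) n f

/-- Only P_i and P_{i+1} occur in the resolution of S_i, and neither maps to a shift of S_j. The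
bijection required by periodicity is between zero spaces. -/
theorem simpleObj_hom_simpleObj_eq_zero {i j : CyclicQuiver r} (h : i ≠ j) (h' : i + 1 ≠ j)
    (n : ℤ) (f : simpleObj k r i ⟶ (simpleObj k r j)⟦n⟧) : f = 0 := by
  obtain ⟨α, hα⟩ := exists_topTriangle (k := k) i
  obtain ⟨β, hβ⟩ := exists_socleTriangle (k := k) i
  refine ShiftedHom.eq_zero_of_periodic hα hβ (fun n => ⟨fun f f' _ => ?_, fun f => ⟨0, ?_⟩⟩)
    (fun n hn f => simpleObj_hom_eq_zero_of_neg i j hn f) n f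
  · rw [projObj_hom_simpleObj_eq_zero h n f, projObj_hom_simpleObj_eq_zero h n f']
  · exact comp_zero.trans (projObj_hom_simpleObj_eq_zero h' n f).symm

theorem simpleObj_hom_projObj_eq_zero {i j : CyclicQuiver r} (h : j ≠ i) (n : ℤ)
    (f : simpleObj k r j ⟶ (projObj k r (i + 1))⟦n⟧) : f = 0 := by
  obtain ⟨α, hα⟩ := exists_topTriangle (k := k) j
  obtain ⟨β, hβ⟩ := exists_socleTriangle (k := k) j
  refine ShiftedHom.eq_zero_of_periodic hα hβ (fun n => ?_)
    (fun n hn f => hom_eq_zero_of_neg hn f) n f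
  have := bijective_mapOf_comp (hP := isFinDim_proj k r j) (hP' := isFinDim_proj k r (j + 1))
    (hN := isFinDim_proj k r (i + 1)) (bijective_projToRadical_comp (k := k) h) n
  rw [mapOf_comp (hM := isFinDim_radical j)] at this
  exact this

/-- Going from the later index b to the earlier a, a nonzero morphism would require a = b or a = b+1
modulo r. As b+1 < r, there is no wrap-around: it would have to pass through the omitted vertex i.
-/
theorem isSemiorthogonal_simpleSeq (i : CyclicQuiver r) :
    IsSemiorthogonal (simpleSeq k r i) := by
  intro a b hab n f
  have ha := a.2
  have hb := b.2
  have hab' : (a : ℕ) < b := hab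
  refine simpleObj_hom_simpleObj_eq_zero (fun h => ?_) (fun h => ?_) n f
  · have := CyclicQuiver.natCast_injective_of_lt (by omega) (by omega) (add_left_cancel h)
    omega
  · rw [add_assoc] at h
    have h2 : (((b : ℕ) + 1 : ℕ) : CyclicQuiver r) = ((a : ℕ) : CyclicQuiver r) := by
      rw [Nat.cast_add, Nat.cast_one]
      exact add_left_cancel h
    have := CyclicQuiver.natCast_injective_of_lt (by omega) (by omega) h2
    omega

/-- If `r ≥ 2`, then `Ext^•(S_i, S_i)` is a polynomial algebra on a generator of degree two. -/
theorem exists_bijective_aeval (i : CyclicQuiver r) (hr : 2 ≤ r) :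
    ∃ θ : ShiftedHom (simpleObj k r i) (simpleObj k r i) (2 : ℤ),
      Function.Bijective (Polynomial.aeval (R := k)
        (DirectSum.of (fun n : ℤ => ShiftedHom (simpleObj k r i) (simpleObj k r i) n) 2 θ :
          ExtAlgebra (simpleObj k r i))) := by
  obtain ⟨α, hα⟩ := exists_topTriangle (k := k) i
  obtain ⟨β, hβ⟩ := exists_socleTriangle (k := k) i
  -- Here r ≥ 2 is needed, so that i+1 ≠ i.
  have hP' : ∀ (n : ℤ) (φ : projObj k r (i + 1) ⟶ (simpleObj k r i)⟦n⟧), φ = 0 := by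
    refine projObj_hom_simpleObj_eq_zero fun h => ?_
    have := CyclicQuiver.natCast_injective_of_lt (r := r) (n := 1) (m := 0) (by omega) (by omega)
      (by rw [Nat.cast_one, Nat.cast_zero]; linear_combination h)
    omega
  have hP : ∀ n : ℤ, n ≠ 0 → ∀ φ : projObj k r i ⟶ (simpleObj k r i)⟦n⟧, φ = 0 :=
    fun n hn φ => hom_eq_zero_of_projective hn φ
  refine ⟨α.comp β rfl, ExtAlgebra.bijective_aeval k _
    (fun n hn φ => simpleObj_hom_eq_zero_of_neg i i hn φ)
    (ShiftedHom.eq_zero_of_periodic_one hα hβ hP' hP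
      (simpleObj_hom_eq_zero_of_neg i i (by omega))) (fun φ => ?_) (fun h => ?_) ?_⟩
  · obtain ⟨g, rfl⟩ := exists_eq_mapOf φ
    obtain ⟨c, rfl⟩ := exists_simple_hom_eq_smul g
    exact ⟨c, by rw [mapOf_smul, mapOf_id]; rfl⟩
  · refine simple_id_ne_zero (k := k) i (mapOf_injective (hM := isFinDim_simple k r i)
      (hN := isFinDim_simple k r i) ?_)
    rw [mapOf_id, mapOf_zero]
    exact h
  · intro m n hmn hm
    exact ShiftedHom.bijective_comp_of_periodic hα hβ hP' hP hmn hm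

end CyclicAlgebra

/-! ### Coproducts in the derived category by K-projective complexes. -/

section Coproducts

variable {C : Type u} [Category.{v} C] [Abelian C] {ι : Type*} {K : ι → CochainComplex C ℤ}
  {L P : CochainComplex C ℤ} {i : ∀ m, K m ⟶ P}

/-- Homotopies to zero on the summands define a homotopy to zero on a degreewise coproduct. -/
def homotopyZeroOfCoproduct
    (hP : ∀ n : ℤ, IsColimit (Cofan.mk (P.X n) fun m => (i m).f n))
    {f : P ⟶ L} (h : ∀ m, Homotopy (i m ≫ f) 0) : Homotopy f 0 where
  hom a b := Cofan.IsColimit.desc (hP a) fun m => (h m).hom a b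
  zero a b hab := by
    refine Cofan.IsColimit.hom_ext (hP a) _ _ fun m => ?_
    rw [Cofan.IsColimit.fac, comp_zero, (h m).zero a b hab]
  comm a := by
    refine Cofan.IsColimit.hom_ext (hP a) _ _ fun m => ?_
    have hm := (h m).comm a
    have hfac (a b : ℤ) : (i m).f a ≫ Cofan.IsColimit.desc (hP a) (fun m => (h m).hom a b) =
        (h m).hom a b := Cofan.IsColimit.fac (hP a) (fun m => (h m).hom a b) m
    rw [dNext_eq _ (show (ComplexShape.up ℤ).Rel a (a + 1) from rfl),
      prevD_eq _ (show (ComplexShape.up ℤ).Rel (a - 1) a from sub_add_cancel a 1)] at hm ⊢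
    change (i m).f a ≫ f.f a = (i m).f a ≫ _
    rw [Preadditive.comp_add, Preadditive.comp_add, (i m).comm_assoc, hfac, ← Category.assoc,
      hfac]
    simpa using hm

theorem isKProjective_of_coproduct [∀ m, (K m).IsKProjective]
    (hP : ∀ n : ℤ, IsColimit (Cofan.mk (P.X n) fun m => (i m).f n)) : P.IsKProjective where
  nonempty_homotopy_zero f hL :=
    ⟨homotopyZeroOfCoproduct hP fun m => CochainComplex.IsKProjective.homotopyZero (i m ≫ f) hL⟩

variable [HasDerivedCategory.{w} C]

open DerivedCategory

theorem exists_Q_map_eq [P.IsKProjective] (φ : Q.obj P ⟶ Q.obj L) : ∃ f : P ⟶ L, φ = Q.map f := by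
  obtain ⟨g, hg⟩ := (CochainComplex.IsKProjective.Qh_map_bijective P _).2
    ((quotientCompQhIso C).hom.app P ≫ φ ≫ (quotientCompQhIso C).inv.app L)
  obtain ⟨f, rfl⟩ := (HomotopyCategory.quotient _ _).map_surjective g
  refine ⟨f, ?_⟩
  rw [← cancel_mono ((quotientCompQhIso C).inv.app L), quotientCompQhIso_inv_naturality, hg]
  simp

theorem nonempty_homotopy_zero_of_Q_map_eq_zero [P.IsKProjective] {f : P ⟶ L}
    (hf : Q.map f = 0) : Nonempty (Homotopy f 0) := by
  refine ⟨HomotopyCategory.homotopyOfEq _ _ ?_⟩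
  apply (CochainComplex.IsKProjective.Qh_map_bijective P _).1
  rw [← cancel_mono ((quotientCompQhIso C).hom.app L), quotientCompQhIso_hom_naturality,
    hf, Functor.map_zero, Functor.map_zero, zero_comp, comp_zero]

theorem Q_map_eq_zero_of_homotopy {f : P ⟶ L} (h : Homotopy f 0) : Q.map f = 0 := by
  rw [← cancel_epi ((quotientCompQhIso C).hom.app P), ← quotientCompQhIso_hom_naturality,
    HomotopyCategory.eq_of_homotopy f 0 h, Functor.map_zero, Functor.map_zero, zero_comp, comp_zero]

/-- The localization functor commutes with coproducts of K-projective complexes. -/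
theorem nonempty_isColimit_Q [∀ m, (K m).IsKProjective] [HasColimitsOfShape (Discrete ι) C]
    (hP : IsColimit (Cofan.mk P i)) :
    Nonempty (IsColimit (Cofan.mk (Q.obj P) fun m => Q.map (i m))) := by
  have hP' (n : ℤ) : IsColimit (Cofan.mk (P.X n) fun m => (i m).f n) :=
    isColimitCofanMkObjOfIsColimit (HomologicalComplex.eval C (ComplexShape.up ℤ) n) _ _ hP
  have := isKProjective_of_coproduct hP'
  -- Existence: maps out of a K-projective complex come from chain maps, which glue on the
  -- coproduct. Uniqueness, below, glues the null-homotopies in the same way.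
  have exists_desc (X : DerivedCategory C) (φ : ∀ m, Q.obj (K m) ⟶ X) :
      ∃ ψ : Q.obj P ⟶ X, ∀ m, Q.map (i m) ≫ ψ = φ m := by
    obtain ⟨L, ⟨e⟩⟩ : ∃ L, Nonempty (Q.obj L ≅ X) := ⟨_, ⟨Q.objObjPreimageIso X⟩⟩
    choose f hf using fun m => exists_Q_map_eq (φ m ≫ e.inv)
    refine ⟨Q.map (Cofan.IsColimit.desc hP f) ≫ e.hom, fun m => ?_⟩
    have hm : i m ≫ Cofan.IsColimit.desc hP f = f m := Cofan.IsColimit.fac hP f m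
    rw [← Category.assoc, ← Q.map_comp, hm, ← hf, Category.assoc, Iso.inv_hom_id,
      Category.comp_id]
  have ext_zero (X : DerivedCategory C) (ψ : Q.obj P ⟶ X) (h : ∀ m, Q.map (i m) ≫ ψ = 0) :
      ψ = 0 := by
    obtain ⟨L, ⟨e⟩⟩ : ∃ L, Nonempty (Q.obj L ≅ X) := ⟨_, ⟨Q.objObjPreimageIso X⟩⟩
    obtain ⟨f, hf⟩ := exists_Q_map_eq (ψ ≫ e.inv)
    have hf' (m) : Q.map (i m ≫ f) = 0 := by
      rw [Q.map_comp, ← hf, ← Category.assoc, h, zero_comp]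
    rw [← cancel_mono e.inv, zero_comp, hf]
    exact Q_map_eq_zero_of_homotopy (homotopyZeroOfCoproduct hP' fun m =>
      (nonempty_homotopy_zero_of_Q_map_eq_zero (hf' m)).some)
  choose desc hdesc using exists_desc
  refine ⟨Cofan.IsColimit.mk _ (fun s => desc s.pt s.inj) (fun s m => hdesc s.pt s.inj m) ?_⟩
  intro s ψ hψ
  rw [← sub_eq_zero]
  refine ext_zero _ _ fun m => ?_
  rw [Preadditive.comp_sub, sub_eq_zero, hdesc]
  exact hψ m

theorem hasCoproduct_of_iso_Q [∀ m, (K m).IsKProjective] [HasColimitsOfShape (Discrete ι) C]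
    {X : ι → DerivedCategory C} (e : ∀ m, X m ≅ Q.obj (K m)) : HasCoproduct X := by
  obtain ⟨h⟩ := nonempty_isColimit_Q (K := K) (i := Sigma.ι K) (coproductIsCoproduct K)
  have : HasCoproduct fun m => Q.obj (K m) := ⟨⟨⟨_, h⟩⟩⟩
  exact hasColimit_of_iso (Discrete.natIso fun ⟨m⟩ => e m :
    Discrete.functor X ≅ Discrete.functor fun m => Q.obj (K m))

/-- A projective resolution is a K-projective model of M, and its shifts are models of the shifts of
M. -/
theorem hasCoproduct_shift_singleFunctor [EnoughProjectives C] [HasColimitsOfShape (Discrete ι) C]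
    (M : C) (a : ι → ℤ) :
    HasCoproduct fun m => ((singleFunctor C 0).obj M)⟦a m⟧ := by
  have := HasExt.standard C
  let R := ProjectiveResolution.of M
  have hR : IsIso (Q.map R.π') := by
    rw [isIso_Q_map_iff_quasiIso]
    infer_instance
  exact hasCoproduct_of_iso_Q (K := fun m => R.cochainComplex⟦a m⟧) fun m =>
    (shiftFunctor _ (a m)).mapIso ((singleFunctorIsoCompQ C 0).app M ≪≫ (asIso (Q.map R.π')).symm)
      ≪≫ (Q.commShiftIso (a m)).symm.app R.cochainComplex

end Coproducts

/-! ### Vanishing of homotopy colimits. -/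

section Hocolim

variable {C : Type u} [Category.{v} C] [Abelian C] [HasDerivedCategory.{w} C]

open DerivedCategory

/-- An endomorphism of a coproduct `⨁ X m` with `X m ∈ D^{≤ a m}` and `a m ⟶ -∞` vanishes on
cohomology in degree `n` if this holds for its restrictions to the summands. -/
theorem homologyFunctor_map_eq_zero_of_coproduct {X : ℕ → DerivedCategory C} {c : Cofan X}
    (hc : IsColimit c) {n : ℤ} {N : ℕ} (hX : ∀ m, N ≤ m → (X m).IsLE (n - 1))
    {Y : DerivedCategory C} (σ : c.pt ⟶ Y)
    (hσ : ∀ m, (homologyFunctor C n).map (c.inj m ≫ σ) = 0) :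
    (homologyFunctor C n).map σ = 0 := by
  -- Projections to the summands. They define the idempotent s onto the first N summands, the only
  -- ones that matter for cohomology in degree n.
  let p (m : ℕ) : c.pt ⟶ X m := Cofan.IsColimit.desc hc fun j =>
    if h : j = m then eqToHom (by rw [h]) else 0
  have hp (m : ℕ) : c.inj m ≫ p m = 𝟙 _ := by
    rw [Cofan.IsColimit.fac, dif_pos rfl, eqToHom_refl]
  have hp' {j m : ℕ} (h : j ≠ m) : c.inj j ≫ p m = 0 := by
    rw [Cofan.IsColimit.fac, dif_neg h]
  let s : c.pt ⟶ c.pt := ∑ m ∈ Finset.range N, p m ≫ c.inj m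
  have hs (j : ℕ) (hj : j < N) : c.inj j ≫ s = c.inj j := by
    rw [Preadditive.comp_sum, Finset.sum_eq_single j, ← Category.assoc, hp, Category.id_comp]
    · intro m _ hm
      rw [← Category.assoc, hp' hm.symm, zero_comp]
    · intro h
      exact absurd (Finset.mem_range.2 hj) h
  have hs' (j : ℕ) (hj : N ≤ j) : c.inj j ≫ s = 0 := by
    rw [Preadditive.comp_sum]
    refine Finset.sum_eq_zero fun m hm => ?_
    rw [← Category.assoc, hp' (by have := Finset.mem_range.1 hm; omega), zero_comp]
  -- 1 - s is zero on the first N summands, and each further summand has no map to the truncation B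
  -- in degrees ≥ n. So 1 - s factors through A, which has no cohomology in degree n.
  have he : (homologyFunctor C n).map (𝟙 c.pt - s) = 0 := by
    obtain ⟨A, B, hA, hB, f, g, h, hT⟩ := TStructure.t.exists_triangle c.pt (n - 1) n (by omega)
    have hA' : A.IsLE (n - 1) := ⟨hA⟩
    have hB' : B.IsGE n := ⟨hB⟩
    obtain ⟨ψ, hψ⟩ := exists_eq_comp_mor₁ hT (𝟙 c.pt - s) (by
      refine Cofan.IsColimit.hom_ext hc _ _ fun m => ?_
      rw [comp_zero, ← Category.assoc, Preadditive.comp_sub, Category.comp_id]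
      obtain hm | hm := lt_or_ge m N
      · rw [hs m hm, sub_self, zero_comp]
      · have := hX m hm
        exact TStructure.t.zero _ (n - 1) n)
    rw [hψ, Functor.map_comp, (isZero_of_isLE A (n - 1) n (by omega)).eq_of_src
      ((homologyFunctor C n).map f) 0, comp_zero]
  have hdecomp : σ = (𝟙 c.pt - s) ≫ σ + ∑ m ∈ Finset.range N, p m ≫ c.inj m ≫ σ := by
    simp only [← Category.assoc, ← Preadditive.sum_comp, ← Preadditive.add_comp]
    rw [sub_add_cancel, Category.id_comp]
  rw [hdecomp, Functor.map_add, Functor.map_comp, he, zero_comp, zero_add, Functor.map_sum]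
  refine Finset.sum_eq_zero fun m _ => ?_
  rw [Functor.map_comp, hσ, comp_zero]

/-- The shift map σ of the coproduct is zero on cohomology, so 1 - σ is the identity there. Thus 1 -
σ is an isomorphism and its cone vanishes. -/
theorem isHocolim_zero {X : ℕ → DerivedCategory C} [HasCoproduct X] (f : ∀ m, X m ⟶ X (m + 1))
    (hX : ∀ n : ℤ, ∃ N : ℕ, ∀ m, N ≤ m → (X m).IsLE n)
    (hf : ∀ (m : ℕ) (n : ℤ), (homologyFunctor C n).map (f m) = 0) :
    ∃ Y, IsHocolim X f Y ∧ IsZero Y := by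
  let c := Cofan.mk (∐ X) (Sigma.ι X)
  have hc : IsColimit c := coproductIsCoproduct X
  let σ : c.pt ⟶ c.pt := Cofan.IsColimit.desc hc fun n => f n ≫ c.inj (n + 1)
  have hσ : IsIso (𝟙 c.pt - σ) := by
    rw [DerivedCategory.isIso_iff]
    intro n
    obtain ⟨N, hN⟩ := hX (n - 1)
    rw [Functor.map_sub, homologyFunctor_map_eq_zero_of_coproduct hc hN σ, sub_zero,
      CategoryTheory.Functor.map_id]
    · infer_instance
    · intro m
      rw [Cofan.IsColimit.fac, Functor.map_comp, hf, zero_comp]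
  obtain ⟨Y, g, h, hT⟩ := distinguished_cocone_triangle (𝟙 c.pt - σ)
  exact ⟨Y, ⟨c, hc, g, h, hT⟩, Triangle.isZero₃_of_isIso₁ _ hT hσ⟩

/-- The homotopy colimit of `M ⟶ M[q] ⟶ M[2q] ⟶ ⋯` is zero for a module `M` and `q > 0`. -/
theorem isHocolim_zero_of_singleFunctor [EnoughProjectives C] [HasColimitsOfShape (Discrete ℕ) C]
    (M : C) {q : ℤ} (hq : 0 < q)
    (θ : ShiftedHom ((singleFunctor C 0).obj M) ((singleFunctor C 0).obj M) q) :
    ∃ Y, IsHocolim (fun n : ℕ => ((singleFunctor C 0).obj M)⟦q * (n : ℤ)⟧)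
      (fun n => shiftSequenceMap θ n) Y ∧ IsZero Y := by
  have := hasCoproduct_shift_singleFunctor M fun n : ℕ => q * (n : ℤ)
  have hLE (a : ℤ) : (((singleFunctor C 0).obj M)⟦a⟧).IsLE (-a) :=
    TStructure.t.isLE_shift _ 0 a (-a)
  have hGE (a : ℤ) : (((singleFunctor C 0).obj M)⟦a⟧).IsGE (-a) :=
    TStructure.t.isGE_shift _ 0 a (-a)
  -- The bound |n| suffices: q ≥ 1 and m ≥ |n| give -qm ≤ n.
  refine isHocolim_zero _ (fun n => ⟨n.natAbs, fun m hm => ?_⟩) (fun m n => ?_)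
  · have : -(q * (m : ℤ)) ≤ n := by nlinarith [abs_le.1 (le_refl |n|), Int.natCast_natAbs n]
    exact TStructure.t.isLE_of_le _ _ n this
  -- Source and target have cohomology in the distinct single degrees -qm and -q(m+1), so in each
  -- degree one of the two is zero.
  · by_cases hn : n = -(q * (m : ℤ))
    · have : -(q * ((m + 1 : ℕ) : ℤ)) < n := by
        push_cast
        nlinarith
      exact (isZero_of_isLE _ _ n this).eq_of_tgt _ _
    · obtain hn | hn := lt_or_gt_of_ne hn
      · exact (isZero_of_isGE _ _ n hn).eq_of_src _ _
      · exact (isZero_of_isLE _ _ n hn).eq_of_src _ _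

end Hocolim

namespace CyclicAlgebra

variable {k : Type u} [Field k] {r : ℕ} [NeZero r]
  [HasDerivedCategory.{w} (ModuleCat.{u} (CyclicAlgebra k r)ᵐᵒᵖ)]

theorem isPInftyObject_simpleObj (i : CyclicQuiver r) (hr : 2 ≤ r) :
    IsPInftyObject k (isBoundedFinDim k (CyclicAlgebra k r)ᵐᵒᵖ).ι 2 (simpleObj k r i) := by
  obtain ⟨θ, hθ⟩ := exists_bijective_aeval (k := k) i hr
  exact ⟨AlgEquiv.ofBijective _ hθ, θ, Polynomial.aeval_X _,
    isHocolim_zero_of_singleFunctor (simple k r i) two_pos _⟩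

end CyclicAlgebra

/-! ### Generation of the bounded derived category by modules. -/

section Generation

variable {k : Type u} [Field k] {R : Type u} [Ring R] [Algebra k R]
  [HasDerivedCategory.{w} (ModuleCat.{u} R)]

open DerivedCategory

/-- Induction on the number of degrees that may carry cohomology: truncation splits off the top
cohomology, a shifted module, and leaves a shorter complex. -/
theorem prop_of_isGE_of_isLE {Q : ObjectProperty (DerivedCategory (ModuleCat.{u} R))}
    [Q.IsTriangulated] [Q.IsClosedUnderIsomorphisms]
    (hQ : ∀ M, isFinDim k R M → Q ((singleFunctor _ 0).obj M))
    (n : ℕ) (a b : ℤ) (hab : b < a + n) (X : DerivedCategory (ModuleCat.{u} R))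
    (hX : hasFinDimHomology k R X) [X.IsGE a] [X.IsLE b] : Q X := by
  induction n generalizing X b with
  | zero => exact Q.prop_of_isZero (TStructure.t.isZero X b a (by omega))
  | succ n ih =>
    obtain hlt | hle := lt_or_ge b a
    · exact Q.prop_of_isZero (TStructure.t.isZero X b a hlt)
    obtain ⟨A, B, hA, hB, f, g, h, hT⟩ := TStructure.t.exists_triangle X (b - 1) b (by omega)
    have hA' : A.IsLE (b - 1) := ⟨hA⟩
    have hB' : B.IsGE b := ⟨hB⟩
    have hA'' : (A⟦(1 : ℤ)⟧).IsLE (b - 2) := TStructure.t.isLE_shift A (b - 1) 1 (b - 2)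
    have hB'' : (B⟦(-1 : ℤ)⟧).IsGE (b + 1) := TStructure.t.isGE_shift B b (-1) (b + 1)
    have hex (i : ℤ) := (homologyFunctor (ModuleCat.{u} R) i).map_distinguished_exact _
      (rot_of_distTriang _ hT)
    have hex' (i : ℤ) := (homologyFunctor (ModuleCat.{u} R) i).map_distinguished_exact _
      (inv_rot_of_distTriang _ hT)
    have hBLE : B.IsLE b := by
      rw [isLE_iff]
      intro i hi
      exact (hex i).isZero_X₂ ((isZero_of_isLE X b i hi).eq_of_src _ _)
        ((isZero_of_isLE (A⟦(1 : ℤ)⟧) (b - 2) i (by omega)).eq_of_tgt _ _)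
    have hAGE : A.IsGE a := by
      rw [isGE_iff]
      intro i hi
      exact (hex' i).isZero_X₂ ((isZero_of_isGE (B⟦(-1 : ℤ)⟧) (b + 1) i (by omega)).eq_of_src _ _)
        ((isZero_of_isGE X a i hi).eq_of_tgt _ _)
    have hBfin : isFinDim k R ((homologyFunctor _ b).obj B) :=
      (isFinDim k R).prop_X₂_of_exact (hex b) (hX b)
        ((isFinDim k R).prop_of_isZero (isZero_of_isLE (A⟦(1 : ℤ)⟧) (b - 2) b (by omega)))
    obtain ⟨M, ⟨e⟩⟩ := exists_iso_singleFunctor_obj_of_isGE_of_isLE B b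
    have hM : isFinDim k R M := (isFinDim k R).prop_of_iso
      ((homologyFunctor _ b).mapIso e ≪≫ (singleFunctorCompHomologyFunctorIso _ b).app M) hBfin
    have e' : B ≅ ((singleFunctor _ 0).obj M)⟦-b⟧ :=
      e ≪≫ (((singleFunctors (ModuleCat.{u} R)).shiftIso (-b) b 0 (by omega)).app M).symm
    have hBfin' : hasFinDimHomology k R B := (hasFinDimHomology k R).prop_of_iso e'.symm
      ((hasFinDimHomology k R).le_shift (-b) _ (isBoundedFinDim_single k hM).2)
    have hAfin := (hasFinDimHomology k R).ext_of_isTriangulatedClosed₁ _ hT hX hBfin'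
    exact Q.ext_of_isTriangulatedClosed₂ _ hT (ih (b - 1) (by push_cast at hab; omega) A hAfin)
      (Q.prop_of_iso e'.symm (Q.le_shift (-b) _ (hQ M hM)))

/-- The bounded derived category is generated by the finite dimensional modules. -/
theorem BoundedDerived.eq_top {Q : ObjectProperty (BoundedDerived k R)} [Q.IsTriangulated]
    [Q.IsClosedUnderIsomorphisms] (hQ : ∀ M hM, Q (BoundedDerived.of k M hM)) : Q = ⊤ := by
  rw [eq_top_iff]
  rintro X -
  obtain ⟨⟨⟨a, ha⟩, ⟨b, hb⟩⟩, hX⟩ := X.property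
  -- The truncation argument runs in the ambient derived category, so Q is replaced by its image
  -- there.
  obtain ⟨Y, hY, ⟨e⟩⟩ := prop_of_isGE_of_isLE (Q := Q.map (isBoundedFinDim k R).ι)
    (fun M hM => Q.prop_map_obj _ (hQ M hM)) (b - a + 1).toNat a b (by omega) X.obj hX
  exact Q.prop_of_iso ((isBoundedFinDim k R).isoMk e) hY

end Generation

/-! ### The two semiorthogonal decompositions. -/

namespace CyclicAlgebra

open MulOpposite

variable {k : Type u} [Field k] {r : ℕ} [NeZero r]

/-- A path of positive length from i back to i has length at least r and is zero. So S_i is not a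
composition factor of rad P_i. -/
theorem path_one_mul_mul_idem (i : CyclicQuiver r) (y : CyclicAlgebra k r) :
    path k r i 1 * y * idem k r i = 0 := by
  have hr := NeZero.pos r
  have h1 := idem_mul_mul_idem (k := k) (i + 1) (n := r - 1) (by omega) y
  have h2 : i + 1 + ((r - 1 : ℕ) : CyclicQuiver r) = i := by
    have : ((r - 1 + 1 : ℕ) : CyclicQuiver r) = 0 := by
      rw [Nat.sub_add_cancel hr, CyclicQuiver.natCast_self]
    rw [Nat.cast_add, Nat.cast_one] at this
    linear_combination this
  have h3 : path k r i 1 * idem k r (i + 1) = path k r i 1 :=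
    path_mul_idem k r (by rw [Nat.cast_one])
  have h4 := path_mul_path k r i 1 (r - 1)
  rw [Nat.cast_one] at h4
  rw [h2] at h1
  rw [← h3, mul_assoc, mul_assoc, ← mul_assoc (idem k r (i + 1)), h1, mul_smul_comm, h4,
    path_eq_zero _ (by omega), smul_zero]

variable [HasDerivedCategory.{w} (ModuleCat.{u} (CyclicAlgebra k r)ᵐᵒᵖ)]

/-- A finite dimensional module lies in every triangulated subcategory that contains its
composition factors. -/
theorem prop_of_forall_simpleObj {Q : ObjectProperty (BoundedDerived k (CyclicAlgebra k r)ᵐᵒᵖ)}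
    [Q.IsTriangulated] [Q.IsClosedUnderIsomorphisms]
    (N : ModuleCat.{u} (CyclicAlgebra k r)ᵐᵒᵖ) (hN : isFinDim k (CyclicAlgebra k r)ᵐᵒᵖ N)
    (hQ : ∀ j, (∃ z : N, op (idem k r j) • z ≠ 0) → Q (simpleObj k r j)) :
    Q (BoundedDerived.of k N hN) := by
  let F := ModuleCat.restrictScalars (algebraMap k (CyclicAlgebra k r)ᵐᵒᵖ)
  induction hd : Module.finrank k (F.obj N) using Nat.strong_induction_on generalizing N with
  | _ d ih =>
    by_cases h0 : ∀ y : N, y = 0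
    · refine Q.prop_of_isZero ((IsZero.iff_id_eq_zero _).2 ?_)
      rw [← BoundedDerived.mapOf_id, ← BoundedDerived.mapOf_zero]
      congr 1
      ext y
      exact (h0 _).trans (h0 _).symm
    push Not at h0
    obtain ⟨y, hy⟩ := h0
    obtain ⟨j, f, hf, hz⟩ := exists_simple_mono hy
    have hS : (ShortComplex.mk f (cokernel.π f) (cokernel.condition f)).ShortExact :=
      ShortComplex.ShortExact.mk' (ShortComplex.exact_cokernel f) hf inferInstance
    have hfin : isFinDim k (CyclicAlgebra k r)ᵐᵒᵖ (cokernel f) :=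
      (isFinDim k (CyclicAlgebra k r)ᵐᵒᵖ).prop_of_epi (cokernel.π f) hN
    obtain ⟨δ, hT⟩ := BoundedDerived.exists_distinguished hS (isFinDim_simple k r j) hN hfin
    have hsurj : Function.Surjective (cokernel.π f).hom :=
      (ModuleCat.epi_iff_surjective _).1 inferInstance
    -- Equal dimensions would make the quotient map injective, hence f = 0, impossible for a
    -- monomorphism from a simple module.
    have hlt : Module.finrank k (F.obj (cokernel f)) < d := by
      have hN' : Module.Finite k (F.obj N) := hN
      have hC' : Module.Finite k (F.obj (cokernel f)) := hfin
      have hs : Function.Surjective (F.map (cokernel.π f)).hom := hsurj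
      rw [← hd]
      refine lt_of_le_of_ne (LinearMap.finrank_le_finrank_of_surjective hs) fun heq => ?_
      have hinj := (LinearMap.injective_iff_surjective_of_finrank_eq_finrank heq.symm).2 hs
      have : Mono (cokernel.π f) := (ModuleCat.mono_iff_injective _).2 hinj
      have hf0 : f = 0 := by
        rw [← cancel_mono (cokernel.π f), cokernel.condition, zero_comp]
      refine simple_id_ne_zero (k := k) j ?_
      rw [← cancel_mono f, hf0, comp_zero, comp_zero]
    -- The hypothesis passes to the quotient: an idempotent that acts nontrivially there acts
    -- nontrivially on N.
    refine Q.ext_of_isTriangulatedClosed₂ _ hT (hQ j hz) (ih _ hlt _ hfin ?_ rfl)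
    rintro l ⟨z, hz⟩
    obtain ⟨z, rfl⟩ := hsurj z
    refine hQ l ⟨z, fun h => hz ?_⟩
    rw [← map_smul, h, map_zero]

theorem eq_top_of_simpleObj {Q : ObjectProperty (BoundedDerived k (CyclicAlgebra k r)ᵐᵒᵖ)}
    [Q.IsTriangulated] [Q.IsClosedUnderIsomorphisms] (hQ : ∀ j, Q (simpleObj k r j)) : Q = ⊤ :=
  BoundedDerived.eq_top fun M hM => prop_of_forall_simpleObj M hM fun j _ => hQ j

theorem absorbing_simpleObj {i j : CyclicQuiver r} (h : j ≠ i) :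
    absorbing k r i (simpleObj k r j) := by
  obtain ⟨l, hl, rfl⟩ := exists_eq_add_natCast h
  exact le_generatedBy _ _ (ObjectProperty.ofObj_apply (simpleSeq k r i) ⟨l, by omega⟩)

instance (i : CyclicQuiver r) : (absorbing k r i).IsTriangulated :=
  generatedBy_isTriangulated _

instance (i : CyclicQuiver r) : (absorbing k r i).IsClosedUnderIsomorphisms :=
  generatedBy_isClosedUnderIsomorphisms _

theorem absorbing_radicalObj (i : CyclicQuiver r) : absorbing k r i (radicalObj k r i) := by
  refine prop_of_forall_simpleObj _ _ fun j hj => absorbing_simpleObj ?_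
  rintro rfl
  obtain ⟨⟨z, hz⟩, hj⟩ := hj
  obtain ⟨y, rfl⟩ := mem_radical_iff.1 hz
  exact hj (Subtype.ext (path_one_mul_mul_idem j y))

theorem eq_top_of_absorbing_le {Q : ObjectProperty (BoundedDerived k (CyclicAlgebra k r)ᵐᵒᵖ)}
    [Q.IsTriangulated] [Q.IsClosedUnderIsomorphisms] {i : CyclicQuiver r}
    (hQ : absorbing k r i ≤ Q) (h : Q (simpleObj k r i)) : Q = ⊤ := by
  refine eq_top_of_simpleObj fun j => ?_
  by_cases hj : j = i
  · rw [hj]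
    exact h
  · exact hQ _ (absorbing_simpleObj hj)

/-- S_i is the cone of rad P_i → P_i. -/
theorem eq_top_of_projObj {Q : ObjectProperty (BoundedDerived k (CyclicAlgebra k r)ᵐᵒᵖ)}
    [Q.IsTriangulated] [Q.IsClosedUnderIsomorphisms] {i : CyclicQuiver r}
    (hQ : absorbing k r i ≤ Q) (h : Q (projObj k r i)) : Q = ⊤ := by
  obtain ⟨α, hα⟩ := exists_topTriangle (k := k) i
  exact eq_top_of_absorbing_le hQ
    (Q.ext_of_isTriangulatedClosed₃ _ hα (hQ _ (absorbing_radicalObj i)) h)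

/-- Here S_i is recovered as the fibre of P_{i+1} → rad P_i. -/
theorem eq_top_of_projObj_add_one
    {Q : ObjectProperty (BoundedDerived k (CyclicAlgebra k r)ᵐᵒᵖ)}
    [Q.IsTriangulated] [Q.IsClosedUnderIsomorphisms] {i : CyclicQuiver r}
    (hQ : absorbing k r i ≤ Q) (h : Q (projObj k r (i + 1))) : Q = ⊤ := by
  obtain ⟨β, hβ⟩ := exists_socleTriangle (k := k) i
  exact eq_top_of_absorbing_le hQ
    (Q.ext_of_isTriangulatedClosed₁ _ hβ h (hQ _ (absorbing_radicalObj i)))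

theorem absorbing_le_rightOrthogonal (i : CyclicQuiver r) : absorbing k r i ≤
    (generatedBy (ObjectProperty.singleton (projObj k r i))).rightOrthogonal := by
  refine generatedBy_le_rightOrthogonal_generatedBy ?_
  rintro _ _ ⟨⟩ ⟨a⟩ n f
  exact projObj_hom_simpleObj_eq_zero (CyclicQuiver.add_natCast_ne i a).symm n f

theorem generatedBy_projObj_le_rightOrthogonal (i : CyclicQuiver r) :
    generatedBy (ObjectProperty.singleton (projObj k r (i + 1))) ≤
      (absorbing k r i).rightOrthogonal := by
  refine generatedBy_le_rightOrthogonal_generatedBy ?_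
  rintro _ _ ⟨a⟩ ⟨⟩ n f
  exact simpleObj_hom_projObj_eq_zero (CyclicQuiver.add_natCast_ne i a) n f

theorem extensionProduct_projObj_absorbing (i : CyclicQuiver r) :
    ObjectProperty.extensionProduct
      (generatedBy (ObjectProperty.singleton (projObj k r i))) (absorbing k r i) = ⊤ :=
  extensionProduct_eq_top (absorbing_le_rightOrthogonal i)
    (eq_top_of_projObj (i := i) (le_sup_right.trans (le_generatedBy _))
      (le_generatedBy _ _ (Or.inl (le_generatedBy _ _ (by simp)))))

theorem extensionProduct_absorbing_projObj (i : CyclicQuiver r) :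
    ObjectProperty.extensionProduct (absorbing k r i)
      (generatedBy (ObjectProperty.singleton (projObj k r (i + 1)))) = ⊤ :=
  extensionProduct_eq_top (generatedBy_projObj_le_rightOrthogonal i)
    (eq_top_of_projObj_add_one (i := i) (le_sup_left.trans (le_generatedBy _))
      (le_generatedBy _ _ (Or.inr (le_generatedBy _ _ (by simp)))))

/-- 𝖲_i is the source part of the decomposition with ⟨P_{i+1}⟩, which gives the right adjoint, and
the target part of the one with ⟨P_i⟩, which gives the left adjoint. -/
theorem isAdmissible_absorbing (i : CyclicQuiver r) : IsAdmissible (absorbing k r i) where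
  isTriangulated := inferInstance
  rightAdmissible := isLeftAdjoint_ι_of_extensionProduct
    (generatedBy_projObj_le_rightOrthogonal i) (extensionProduct_absorbing_projObj i)
  leftAdmissible := isRightAdjoint_ι_of_extensionProduct
    (absorbing_le_rightOrthogonal i) (extensionProduct_projObj_absorbing i)

theorem leftOrthogonal_absorbing (i : CyclicQuiver r) : (absorbing k r i).leftOrthogonal =
    generatedBy (ObjectProperty.singleton (projObj k r i)) :=
  leftOrthogonal_eq_of_extensionProduct (absorbing_le_rightOrthogonal i)
    (extensionProduct_projObj_absorbing i)

theorem rightOrthogonal_absorbing (i : CyclicQuiver r) : (absorbing k r i).rightOrthogonal =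
    generatedBy (ObjectProperty.singleton (projObj k r (i + 1))) :=
  rightOrthogonal_eq_of_extensionProduct (generatedBy_projObj_le_rightOrthogonal i)
    (extensionProduct_absorbing_projObj i)

theorem isSemiorthogonalDecomposition (i : CyclicQuiver r) :
    IsSemiorthogonalDecomposition ![absorbing k r i,
      generatedBy (ObjectProperty.singleton (projObj k r i))] where
  isTriangulated a := by
    fin_cases a
    · exact inferInstanceAs (absorbing k r i).IsTriangulated
    · exact generatedBy_isTriangulated _
  isClosedUnderIsomorphisms a := by
    fin_cases a
    · exact inferInstanceAs (absorbing k r i).IsClosedUnderIsomorphisms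
    · exact generatedBy_isClosedUnderIsomorphisms _
  semiorthogonal a b hab := by
    obtain ⟨rfl, rfl⟩ : a = 0 ∧ b = 1 := by
      rw [Fin.lt_def] at hab
      constructor <;> ext <;> simp only [Fin.val_zero, Fin.val_one] <;> omega
    exact absorbing_le_rightOrthogonal i
  generate := by
    refine eq_top_of_projObj (i := i) ?_ ?_
    · exact (le_iSup ![absorbing k r i,
        generatedBy (ObjectProperty.singleton (projObj k r i))] 0).trans (le_generatedBy _)
    · exact le_generatedBy _ _ (le_iSup ![absorbing k r i,
        generatedBy (ObjectProperty.singleton (projObj k r i))] 1 _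
          (le_generatedBy _ _ (by simp)))

end CyclicAlgebra

/-! ### Smoothness from a trivial dg endomorphism algebra. -/

section Smooth

/-- Smoothness asks for generation as a thick subcategory. Closure under retracts bridges the gap.
-/
theorem generatedBy_eq_triangEnvelope {T : Type w} [Category.{v} T] [HasZeroObject T]
    [HasShift T ℤ] [Preadditive T] [∀ n : ℤ, (shiftFunctor T n).Additive] [Pretriangulated T]
    [IsTriangulated T] (P : ObjectProperty T) [P.Nonempty]
    [(generatedBy P).IsStableUnderRetracts] : generatedBy P = P.triangEnvelope :=
  le_antisymm (generatedBy_le P.le_triangEnvelope)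
    (P.triangEnvelope_le_iff.2 (le_generatedBy P))

open TensorProduct in
-- If A is k, every tensor is a scalar multiple of 1 ⊗ 1. This makes the diagonal bimodule free of
-- rank one.
theorem bijective_of_apply_tmul {k : Type u} [Field k] {A : Type v} [Ring A] [Algebra k A]
    (h : Function.Bijective (algebraMap k A)) (φ : A ⊗[k] A →ₗ[k] A)
    (hφ : ∀ a b : A, φ (a ⊗ₜ b) = a * b) : Function.Bijective φ := by
  refine ⟨(injective_iff_map_eq_zero φ).2 fun t ht => ?_,
    fun x => ⟨x ⊗ₜ 1, (hφ x 1).trans (mul_one x)⟩⟩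
  obtain ⟨c, rfl⟩ : ∃ c : k, t = c • ((1 : A) ⊗ₜ[k] (1 : A)) := by
    clear ht
    induction t using TensorProduct.induction_on with
    | zero => exact ⟨0, (zero_smul _ _).symm⟩
    | add x y hx hy =>
      obtain ⟨a, rfl⟩ := hx
      obtain ⟨b, rfl⟩ := hy
      exact ⟨a + b, (add_smul _ _ _).symm⟩
    | tmul a b =>
      obtain ⟨a, rfl⟩ := h.2 a
      obtain ⟨b, rfl⟩ := h.2 b
      refine ⟨a * b, ?_⟩
      rw [Algebra.algebraMap_eq_smul_one, Algebra.algebraMap_eq_smul_one,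
        TensorProduct.smul_tmul_smul]
  rw [map_smul, hφ, mul_one, ← Algebra.algebraMap_eq_smul_one] at ht
  rw [(map_eq_zero_iff _ h.1).1 ht, zero_smul]

/-- A dg algebra that is isomorphic to the ground field is smooth. -/
theorem DGAlgebra.isSmooth_of_bijective {k : Type u} [Field k] (E : DGAlgebra.{u, v} k)
    (h : Function.Bijective (algebraMap k E.carrier)) (hd : E.d 1 = 0) : E.IsSmooth :=
  DGBimodule.IsPerfect.free ⟨0, (1 : E.carrier), E.one_mem, hd,
    bijective_of_apply_tmul h _ fun a b => congrArg (a * ·) (one_mul b)⟩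

open CochainComplex.HomComplex in
-- A complex concentrated in degree zero has only cochains of degree zero, and these are its
-- endomorphisms.
theorem bijective_algebraMap_dgEnd {k : Type u} [Field k] {C : Type w} [Category.{v} C]
    [Preadditive C] [Linear k C] (K : CochainComplex C ℤ) (hK : ∀ p : ℤ, p ≠ 0 → IsZero (K.X p))
    (hK₀ : 𝟙 (K.X 0) ≠ 0) (hK' : ∀ f : K.X 0 ⟶ K.X 0, ∃ c : k, f = c • 𝟙 (K.X 0)) :
    Function.Bijective (algebraMap k (dgEnd k K).carrier) := by
  have hne {n : ℤ} (hn : n ≠ 0) (f : Cochain K K n) : f = 0 := by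
    ext p q hpq
    by_cases hp : p = 0
    · exact (hK q (by omega)).eq_of_tgt _ _
    · exact (hK p hp).eq_of_src _ _
  have hzero (f : Cochain K K 0) : ∃ c : k, f = c • Cochain.ofHom (𝟙 K) := by
    obtain ⟨c, hc⟩ := hK' (f.v 0 0 (add_zero 0))
    refine ⟨c, Cochain.ext _ _ fun p q hpq => ?_⟩
    by_cases hp : p = 0
    · obtain rfl : q = p := by omega
      subst hp
      rw [hc, Cochain.smul_v, Cochain.ofHom_v]
      rfl
    · exact (hK p hp).eq_of_src _ _
  have hone : (1 : ⨁ n : ℤ, Cochain K K n) =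
    DirectSum.of (fun n : ℤ => Cochain K K n) 0 (Cochain.ofHom (𝟙 K)) := rfl
  change Function.Bijective (algebraMap k (⨁ n : ℤ, Cochain K K n))
  constructor
  · have : Nontrivial (⨁ n : ℤ, Cochain K K n) := by
      refine ⟨1, 0, fun h => hK₀ ?_⟩
      rw [hone] at h
      have h1 := congrArg (fun x : ⨁ n : ℤ, Cochain K K n => x 0) h
      have h2 : Cochain.ofHom (𝟙 K) = 0 := by simpa using h1
      have h3 := congrArg (fun z : Cochain K K 0 => z.v 0 0 (add_zero 0)) h2
      exact (Cochain.ofHom_v (𝟙 K) 0).symm.trans h3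
    exact (algebraMap k (⨁ n : ℤ, Cochain K K n)).injective
  · intro x
    induction x using DirectSum.induction_on with
    | zero => exact ⟨0, map_zero _⟩
    | add x y hx hy =>
      obtain ⟨a, rfl⟩ := hx
      obtain ⟨b, rfl⟩ := hy
      exact ⟨a + b, map_add _ _ _⟩
    | of n f =>
      by_cases hn : n = 0
      · subst hn
        obtain ⟨c, rfl⟩ := hzero f
        refine ⟨c, ?_⟩
        rw [Algebra.algebraMap_eq_smul_one, hone, ← DirectSum.of_smul]
      · exact ⟨0, by rw [hne hn f, map_zero, map_zero]⟩

open CochainComplex.HomComplex in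
-- The Leibniz rule for 1 = 1 · 1 gives d 1 = d 1 + d 1.
theorem dgEnd_d_one {k : Type u} [Field k] {C : Type w} [Category.{v} C]
    [Preadditive C] [Linear k C] (K : CochainComplex C ℤ) : (dgEnd k K).d 1 = 0 := by
  have h := (dgEnd k K).d_mul 1 (dgEnd k K).one_mem
  rw [mul_one, mul_one, one_mul, Int.negOnePow_zero, one_smul] at h
  simpa using h

variable {k : Type u} [Field k] {R : Type u} [Ring R] [Algebra k R]
  [HasDerivedCategory.{w} (ModuleCat.{u} R)]

/-- A projective module with trivial endomorphism algebra generates a smooth subcategory. -/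
theorem isSmoothSubcategory_generatedBy {P : ModuleCat.{u} R} [Projective P]
    (hP : isFinDim k R P) (h0 : 𝟙 P ≠ 0) (hend : ∀ f : P ⟶ P, ∃ c : k, f = c • 𝟙 P)
    [hS : (generatedBy (ObjectProperty.singleton
      (BoundedDerived.of k P hP))).IsStableUnderRetracts] :
    IsSmoothSubcategory k
      (generatedBy (ObjectProperty.singleton (BoundedDerived.of k P hP))) := by
  let K : CochainComplex (ModuleCat.{u} R) ℤ :=
    (HomologicalComplex.single (ModuleCat.{u} R) (ComplexShape.up ℤ) 0).obj P
  let e : K.X 0 ≅ P := HomologicalComplex.singleObjXSelf (ComplexShape.up ℤ) 0 P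
  have hK (p : ℤ) (hp : p ≠ 0) : IsZero (K.X p) :=
    HomologicalComplex.isZero_single_obj_X (ComplexShape.up ℤ) 0 P p hp
  have hproj (n : ℤ) : Projective (K.X n) := by
    by_cases hn : n = 0
    · subst hn
      exact Projective.of_iso e.symm inferInstance
    · exact (hK n hn).projective
  have hLE : K.IsStrictlyLE 0 := by
    rw [CochainComplex.isStrictlyLE_iff]
    intro i hi
    exact hK i (by omega)
  -- P in degree zero is its own K-projective resolution, being a bounded above complex of
  -- projectives.
  refine ⟨K, BoundedDerived.of k P hP, CochainComplex.isKProjective_of_projective K 0,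
    ⟨(DerivedCategory.singleFunctorIsoCompQ (ModuleCat.{u} R) 0).app P⟩,
    generatedBy_eq_triangEnvelope _, ?_⟩
  refine DGAlgebra.isSmooth_of_bijective _ (bijective_algebraMap_dgEnd K hK ?_ ?_) (dgEnd_d_one K)
  · intro h
    apply h0
    rw [← Category.id_comp (𝟙 P), ← e.inv_hom_id, ← Category.comp_id e.inv, h]
    simp
  · intro f
    obtain ⟨c, hc⟩ := hend (e.inv ≫ f ≫ e.hom)
    refine ⟨c, ?_⟩
    rw [← cancel_epi e.inv, ← cancel_mono e.hom, Category.assoc, hc]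
    simp

end Smooth

/-! ### The complements are smooth and proper. -/

namespace CyclicAlgebra

variable {k : Type u} [Field k] {r : ℕ} [NeZero r]
  [HasDerivedCategory.{w} (ModuleCat.{u} (CyclicAlgebra k r)ᵐᵒᵖ)]

/-- Projectivity leaves only degree zero, where the endomorphisms are scalars. -/
theorem hasFiniteTotalHom_projObj (j : CyclicQuiver r) :
    HasFiniteTotalHom k (projObj k r j) (projObj k r j) := by
  refine ⟨fun n => ?_, 0, fun n hn f =>
    BoundedDerived.hom_eq_zero_of_projective (by rintro rfl; simp at hn) f⟩
  by_cases hn : n = 0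
  · subst hn
    let f : k →ₗ[k] (projObj k r j ⟶ (projObj k r j)⟦(0 : ℤ)⟧) :=
      LinearMap.toSpanSingleton k _ (ShiftedHom.mk₀ (0 : ℤ) rfl (𝟙 (projObj k r j)))
    refine Module.Finite.of_surjective f fun g => ?_
    obtain ⟨g, rfl⟩ := BoundedDerived.exists_eq_mk₀_mapOf g
    obtain ⟨c, rfl⟩ := exists_proj_hom_eq_smul g
    refine ⟨c, ?_⟩
    rw [BoundedDerived.mapOf_smul, BoundedDerived.mapOf_id]
    exact (Linear.smul_comp _ _ _ _ _ _).symm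
  · have : Subsingleton (projObj k r j ⟶ (projObj k r j)⟦n⟧) :=
      ⟨fun f g => (BoundedDerived.hom_eq_zero_of_projective hn f).trans
        (BoundedDerived.hom_eq_zero_of_projective hn g).symm⟩
    infer_instance

theorem isProperSubcategory_projObj (j : CyclicQuiver r) :
    IsProperSubcategory k (generatedBy (ObjectProperty.singleton (projObj k r j))) :=
  isProperSubcategory_generatedBy_singleton (hasFiniteTotalHom_projObj j)

theorem isSmoothSubcategory_projObj (j : CyclicQuiver r) :
    IsSmoothSubcategory k (generatedBy (ObjectProperty.singleton (projObj k r j))) := by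
  -- For every j, ⟨P_j⟩ is the left orthogonal of 𝖲_j, and left orthogonals are closed under
  -- retracts. This covers P_{i+1} too.
  have : (generatedBy (ObjectProperty.singleton (projObj k r j))).IsStableUnderRetracts := by
    rw [← leftOrthogonal_absorbing]
    infer_instance
  exact isSmoothSubcategory_generatedBy (hS := this) (isFinDim_proj k r j) (proj_id_ne_zero j)
    exists_proj_hom_eq_smul

theorem absorbsSingularities_absorbing (i : CyclicQuiver r) :
    AbsorbsSingularities k (absorbing k r i) where
  isAdmissible := isAdmissible_absorbing i
  smooth_right := by
    rw [rightOrthogonal_absorbing]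
    exact isSmoothSubcategory_projObj _
  proper_right := by
    rw [rightOrthogonal_absorbing]
    exact isProperSubcategory_projObj _
  smooth_left := by
    rw [leftOrthogonal_absorbing]
    exact isSmoothSubcategory_projObj _
  proper_left := by
    rw [leftOrthogonal_absorbing]
    exact isProperSubcategory_projObj _

end CyclicAlgebra

end

theorem theoremA (k : Type u) [Field k] (r : ℕ) [NeZero r]
    [HasDerivedCategory.{w} (ModuleCat.{u} (CyclicAlgebra k r)ᵐᵒᵖ)] (i : CyclicQuiver r) :
    (IsSemiorthogonal (CyclicAlgebra.simpleSeq k r i) ∧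
      ∀ a, IsPInftyObject k (isBoundedFinDim k (CyclicAlgebra k r)ᵐᵒᵖ).ι 2
        (CyclicAlgebra.simpleSeq k r i a)) ∧
    IsSemiorthogonalDecomposition ![CyclicAlgebra.absorbing k r i,
      generatedBy (ObjectProperty.singleton (CyclicAlgebra.projObj k r i))] ∧
    AbsorbsSingularities k (CyclicAlgebra.absorbing k r i) :=
  ⟨⟨CyclicAlgebra.isSemiorthogonal_simpleSeq i, fun a =>
      -- An index in `Fin (r - 1)` exists only if r ≥ 2.
      CyclicAlgebra.isPInftyObject_simpleObj _ (by have := a.2; omega)⟩,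
    CyclicAlgebra.isSemiorthogonalDecomposition i,
    CyclicAlgebra.absorbsSingularities_absorbing i⟩
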